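/- Let $M$ be a smooth manifold of dimension $n\ge 1$ and $\pi:\Phi\to M$ a smooth fibre bundle with $N$-dimensional fibres (more generally, a smooth fibred manifold: around every point of $\Phi$ there are coordinates $(x^\mu,\varphi^K)$ adapted to $\pi$). Let $k\ge 1$ be the order of the theory and put $$\mathcal Q:=J^{k-1}\Phi,\qquad \mathcal P:=V^*\mathcal Q\otimes_{\mathcal Q}\Lambda^{n-1}M,\qquad \Pi:\mathcal P\to\mathcal Q,\qquad \mathcal Q^I:=J^k\Phi\subset J^1\mathcal Q .$$ In adapted coordinates a momentum is written $$p=\sum_{l=0}^{k-1}\ \sum_{\mu_1,\dots,\mu_l,\lambda} p_K^{\mu_1\dots\mu_l\lambda}\,\delta\varphi^K_{\mu_1\dots\mu_l}\otimes d_\lambda ,\qquad p_K^{\mu_1\dots\mu_l\lambda}=p_K^{(\mu_1\dots\mu_l)\lambda},$$ where $d_\lambda$ is the $(n-1)$-covector with $dx^\lambda\wedge d_\lambda=d^nx$ and round brackets denote complete symmetrisation. On each fibre of $J^1\mathcal P$ over $M$ consider the $\Lambda^nM$-valued two-form $$\widetilde{\widetilde\omega}{}^I=\sum\left(\delta p^{\bar\mu\lambda}{}_{,\lambda}\wedge\delta\varphi_{\bar\mu}+\delta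 p^{\bar\mu\lambda}\wedge\delta\varphi_{\bar\mu,\lambda}\right)\otimes d^nx ,$$ the sum being over the fibre coordinates $\varphi_{\bar\mu}$ of $\mathcal Q$ and over $\lambda$, with $p^{\bar\mu\lambda}$ the coefficient of $\delta\varphi_{\bar\mu}\otimes d_\lambda$ in $p$. For a sub-bundle $\mathcal S\subseteq\mathcal P$ let $\widetilde{\mathcal S}^I$ be the part of $J^1\mathcal S\subseteq J^1\mathcal P$ lying over the holonomic jets $\mathcal Q^I\subset J^1\mathcal Q$, let $\widetilde\omega^I$ be the restriction of the two-form to the fibres of $\widetilde{\mathcal S}^I$ over $M$, and let $\mathcal S^I:=\widetilde{\mathcal S}^I/(\text{degeneracy of }\widetilde\omega^I)$ be the leaf space of its degeneracy distribution: two points are identified if they can be joined by a curve that stays in one fibre over $M$ and is everywhere tangent to the kernel of $\widetilde\omega^I$. For $\mathcal S=\mathcal P$ this gives $\widetilde{\mathcal P}^I$ and the infinitesimal phase bundle $\mathcal P^I$. A map from a Euclidean space into such a leaf space is called smooth if it locally lifts to a smooth map into $\widetilde{\mathcal S}^I$ (respectively $\widetilde{\mathcal P}^I$). Let $\mathcal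 S\subset\mathcal P$ be a sub-bundle of totally symmetric momenta; that is, either (a) around every point of $M$ there are coordinates $x^\mu$ in which $\mathcal S$ is given by the equations $p_K^{\mu_1\dots\mu_l\lambda}=p_K^{(\mu_1\dots\mu_l\lambda)}$ for all $0\le l\le k-1$; or (b) $\mathcal S$ is the intrinsically defined sub-bundle given by the requirement that the highest-order part of the momentum, an element of $S^{k-1}TM\otimes TM\otimes\Lambda^nM\otimes V^*\Phi$, lies in $S^kTM\otimes\Lambda^nM\otimes V^*\Phi$. Then the inclusion $\widetilde{\mathcal S}^I\subseteq\widetilde{\mathcal P}^I$ induces a bijection $\mathcal S^I\to\mathcal P^I$, $[\zeta]\mapsto[\zeta]$. This bijection covers the identity of $\mathcal Q^I$, is linear on the fibres over $\mathcal Q^I$, is smooth with smooth inverse, and identifies the two-forms induced by $\widetilde\omega^I$ on the leaf spaces. Thus $\mathcal S^I\cong\mathcal P^I$. Moreover the non-symmetric parts of the momenta are pure gauge: if two points of $\widetilde{\mathcal P}^I$ over the same point of $M$ have, in some adapted coordinates, the same $\varphi_{\bar\mu}$, $\varphi_{\bar\mu,\lambda}$ and $p^{\bar\mu\lambda}{}_{,\nu}$,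 and the same symmetrised momenta $p_K^{(\mu_1\dots\mu_l\lambda)}$ for $0\le l\le k-1$, then they define the same point of $\mathcal P^I$. -/

import Mathlib

open Set Filter Topology
open scoped Manifold ContDiff

noncomputable section

namespace HigherOrderPhase

/-! ### Fibred charts and bundles described by them

The base `M` has dimension `n = m + 1`, the fibres of `π : Φ → M` have dimension `N`. -/

/-- Adapted coordinates `(x^μ, φ^K)` for `π : Φ → M`: a smooth chart `base` of `M` and a smooth chart
`total` of `Φ` whose first `m + 1` coordinates are the coordinates `x^μ ∘ π`. -/
structure FibredChart (m N : ℕ) {M Φ : Type*}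
    [TopologicalSpace M] [ChartedSpace (EuclideanSpace ℝ (Fin (m + 1))) M]
    [TopologicalSpace Φ] [ChartedSpace (EuclideanSpace ℝ (Fin (m + 1 + N))) Φ]
    (π : Φ → M) where
  base : OpenPartialHomeomorph M (EuclideanSpace ℝ (Fin (m + 1)))
  total : OpenPartialHomeomorph Φ (EuclideanSpace ℝ (Fin (m + 1 + N)))
  base_mem : base ∈ IsManifold.maximalAtlas (𝓡 (m + 1)) ∞ M
  total_mem : total ∈ IsManifold.maximalAtlas (𝓡 (m + 1 + N)) ∞ Φ
  mapsTo : ∀ y ∈ total.source, π y ∈ base.source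
  coord_eq : ∀ y ∈ total.source, ∀ μ : Fin (m + 1), total y (Fin.castAdd N μ) = base (π y) μ

variable {m N : ℕ} {M Φ : Type*}
  [TopologicalSpace M] [ChartedSpace (EuclideanSpace ℝ (Fin (m + 1))) M]
  [TopologicalSpace Φ] [ChartedSpace (EuclideanSpace ℝ (Fin (m + 1 + N))) Φ]
  {π : Φ → M}

variable (m N π) in
/-- The data of a bundle `B → M` in coordinates: every fibred chart `e` of `Φ` gives the fibre
coordinates `coord e` on the part `dom e` of `B`. All bundles below (`Φ`, its jet bundles, the phase
bundle and its jet bundle) are of this kind. -/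
structure BundleCoords (B : Type*) (ι : Type) where
  proj : B → M
  dom : FibredChart m N π → Set B
  coord : FibredChart m N π → B → ι → ℝ

variable (m N π) in
/-- The bundle `Φ` itself, with its fibre coordinates `φ^K`. -/
def fieldB : BundleCoords m N π Φ (Fin N) where
  proj := π
  dom e := e.total.source
  coord e y K := e.total y (Fin.natAdd (m + 1) K)

namespace BundleCoords

variable {B : Type*} {ι : Type} [Fintype ι] (X : BundleCoords m N π B ι)

/-- Smoothness at `u` of a map from a normed space to the bundle manifold. -/
def SmoothAt {G : Type*} [NormedAddCommGroup G] [NormedSpace ℝ G] (c : G → B) (u : G) : Prop :=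
  ∀ e, c u ∈ X.dom e → (∀ᶠ w in 𝓝 u, c w ∈ X.dom e) ∧
    ContDiffAt ℝ ∞ (fun w => (e.base (X.proj (c w)), X.coord e (c w))) u

/-- The coordinate expression of a section. -/
def rep (e : FibredChart m N π) (s : M → B) (z : EuclideanSpace ℝ (Fin (m + 1))) : ι → ℝ :=
  X.coord e (s (e.base.symm z))

/-- `s` is a smooth section of the bundle in a neighbourhood of `x`. -/
def IsSection (s : M → B) (x : M) : Prop :=
  (∀ᶠ y in 𝓝 x, X.proj (s y) = y) ∧
    ∀ e, s x ∈ X.dom e → ∀ᶠ y in 𝓝 x, s y ∈ X.dom e ∧ ContDiffAt ℝ ∞ (X.rep e s) (e.base y)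

end BundleCoords

/-! ### Jets of sections -/

section Jets

variable {B : Type*} {ι : Type} [Fintype ι] (X : BundleCoords m N π B ι)

/-- Two local sections have the same `k`-jet at `x`: same value and same derivatives up to order `k`
in all fibred charts. -/
def jetSetoid (k : ℕ) (x : M) : Setoid {s : M → B // X.IsSection s x} where
  r s t := s.1 x = t.1 x ∧ ∀ e, s.1 x ∈ X.dom e → ∀ l ≤ k,
    iteratedFDeriv ℝ l (X.rep e s.1) (e.base x) = iteratedFDeriv ℝ l (X.rep e t.1) (e.base x)
  iseqv :=
    { refl := fun _ => ⟨rfl, fun _ _ _ _ => rfl⟩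
      symm := fun h => ⟨h.1.symm, fun e he l hl => (h.2 e (h.1 ▸ he) l hl).symm⟩
      trans := fun h h' => ⟨h.1.trans h'.1, fun e he l hl =>
        (h.2 e he l hl).trans (h'.2 e (h.1 ▸ he) l hl)⟩ }

/-- The total space of the bundle `J^k X → M`. -/
def Jet (k : ℕ) : Type _ := Σ x : M, Quotient (jetSetoid X k x)

variable {X} in
/-- The `k`-jet `j^k_x s`. -/
def Jet.mk (k : ℕ) (s : M → B) {x : M} (hs : X.IsSection s x) : Jet X k :=
  ⟨x, Quotient.mk (jetSetoid X k x) ⟨s, hs⟩⟩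

variable {X} in
/-- The projection `J^k X → X`. -/
def Jet.target {k : ℕ} (ζ : Jet X k) : B :=
  Quotient.lift (s := jetSetoid X k ζ.1) (fun s => s.1 ζ.1) (fun _ _ h => h.1) ζ.2

/-- Labels `μ₁ ≤ … ≤ μ_l`, `l ≤ k`, of the independent partial derivatives of order at most `k` in
`n` variables. -/
abbrev JetIdx (n k : ℕ) : Type := Σ l : Fin (k + 1), {μ : Fin l → Fin n // Monotone μ}

instance (n k : ℕ) : Fintype (JetIdx n k) := by
  classical
  infer_instance

/-- The nondecreasing rearrangement of `μ₁, …, μ_l`; it labels the symmetric coordinate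
`φ_{μ₁ … μ_l}`. -/
def sorted {l n : ℕ} (μ : Fin l → Fin n) : {μ : Fin l → Fin n // Monotone μ} :=
  ⟨μ ∘ Tuple.sort μ, Tuple.monotone_sort μ⟩

/-- The `k`-th jet bundle, with its coordinates `φ_{μ₁ … μ_l} = ∂_{μ₁} ⋯ ∂_{μ_l} φ`, `l ≤ k`. On `dom e`
the coordinates do not depend on the section chosen to represent the jet. -/
def jetB (k : ℕ) : BundleCoords m N π (Jet X k) (ι × JetIdx (m + 1) k) where
  proj ζ := ζ.1
  dom e := {ζ | ζ.target ∈ X.dom e}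
  coord e ζ a := iteratedFDeriv ℝ (a.2.1 : ℕ) (X.rep e (Quotient.out ζ.2).1) (e.base ζ.1)
    (fun j => EuclideanSpace.single (a.2.2.1 j) 1) a.1

end Jets

/-! ### Vertical vectors and the phase bundle of a bundle -/

section Covectors

variable {B : Type*} {ι : Type} [Fintype ι] (X : BundleCoords m N π B ι)

/-- `v`, given by its components in all charts around `b`, is the velocity at `b` of a smooth curve in
the fibre of `X` through `b`. -/
def IsVelocity (b : B) (v : {e // b ∈ X.dom e} → ι → ℝ) : Prop :=
  ∃ c : ℝ → B, X.SmoothAt c 0 ∧ c 0 = b ∧ (∀ᶠ t in 𝓝 0, X.proj (c t) = X.proj b) ∧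
    ∀ e, deriv (fun t => X.coord e.1 (c t)) 0 = v e

/-- The vertical tangent space at `b`, i.e. the tangent space at `b` of the fibre through `b`. -/
def VertTangent (b : B) : Submodule ℝ ({e // b ∈ X.dom e} → ι → ℝ) :=
  Submodule.span ℝ {v | IsVelocity X b v}

/-- The coordinate vector `∂/∂φ^i` at `b`. -/
def coordVec (e : FibredChart m N π) (b : B) (i : ι) : VertTangent X b := by
  classical
  exact Classical.epsilon fun v => ∃ h : b ∈ X.dom e, v.1 ⟨e, h⟩ = Pi.single i 1

/-- The coordinate vector `∂_μ` at the point `x` of `M`. -/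
def baseVec (e : FibredChart m N π) (x : M) (μ : Fin (m + 1)) : TangentSpace (𝓡 (m + 1)) x :=
  mfderiv 𝓘(ℝ, EuclideanSpace ℝ (Fin (m + 1))) (𝓡 (m + 1)) e.base.symm (e.base x)
    (EuclideanSpace.single μ 1 : EuclideanSpace ℝ (Fin (m + 1)))

/-- The total space of `V^*X ⊗ Λ^{n-1} M`: a point is a point `b` of `X` with a linear map from the
vertical tangent space at `b` to the `(n - 1)`-covectors of `M` (recall `n = m + 1`). -/
def Cov : Type _ :=
  Σ b : B, VertTangent X b →ₗ[ℝ] ((TangentSpace (𝓡 (m + 1)) (X.proj b)) [⋀^Fin m]→L[ℝ] ℝ)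

/-- The bundle `V^*X ⊗ Λ^{n-1} M`. Its coordinates are those of `X` and the momenta `p^λ_i`, given by
`p = p^λ_i δφ^i ⊗ d_λ`, where `d_λ` is the `(n - 1)`-covector with `dx^λ ∧ d_λ = d^n x`. -/
def covB : BundleCoords m N π (Cov X) (ι ⊕ ι × Fin (m + 1)) where
  proj p := X.proj p.1
  dom e := {p | p.1 ∈ X.dom e}
  coord e p a := match a with
    | Sum.inl i => X.coord e p.1 i
    | Sum.inr (i, lam) => (-1) ^ (lam : ℕ) *
        p.2 (coordVec X e p.1 i) (fun j => baseVec e (X.proj p.1) (lam.succAbove j))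

/-- In first-order jets: the label of the value. -/
def ix0 : JetIdx (m + 1) 1 := ⟨0, sorted Fin.elim0⟩

/-- In first-order jets: the label of the derivative in direction `lam`. -/
def ix1 (lam : Fin (m + 1)) : JetIdx (m + 1) 1 := ⟨1, sorted fun _ => lam⟩

/-- The two-form
`(δp^λ_{i,λ} ∧ δφ^i + δp^λ_i ∧ δφ^i_{,λ}) ⊗ d^n x` on the fibres over `M` of the first jet bundle of
`V^*X ⊗ Λ^{n-1} M`, as the coefficient of `d^n x`, evaluated on two vectors given by components. -/
def omega (u v : (ι ⊕ ι × Fin (m + 1)) × JetIdx (m + 1) 1 → ℝ) : ℝ :=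
  ∑ i : ι, ∑ lam : Fin (m + 1),
    ((u (Sum.inr (i, lam), ix1 lam) * v (Sum.inl i, ix0)
        - v (Sum.inr (i, lam), ix1 lam) * u (Sum.inl i, ix0))
      + (u (Sum.inr (i, lam), ix0) * v (Sum.inl i, ix1 lam)
        - v (Sum.inr (i, lam), ix0) * u (Sum.inl i, ix1 lam)))

end Covectors

/-! ### The theory of order `k + 1` -/

section Theory

variable (m N π) in
/-- The configuration bundle `Q = J^k Φ` of the theory of order `k + 1`. -/
abbrev confB (k : ℕ) := jetB (fieldB m N π) k

variable (m N π) in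
/-- The total space of the phase bundle `P = V^*Q ⊗ Λ^{n-1} M`. -/
abbrev Phase (k : ℕ) := Cov (confB m N π k)

variable (m N π) in
/-- The phase bundle, as a bundle over `M`. -/
abbrev phaseB (k : ℕ) := covB (confB m N π k)

variable (m N π) in
/-- The total space of `J^1 P`. -/
abbrev PhaseJet (k : ℕ) := Jet (phaseB m N π k) 1

variable (m N π) in
/-- The bundle `J^1 P`. -/
abbrev phaseJetB (k : ℕ) := jetB (phaseB m N π k) 1

variable {k : ℕ}

/-- The tensor component `p^{μ₁ … μ_l λ}_K`, symmetric in `μ₁, …, μ_l`, of a momentum, where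
`(μ₁, …, μ_l, λ) = ν` and `p = ∑_l ∑_{μ₁, …, μ_l, λ} p^{μ₁ … μ_l λ}_K δφ^K_{μ₁ … μ_l} ⊗ d_λ`. As this sum runs
over all sequences `μ`, the coefficient of an independent `δφ` is divided by the number of
sequences that label it. -/
def momentum (e : FibredChart m N π) (p : Phase m N π k) (K : Fin N) (l : Fin (k + 1))
    (ν : Fin (l + 1) → Fin (m + 1)) : ℝ :=
  (phaseB m N π k).coord e p (Sum.inr ((K, ⟨l, sorted (Fin.init ν)⟩), ν (Fin.last l))) /
    Nat.card {μ : Fin l → Fin (m + 1) // sorted μ = sorted (Fin.init ν)}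

/-- The complete symmetrisation `p^{(μ₁ … μ_l λ)}_K`. -/
def symMomentum (e : FibredChart m N π) (p : Phase m N π k) (K : Fin N) (l : Fin (k + 1))
    (ν : Fin (l + 1) → Fin (m + 1)) : ℝ :=
  (∑ σ : Equiv.Perm (Fin (l + 1)), momentum e p K l (ν ∘ σ)) / Nat.factorial (l + 1)

/-- `p^{μ₁ … μ_l λ}_K = p^{(μ₁ … μ_l λ)}_K` in the chart `e`, for the given `l`. -/
def IsSymmetricAt (e : FibredChart m N π) (p : Phase m N π k) (l : Fin (k + 1)) : Prop :=
  ∀ K ν, momentum e p K l ν = symMomentum e p K l ν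

/-- `S` is a sub-bundle of totally symmetric momenta: around every point of `M` there are coordinates
`x^μ` in which `S` is given by `p^{μ₁ … μ_l λ}_K = p^{(μ₁ … μ_l λ)}_K` for all `0 ≤ l ≤ k`. -/
def IsTotallySymmetric (S : Set (Phase m N π k)) : Prop :=
  ∀ x : M, ∃ c ∈ IsManifold.maximalAtlas (𝓡 (m + 1)) ∞ M, x ∈ c.source ∧
    ∀ p : Phase m N π k, (phaseB m N π k).proj p ∈ c.source →
      (p ∈ S ↔ ∀ e : FibredChart m N π, e.base = c → p ∈ (phaseB m N π k).dom e →
        ∀ l, IsSymmetricAt e p l)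

variable (m N π k) in
/-- The intrinsically defined sub-bundle: the part of the momentum in
`S^k TM ⊗ TM ⊗ Λ^n M ⊗ V^*Φ` (its highest-order part) lies in `S^{k+1} TM ⊗ Λ^n M ⊗ V^*Φ`. This is a
tensorial condition, and may be tested in any chart. -/
def topSymmetric : Set (Phase m N π k) :=
  {p | ∀ e, p ∈ (phaseB m N π k).dom e → IsSymmetricAt e p (Fin.last k)}

/-- `ζ ∈ J^1 P` lies over the holonomic jet `q ∈ Q^I = J^{k+1} Φ`: there are a section `s` of `Φ`
with `q = j^{k+1} s` and a section `p` of `P` with `ζ = j^1 p` and `Π ∘ p = j^k s`. -/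
def LiesOver (ζ : PhaseJet m N π k) (q : Jet (fieldB m N π) (k + 1)) : Prop :=
  ∃ (x : M) (s : M → Φ) (hs : (fieldB m N π).IsSection s x)
    (p : M → Phase m N π k) (hp : (phaseB m N π k).IsSection p x),
    ζ = Jet.mk 1 p hp ∧ q = Jet.mk (k + 1) s hs ∧
      ∀ᶠ y in 𝓝 x, ∃ h : (fieldB m N π).IsSection s y, (p y).1 = Jet.mk k s h

/-- `J^1 S ⊆ J^1 P`, the jets of those sections of `P` that take values in `S`. -/
def firstJets (S : Set (Phase m N π k)) : Set (PhaseJet m N π k) :=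
  {ζ | ∃ (x : M) (p : M → Phase m N π k) (hp : (phaseB m N π k).IsSection p x),
    ζ = Jet.mk 1 p hp ∧ ∀ᶠ y in 𝓝 x, p y ∈ S}

/-- `J^1 S` restricted to the holonomic jets `Q^I = J^{k+1} Φ ⊆ J^1 Q`. -/
def holonomic (S : Set (Phase m N π k)) : Set (PhaseJet m N π k) :=
  firstJets S ∩ {ζ | ∃ q, LiesOver ζ q}

theorem holonomic_mono {S S' : Set (Phase m N π k)} (h : S ⊆ S') : holonomic S ⊆ holonomic S' := by
  rintro ζ ⟨⟨x, p, hp, hζ, hS⟩, hq⟩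
  exact ⟨⟨x, p, hp, hζ, hS.mono fun _ hy => h hy⟩, hq⟩

/-- A smooth curve in the fibre of `holonomic S` over the point `x` of `M`. -/
structure IsFibreCurve (S : Set (Phase m N π k)) (x : M) (c : ℝ → PhaseJet m N π k) : Prop where
  smooth : ∀ t, (phaseJetB m N π k).SmoothAt c t
  mem : ∀ t, c t ∈ holonomic S
  proj : ∀ t, (phaseJetB m N π k).proj (c t) = x

/-- The components of the velocity of a curve. -/
def velocity (e : FibredChart m N π) (c : ℝ → PhaseJet m N π k) (t : ℝ) :=
  deriv (fun t => (phaseJetB m N π k).coord e (c t)) t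

/-- `a` and `b` are joined by a curve in a fibre of `holonomic S` which is everywhere tangent to the
degeneracy (the kernel) of the restriction of the two-form to that fibre. -/
def LeafRel (S : Set (Phase m N π k)) (a b : holonomic S) : Prop :=
  ∃ (x : M) (c : ℝ → PhaseJet m N π k), IsFibreCurve S x c ∧ c 0 = a ∧ c 1 = b ∧
    ∀ t, ∀ γ : ℝ → PhaseJet m N π k, IsFibreCurve S x γ → γ 0 = c t →
      ∀ e, c t ∈ (phaseJetB m N π k).dom e → omega (velocity e c t) (velocity e γ 0) = 0

/-- The leaf space of the degeneracy distribution of the two-form on `holonomic S`. For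
`S = P` it is the infinitesimal phase bundle `P^I`. -/
def Reduced (S : Set (Phase m N π k)) : Type _ := Quot (LeafRel S)

/-- The leaf through a point. -/
def leaf (S : Set (Phase m N π k)) (ζ : holonomic S) : Reduced S := Quot.mk _ ζ

/-- Smooth maps into the leaf space: those which locally lift to smooth maps into `holonomic S`. -/
def IsSmoothMap (S : Set (Phase m N π k)) {d : ℕ} (c : EuclideanSpace ℝ (Fin d) → Reduced S) :
    Prop :=
  ∀ u, ∃ c' : EuclideanSpace ℝ (Fin d) → PhaseJet m N π k, ∀ᶠ w in 𝓝 u,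
    (phaseJetB m N π k).SmoothAt c' w ∧ ∃ h : c' w ∈ holonomic S, c w = leaf S ⟨c' w, h⟩

/-- `ζ₃ = a ζ₁ + b ζ₂` in a fibre of the vector bundle `J^1 P → J^1 Q`: the `ζ_i` are jets of
sections `p_i` of `P` over one section of `Q`, and `p₃ = a p₁ + b p₂`. -/
def IsLinComb (a b : ℝ) (ζ₁ ζ₂ ζ₃ : PhaseJet m N π k) : Prop :=
  ∃ (x : M) (p₁ p₂ p₃ : M → Phase m N π k) (h₁ : (phaseB m N π k).IsSection p₁ x)
    (h₂ : (phaseB m N π k).IsSection p₂ x) (h₃ : (phaseB m N π k).IsSection p₃ x),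
    ζ₁ = Jet.mk 1 p₁ h₁ ∧ ζ₂ = Jet.mk 1 p₂ h₂ ∧ ζ₃ = Jet.mk 1 p₃ h₃ ∧
    ∀ᶠ y in 𝓝 x, ∃ q ξ₁ ξ₂, p₁ y = ⟨q, ξ₁⟩ ∧ p₂ y = ⟨q, ξ₂⟩ ∧ p₃ y = ⟨q, a • ξ₁ + b • ξ₂⟩

/-- `F` is an isomorphism of linear bundles over `Q^I` which preserves the reduced two-forms. -/
structure IsSymplecticBundleIso {S S' : Set (Phase m N π k)} (F : Reduced S ≃ Reduced S') : Prop where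
  /-- `F` covers the identity of `Q^I`. -/
  covers : ∀ (ζ : holonomic S) (η : holonomic S'), F (leaf S ζ) = leaf S' η →
    ∀ q, LiesOver ζ.1 q ↔ LiesOver η.1 q
  /-- `F` is linear on the fibres over `Q^I`. -/
  linear : ∀ (a b : ℝ) (ζ₁ ζ₂ ζ₃ : holonomic S) (η₁ η₂ η₃ : holonomic S'),
    IsLinComb a b ζ₁.1 ζ₂.1 ζ₃.1 → IsLinComb a b η₁.1 η₂.1 η₃.1 →
    F (leaf S ζ₁) = leaf S' η₁ → F (leaf S ζ₂) = leaf S' η₂ → F (leaf S ζ₃) = leaf S' η₃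
  /-- `F` and its inverse are smooth. -/
  smooth : ∀ (d : ℕ) (c : EuclideanSpace ℝ (Fin d) → Reduced S),
    IsSmoothMap S c ↔ IsSmoothMap S' (F ∘ c)
  /-- The two-forms agree on tangent vectors which correspond to each other under `F`. In
  particular (take `F` the identity) they descend to the leaf spaces. -/
  symplectic : ∀ (x : M) (c₁ c₂ d₁ d₂ : ℝ → PhaseJet m N π k)
    (hc₁ : IsFibreCurve S x c₁) (hc₂ : IsFibreCurve S x c₂)
    (hd₁ : IsFibreCurve S' x d₁) (hd₂ : IsFibreCurve S' x d₂), c₁ 0 = c₂ 0 → d₁ 0 = d₂ 0 →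
    (∀ t, F (leaf S ⟨c₁ t, hc₁.mem t⟩) = leaf S' ⟨d₁ t, hd₁.mem t⟩) →
    (∀ t, F (leaf S ⟨c₂ t, hc₂.mem t⟩) = leaf S' ⟨d₂ t, hd₂.mem t⟩) →
    ∀ e, c₁ 0 ∈ (phaseJetB m N π k).dom e → d₁ 0 ∈ (phaseJetB m N π k).dom e ∧
      omega (velocity e c₁ 0) (velocity e c₂ 0) = omega (velocity e d₁ 0) (velocity e d₂ 0)

/-- In the chart `e`, the points `ζ` and `η` of `J^1 P` have the same coordinates, except that the
momenta themselves (not their derivatives) may differ in their non-symmetric parts. -/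
def DifferByNonsymmetric (e : FibredChart m N π) (ζ η : PhaseJet m N π k) : Prop :=
  (phaseJetB m N π k).proj ζ = (phaseJetB m N π k).proj η ∧
  (∀ i j, (phaseJetB m N π k).coord e ζ (Sum.inl i, j) =
    (phaseJetB m N π k).coord e η (Sum.inl i, j)) ∧
  (∀ i lam, (phaseJetB m N π k).coord e ζ (Sum.inr i, ix1 lam) =
    (phaseJetB m N π k).coord e η (Sum.inr i, ix1 lam)) ∧
  ∀ K l ν, symMomentum e ζ.target K l ν = symMomentum e η.target K l ν

end Theory

end HigherOrderPhase

end

open HigherOrderPhase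

/-! Work in one fibred chart. Over holonomic jets the configuration part of a tangent vector lies in
the linear space `holo` of jets `j^1 j^k f`, and the two-form is an antisymmetrised bilinear pairing
of momenta with configurations, `ω(u, v) = pair (mom u) (conf v) - pair (mom v) (conf u)`
(`omega_eq_pair`). The pairing is the divergence of `p^λ_i φ^i`. On the jet of `f`, its
undifferentiated momenta contract the tensor `p^{μ₁ … μ_l λ}` with the symmetric derivative `∂_{μ₁}
⋯ ∂_{μ_l} ∂_λ f` (`pair_jc_jc`). Hence only symmetrised momenta enter (`pair_eq_of_symTens_eq`),
while totally symmetric momenta and their first derivatives already detect every derivative of `f`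
of order at most `k + 1` (`eq_zero_of_pair_eq_zero`).

Consequently a tangent vector is degenerate exactly when its configuration part vanishes and its
momentum part annihilates `holo`. This holds for every admissible `S`, since the tangent momenta
always contain the totally symmetric ones. A leaf is therefore determined by the configuration
coordinates and the functional `pair (mom ζ)` on `holo`; this is the relation `SameLeaf`
(`leaf_eq_of_sameLeaf`, `sameLeaf_of_leaf_eq`). The criterion does not mention `S`, so the induced
map of leaf spaces is well defined and injective. It is surjective because, by finite-dimensional
duality, symmetric momenta realise every functional on `holo`; a linear choice of such momenta
(`exists_symmetrisation`) also lifts smooth maps. Linearity and the two-forms are expressed through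
the same invariants.

Two facts make this global. First, `pair` is the divergence of a vector density, that is, the
exterior derivative of an `(n - 1)`-form. Exterior derivatives commute with pullback, so a change of
chart multiplies the pairing by a nonzero Jacobian determinant (`pair_trans`,
`SameLeaf.change_chart`). Secondly, symmetry of momenta is detected by their action on variations
`x^a η`: the contraction with `j^k (x^a η)`, a vector density with index `b`, must be symmetric in
`a` and `b` (`mem_symSub_iff_symTest`). This transforms tensorially as long as the change of base
coordinates is affine to sufficiently high order (`symTest_trans`), which covers the top level in
all charts and all levels when the base coordinates are kept.

The remaining work shows that jet bundles and phase bundles really have smooth coordinates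
(`jetB_nice`, `covB_nice`) and that in adapted charts the holonomic jets form a linear space
(`mem_holonomic_iff`). -/

namespace HigherOrderPhase

/-! ### Equality of jets of functions between vector spaces -/

section JetEq

variable {E F G : Type*} [NormedAddCommGroup E] [NormedSpace ℝ E] [NormedAddCommGroup F]
  [NormedSpace ℝ F] [NormedAddCommGroup G] [NormedSpace ℝ G]

/-- The derivatives of `f` and `g` of order less than `r` agree at `z`. -/
def JetEq (r : ℕ) (f g : E → F) (z : E) : Prop :=
  ∀ l < r, iteratedFDeriv ℝ l f z = iteratedFDeriv ℝ l g z

theorem JetEq.refl (r : ℕ) (f : E → F) (z : E) : JetEq r f f z := fun _ _ => rfl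

theorem JetEq.symm {r : ℕ} {f g : E → F} {z : E} (h : JetEq r f g z) : JetEq r g f z :=
  fun l hl => (h l hl).symm

theorem JetEq.trans {r : ℕ} {f g k : E → F} {z : E} (h : JetEq r f g z) (h' : JetEq r g k z) :
    JetEq r f k z :=
  fun l hl => (h l hl).trans (h' l hl)

theorem JetEq.of_eventuallyEq {r : ℕ} {f g : E → F} {z : E} (h : f =ᶠ[𝓝 z] g) : JetEq r f g z :=
  fun l _ => (h.iteratedFDeriv ℝ l).eq_of_nhds

theorem JetEq.mono {r r' : ℕ} {f g : E → F} {z : E} (h : JetEq r f g z) (hr : r' ≤ r) :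
    JetEq r' f g z :=
  fun l hl => h l (hl.trans_le hr)

theorem JetEq.eq {r : ℕ} {f g : E → F} {z : E} (h : JetEq r f g z) (hr : 0 < r) : f z = g z := by
  have := congrArg (fun q => q (fun _ => 0)) (h 0 hr)
  simpa [iteratedFDeriv_zero_apply] using this

theorem natCast_le_infty (i : ℕ) : ((i : ℕ∞) : ℕ∞ω) ≤ ∞ := by
  exact_mod_cast le_top

theorem natCast_ne_infty (i : ℕ) : ((i : ℕ∞) : ℕ∞ω) ≠ ∞ := by
  simp

theorem JetEq.comp_left {r : ℕ} {f g : E → F} {z : E} {h : F → G} (H : JetEq r f g z)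
    (hf : ContDiffAt ℝ ∞ f z) (hg : ContDiffAt ℝ ∞ g z) (hh : ContDiffAt ℝ ∞ h (f z)) :
    JetEq r (h ∘ f) (h ∘ g) z := by
  intro l hl
  have h0 : f z = g z := H.eq (by omega)
  rw [iteratedFDeriv_comp hh hf (natCast_le_infty l),
    iteratedFDeriv_comp (h0 ▸ hh) hg (natCast_le_infty l), h0]
  simp only [FormalMultilinearSeries.taylorComp]
  refine Finset.sum_congr rfl fun c _ => ?_
  ext v
  simp only [FormalMultilinearSeries.compAlongOrderedFinpartition_apply]
  congr 1
  ext j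
  simp only [OrderedFinpartition.applyOrderedFinpartition, ftaylorSeries]
  rw [H _ ((c.partSize_le j).trans_lt hl)]

theorem JetEq.comp_right {r : ℕ} {f g : F → G} {z : E} {h : E → F} (H : JetEq r f g (h z))
    (hf : ContDiffAt ℝ ∞ f (h z)) (hg : ContDiffAt ℝ ∞ g (h z)) (hh : ContDiffAt ℝ ∞ h z) :
    JetEq r (f ∘ h) (g ∘ h) z := by
  intro l hl
  rw [iteratedFDeriv_comp hf hh (natCast_le_infty l), iteratedFDeriv_comp hg hh
    (natCast_le_infty l)]
  simp only [FormalMultilinearSeries.taylorComp]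
  refine Finset.sum_congr rfl fun c _ => ?_
  ext v
  simp only [FormalMultilinearSeries.compAlongOrderedFinpartition_apply, ftaylorSeries]
  rw [H _ (c.length_le.trans_lt hl)]

theorem JetEq.prodMk {r : ℕ} {f g : E → F} {f' g' : E → G} {z : E} (H : JetEq r f g z)
    (H' : JetEq r f' g' z) (hf : ContDiffAt ℝ ∞ f z) (hg : ContDiffAt ℝ ∞ g z)
    (hf' : ContDiffAt ℝ ∞ f' z) (hg' : ContDiffAt ℝ ∞ g' z) :
    JetEq r (fun w => (f w, f' w)) (fun w => (g w, g' w)) z := by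
  intro l hl
  rw [iteratedFDeriv_prodMk hf hf' (natCast_le_infty l),
    iteratedFDeriv_prodMk hg hg' (natCast_le_infty l), H l hl, H' l hl]

theorem iteratedFDeriv_zero' (i : ℕ) : iteratedFDeriv ℝ i (0 : E → F) = 0 :=
  iteratedFDeriv_fun_zero

/-- Orders of vanishing add up under bilinear products. -/
theorem JetEq.bilinear_zero {a b : ℕ} (B : F →L[ℝ] G →L[ℝ] E) {D : Type*} [NormedAddCommGroup D]
    [NormedSpace ℝ D] {f : D → F} {g : D → G} {z : D} (hf : ContDiff ℝ ∞ f)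
    (hg : ContDiff ℝ ∞ g) (Hf : JetEq a f 0 z) (Hg : JetEq b g 0 z) :
    JetEq (a + b) (fun w => B (f w) (g w)) 0 z := by
  intro l hl
  rw [iteratedFDeriv_zero', Pi.zero_apply, ← norm_le_zero_iff]
  refine (B.norm_iteratedFDeriv_le_of_bilinear hf hg z (natCast_le_infty l)).trans (le_of_eq ?_)
  rw [Finset.sum_eq_zero, mul_zero]
  intro i hi
  rcases lt_or_ge i a with h | h
  · rw [Hf i h, iteratedFDeriv_zero']; simp
  · rw [Hg (l - i) (by have := Finset.mem_range.1 hi; omega), iteratedFDeriv_zero']; simp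

end JetEq

/-! ### Symmetry of iterated derivatives -/

section Symmetry

variable {E F : Type*} [NormedAddCommGroup E] [NormedSpace ℝ E] [NormedAddCommGroup F]
  [NormedSpace ℝ F]

theorem contDiffAt_iteratedFDeriv_apply {l i : ℕ} {f : E → F} {z : E}
    (hf : ContDiffAt ℝ (l + i : ℕ) f z) (u : Fin l → E) :
    ContDiffAt ℝ i (fun w => iteratedFDeriv ℝ l f w u) z := by
  have h : ContDiffAt ℝ i (iteratedFDeriv ℝ l f) z :=
    hf.iteratedFDeriv_right (by norm_cast; omega)
  exact (ContinuousMultilinearMap.apply ℝ (fun _ : Fin l => E) F u).contDiff.contDiffAt.comp z h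

theorem iteratedFDeriv_succ_eq_fderiv {l : ℕ} {f : E → F} {z : E}
    (hf : ContDiffAt ℝ (l + 1 : ℕ) f z) (u : Fin (l + 1) → E) :
    iteratedFDeriv ℝ (l + 1) f z u =
      fderiv ℝ (fun w => iteratedFDeriv ℝ l f w (Fin.tail u)) z (u 0) := by
  have h : ContDiffAt ℝ 1 (iteratedFDeriv ℝ l f) z :=
    hf.iteratedFDeriv_right (by norm_cast; omega)
  rw [iteratedFDeriv_succ_apply_left,
    fderiv_continuousMultilinear_apply_const_apply (h.differentiableAt (by simp))]

theorem iteratedFDeriv_succ_succ_eq_fderiv {l : ℕ} {f : E → F} {z : E}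
    (hf : ContDiffAt ℝ (l + 2 : ℕ) f z) (u : Fin (l + 2) → E) :
    iteratedFDeriv ℝ (l + 2) f z u =
      fderiv ℝ (fderiv ℝ fun w => iteratedFDeriv ℝ l f w (Fin.tail (Fin.tail u))) z (u 0) (u 1) :=
          by
  rw [iteratedFDeriv_succ_eq_fderiv hf]
  have h1 : (fun w => iteratedFDeriv ℝ (l + 1) f w (Fin.tail u)) =ᶠ[𝓝 z]
      fun w => fderiv ℝ (fun w => iteratedFDeriv ℝ l f w (Fin.tail (Fin.tail u))) w (u 1) := by
    filter_upwards [hf.eventually (natCast_ne_infty _)] with w hw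
    exact iteratedFDeriv_succ_eq_fderiv (hw.of_le (by norm_cast; omega)) _
  have h2 : ContDiffAt ℝ 2 (fun w => iteratedFDeriv ℝ l f w (Fin.tail (Fin.tail u))) z :=
    contDiffAt_iteratedFDeriv_apply hf _
  have h3 : ContDiffAt ℝ 1 (fderiv ℝ fun w => iteratedFDeriv ℝ l f w (Fin.tail (Fin.tail u))) z :=
    h2.fderiv_right (by norm_num)
  rw [h1.fderiv_eq, fderiv_clm_apply (h3.differentiableAt (by simp)) (by fun_prop)]
  simp

/-- Exchanging the first two slots is the symmetry of the second derivative of a lower derivative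
with fixed arguments. Later slots follow by differentiating the identity for lower order, which
therefore has to be known at all points near `z`. -/
theorem iteratedFDeriv_swap_castSucc_succ (l : ℕ) : ∀ {f : E → F} {z : E},
    ContDiffAt ℝ (l + 1 : ℕ) f z → ∀ (i : Fin l) (v : Fin (l + 1) → E),
      iteratedFDeriv ℝ (l + 1) f z (v ∘ Equiv.swap i.castSucc i.succ) =
        iteratedFDeriv ℝ (l + 1) f z v := by
  induction l with
  | zero => intro _ _ _ i; exact i.elim0
  | succ l ih =>
    intro f z hf i v
    induction i using Fin.cases with
    | zero =>
      have h1 : (v ∘ Equiv.swap (Fin.castSucc 0) (Fin.succ 0)) 0 = v 1 := by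
        simp
      have h2 : (v ∘ Equiv.swap (Fin.castSucc 0) (Fin.succ 0)) 1 = v 0 := by
        simp
      have h3 : Fin.tail (Fin.tail (v ∘ Equiv.swap (Fin.castSucc 0) (Fin.succ 0))) =
          Fin.tail (Fin.tail v) := by
        ext j
        simp only [Fin.tail, Function.comp]
        rw [Equiv.swap_apply_of_ne_of_ne]
        · simp [Fin.ext_iff]
        · simp [Fin.ext_iff]
      have hs : IsSymmSndFDerivAt ℝ
          (fun w => iteratedFDeriv ℝ l f w (Fin.tail (Fin.tail v))) z := by
        refine ContDiffAt.isSymmSndFDerivAt (n := 2) ?_ (by simp)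
        exact contDiffAt_iteratedFDeriv_apply (i := 2) hf _
      rw [iteratedFDeriv_succ_succ_eq_fderiv hf, iteratedFDeriv_succ_succ_eq_fderiv hf, h1, h2, h3,
        hs.eq]
    | succ i =>
      have h0 : (v ∘ Equiv.swap i.succ.castSucc i.succ.succ) 0 = v 0 := by
        simp only [Function.comp]
        rw [Equiv.swap_apply_of_ne_of_ne]
        · simp [Fin.ext_iff]
        · simp [Fin.ext_iff]
      have h1 : Fin.tail (v ∘ Equiv.swap i.succ.castSucc i.succ.succ) =
          Fin.tail v ∘ Equiv.swap i.castSucc i.succ := by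
        ext j
        simp only [Fin.tail, Function.comp]
        rw [show i.succ.castSucc = i.castSucc.succ from rfl,
          (Fin.succ_injective (l + 1)).swap_apply]
      rw [iteratedFDeriv_succ_eq_fderiv hf, iteratedFDeriv_succ_eq_fderiv hf, h0, h1]
      congr 1
      apply Filter.EventuallyEq.fderiv_eq
      have := (hf.of_le (m := (l + 1 : ℕ)) (by norm_cast; omega)).eventually (by simp)
      filter_upwards [this] with w hw
      exact ih hw i _

/-- Adjacent transpositions generate the symmetric group. -/
theorem iteratedFDeriv_comp_perm {l : ℕ} {f : E → F} {z : E} (hf : ContDiffAt ℝ l f z)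
    (v : Fin l → E) (σ : Equiv.Perm (Fin l)) :
    iteratedFDeriv ℝ l f z (v ∘ σ) = iteratedFDeriv ℝ l f z v := by
  cases l with
  | zero => congr 1; ext j; exact j.elim0
  | succ l =>
    have hσ : σ ∈ Submonoid.closure (Set.range fun i : Fin l ↦ Equiv.swap i.castSucc i.succ) := by
      rw [Equiv.Perm.mclosure_swap_castSucc_succ]; trivial
    induction hσ using Submonoid.closure_induction generalizing v with
    | mem x hx => obtain ⟨i, rfl⟩ := hx; exact iteratedFDeriv_swap_castSucc_succ l hf i v
    | one => rfl
    | mul x y _ _ hx hy =>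
      rw [Equiv.Perm.coe_mul, ← Function.comp_assoc, hy, hx]

end Symmetry

/-! ### Derivatives of homogeneous polynomials at their centre -/

section Homogeneous

variable {E F : Type*} [NormedAddCommGroup E] [NormedSpace ℝ E] [NormedAddCommGroup F]
  [NormedSpace ℝ F]

/-- The power series with the single term `q`. -/
def singleTerm {l : ℕ} (q : ContinuousMultilinearMap ℝ (fun _ : Fin l => E) F) :
    FormalMultilinearSeries ℝ E F :=
  fun i => if h : i = l then h ▸ q else 0

/-- A homogeneous polynomial is its own power series, so all its derivatives at the centre can be
read off at once. -/
theorem hasFPowerSeriesOnBall_multilinear_diag {l : ℕ}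
    (q : ContinuousMultilinearMap ℝ (fun _ : Fin l => E) F)
    (z : E) : HasFPowerSeriesOnBall (fun w => q fun _ => w - z)
      (singleTerm q) z ⊤ where
  r_le := by
    rw [FormalMultilinearSeries.radius_eq_top_of_forall_image_add_eq_zero _ (l + 1)]
    intro i
    exact dif_neg (by omega)
  r_pos := by simp
  hasSum := by
    intro y _
    have := hasSum_single (f := fun i => singleTerm q i fun _ => y) l (by
        intro i hi
        simp [singleTerm, hi])
    simpa [singleTerm] using this

theorem iteratedFDeriv_multilinear_diag [CompleteSpace F] {l : ℕ}
    (q : ContinuousMultilinearMap ℝ (fun _ : Fin l => E) F)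
    (z : E) (v : Fin l → E) : iteratedFDeriv ℝ l (fun w => q fun _ => w - z) z v =
      ∑ σ : Equiv.Perm (Fin l), q (fun i => v (σ i)) := by
  rw [(hasFPowerSeriesOnBall_multilinear_diag q z).iteratedFDeriv_eq_sum_of_completeSpace]
  simp [singleTerm]

theorem iteratedFDeriv_multilinear_diag_of_ne [CompleteSpace F] {l i : ℕ} (hi : i ≠ l)
    (q : ContinuousMultilinearMap ℝ (fun _ : Fin l => E) F)
    (z : E) : iteratedFDeriv ℝ i (fun w => q fun _ => w - z) z = 0 := by
  ext v
  rw [(hasFPowerSeriesOnBall_multilinear_diag q z).iteratedFDeriv_eq_sum_of_completeSpace]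
  simp [singleTerm, hi]

end Homogeneous

/-! ### Smooth dependence of derivatives on parameters; extension of germs -/

section Parameters

variable {A E F : Type*} [NormedAddCommGroup A] [NormedSpace ℝ A] [NormedAddCommGroup E]
  [NormedSpace ℝ E] [NormedAddCommGroup F] [NormedSpace ℝ F]

/-- Parameter and base point are varied jointly, so that the induction over the order only needs
smoothness of a first derivative depending on parameters. Chart changes on jet bundles have this
form. -/
theorem contDiffAt_iteratedFDeriv_param {g : A → E → F} {a : A} {z : E}
    (hg : ContDiffAt ℝ ∞ (Function.uncurry g) (a, z)) (l : ℕ) :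
    ContDiffAt ℝ ∞ (fun p : A × E => iteratedFDeriv ℝ l (g p.1) p.2) (a, z) := by
  induction l with
  | zero =>
    exact (continuousMultilinearCurryFin0 ℝ E F).symm.contDiff.contDiffAt.comp (a, z) hg
  | succ l ih =>
    simp only [iteratedFDeriv_succ_eq_comp_left]
    have hc := LinearIsometryEquiv.contDiff (𝕜 := ℝ) (E := E →L[ℝ] E [×l]→L[ℝ] F)
      (F := E [×(l + 1)]→L[ℝ] F) (n := ∞)
      (continuousMultilinearCurryLeftEquiv ℝ (fun _ : Fin (l + 1) => E) F).symm
    refine hc.contDiffAt.comp (a, z) ?_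
    refine ContDiffAt.fderiv (x₀ := (a, z)) (f := fun
        (p : A × E) w => iteratedFDeriv ℝ l (g p.1) w) (g := Prod.snd)
      (n := ∞) ?_ contDiffAt_snd (by simp)
    have h2 : ContDiffAt ℝ ∞ (fun q : (A × E) × E => (q.1.1, q.2)) ((a, z), z) := by fun_prop
    exact ContDiffAt.comp (g := fun p : A × E => iteratedFDeriv ℝ l (g p.1) p.2)
      ((a, z), z) ih h2

/-- A function which is smooth near a point agrees there with a globally smooth function. -/
theorem exists_contDiff_eventuallyEq [FiniteDimensional ℝ E] {f : E → F} {z : E}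
    (hf : ∀ᶠ w in 𝓝 z, ContDiffAt ℝ ∞ f w) : ∃ g : E → F, ContDiff ℝ ∞ g ∧ g =ᶠ[𝓝 z] f := by
  obtain ⟨ε, hε, h⟩ := Metric.eventually_nhds_iff_ball.1 hf
  -- The outer radius is smaller than `ε`: the cut-off product vanishes near every point outside the
  -- ball, where nothing is known about `f`.
  let b : ContDiffBump z := ⟨ε / 3, ε / 2, by positivity, by linarith⟩
  have hb : b.rOut = ε / 2 := rfl
  refine ⟨fun w => (b : E → ℝ) w • f w, contDiff_iff_contDiffAt.2 fun w => ?_, ?_⟩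
  · by_cases hw : w ∈ Metric.ball z ε
    · exact (b.contDiff (n := ⊤)).contDiffAt.smul (h w hw)
    · refine (contDiffAt_const (c := (0 : F))).congr_of_eventuallyEq ?_
      have : (Metric.closedBall z (ε / 2))ᶜ ∈ 𝓝 w := by
        refine Metric.isClosed_closedBall.isOpen_compl.mem_nhds ?_
        simp only [mem_compl_iff, Metric.mem_closedBall, Metric.mem_ball] at hw ⊢
        linarith
      filter_upwards [this] with y hy
      have : b y = 0 := b.zero_of_le_dist (by
        simp only [mem_compl_iff, Metric.mem_closedBall] at hy
        rw [hb]; linarith)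
      simp [this]
  · filter_upwards [b.eventuallyEq_one] with w hw
    simp [hw]

end Parameters

end HigherOrderPhase

noncomputable section

namespace HigherOrderPhase

/-! ### Rearrangements of multi-indices -/

section Sorted

variable {l n : ℕ}

theorem sorted_comp_perm (μ : Fin l → Fin n) (σ : Equiv.Perm (Fin l)) :
    sorted (μ ∘ σ) = sorted μ := by
  apply Subtype.ext
  have h : Monotone (μ ∘ (σ * Tuple.sort (μ ∘ σ) : Equiv.Perm (Fin l))) := by
    rw [Equiv.Perm.coe_mul, ← Function.comp_assoc]
    exact Tuple.monotone_sort (μ ∘ σ)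
  have := Tuple.unique_monotone h (Tuple.monotone_sort μ)
  rw [Equiv.Perm.coe_mul, ← Function.comp_assoc] at this
  exact this

theorem sorted_of_monotone {μ : Fin l → Fin n} (h : Monotone μ) : sorted μ = ⟨μ, h⟩ := by
  apply Subtype.ext
  exact Tuple.unique_monotone (σ := Tuple.sort μ)
    (τ := 1) (Tuple.monotone_sort μ) (by simpa using h)

theorem sorted_val (μ : {μ : Fin l → Fin n // Monotone μ}) : sorted μ.1 = μ :=
  sorted_of_monotone μ.2

theorem exists_perm_sorted (μ : Fin l → Fin n) : ∃ σ : Equiv.Perm (Fin l), (sorted μ).1 = μ ∘ σ :=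
  ⟨Tuple.sort μ, rfl⟩

theorem exists_perm_of_sorted_eq {μ ν : Fin l → Fin n} (h : sorted μ = sorted ν) :
    ∃ σ : Equiv.Perm (Fin l), ν ∘ σ = μ := by
  obtain ⟨σ, hσ⟩ := exists_perm_sorted μ
  obtain ⟨τ, hτ⟩ := exists_perm_sorted ν
  refine ⟨τ * σ⁻¹, ?_⟩
  rw [Equiv.Perm.coe_mul, ← Function.comp_assoc, ← hτ, ← h, hσ, Function.comp_assoc,
    ← Equiv.Perm.coe_mul, mul_inv_cancel]
  rfl

end Sorted

/-! ### Jet coordinates of functions -/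

section JetCoords

/-- The model space of the base. -/
abbrev Eu (n : ℕ) : Type := EuclideanSpace ℝ (Fin n)

/-- The coordinate vector of the model space. -/
abbrev ev {n : ℕ} (μ : Fin n) : Eu n := EuclideanSpace.single μ 1

variable {n : ℕ} {ι : Type} [Fintype ι]

/-- The coordinates of the `k`-jet of `f` at `z`. -/
def jc (k : ℕ) (f : Eu n → ι → ℝ) (z : Eu n) : ι × JetIdx n k → ℝ := fun a =>
  iteratedFDeriv ℝ (a.2.1 : ℕ) f z (fun j => ev (a.2.2.1 j)) a.1

theorem JetEq.jc_eq {k : ℕ} {f g : Eu n → ι → ℝ} {z : Eu n} (h : JetEq (k + 1) f g z) :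
    jc k f z = jc k g z := by
  ext a
  simp only [jc]
  rw [h _ a.2.1.2]

/-- Symmetry of derivatives allows arbitrary index sequences, although the jet coordinates are
labelled by nondecreasing ones. -/
theorem iteratedFDeriv_ev {k : ℕ} {f : Eu n → ι → ℝ} {z : Eu n} (hf : ContDiffAt ℝ ∞ f z)
    (l : Fin (k + 1)) (ν : Fin l → Fin n) (i : ι) :
    iteratedFDeriv ℝ (l : ℕ) f z (fun j => ev (ν j)) i = jc k f z (i, ⟨l, sorted ν⟩) := by
  obtain ⟨σ, hσ⟩ := exists_perm_sorted ν
  simp only [jc]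
  have : (fun j => ev ((sorted ν).1 j)) = (fun j => ev (ν j)) ∘ σ := by
    rw [hσ]; rfl
  rw [this, iteratedFDeriv_comp_perm (hf.of_le (natCast_le_infty _))]

/-- A multilinear map is determined on basis vectors, and sorting the indices does not change a
derivative. -/
theorem jetEq_of_jc_eq {k : ℕ} {f g : Eu n → ι → ℝ} {z : Eu n} (hf : ContDiffAt ℝ ∞ f z)
    (hg : ContDiffAt ℝ ∞ g z) (h : jc k f z = jc k g z) : JetEq (k + 1) f g z := by
  intro l hl
  apply ContinuousMultilinearMap.toMultilinearMap_injective
  refine Module.Basis.ext_multilinear (fun _ => (EuclideanSpace.basisFun (Fin n) ℝ).toBasis)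
    fun ν => ?_
  ext i
  have h1 := iteratedFDeriv_ev (k := k) hf ⟨l, hl⟩ ν i
  have h2 := iteratedFDeriv_ev (k := k) hg ⟨l, hl⟩ ν i
  simp only [OrthonormalBasis.coe_toBasis, EuclideanSpace.basisFun_apply,
    ContinuousMultilinearMap.coe_coe]
  exact h1.trans ((congrFun h _).trans h2.symm)

theorem jc_congr {k : ℕ} {f g : Eu n → ι → ℝ} {z : Eu n} (h : f =ᶠ[𝓝 z] g) :
    jc k f z = jc k g z :=
  (JetEq.of_eventuallyEq h).jc_eq

theorem jc_add {k : ℕ} {f g : Eu n → ι → ℝ} {z : Eu n} (hf : ContDiffAt ℝ ∞ f z)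
    (hg : ContDiffAt ℝ ∞ g z) : jc k (f + g) z = jc k f z + jc k g z := by
  ext a
  simp only [jc, Pi.add_apply]
  rw [iteratedFDeriv_add_apply (hf.of_le (natCast_le_infty _)) (hg.of_le (natCast_le_infty _))]
  rfl

theorem jc_smul {k : ℕ} {f : Eu n → ι → ℝ} {z : Eu n} (c : ℝ) (hf : ContDiffAt ℝ ∞ f z) :
    jc k (c • f) z = c • jc k f z := by
  ext a
  simp only [jc, Pi.smul_apply]
  rw [iteratedFDeriv_const_smul_apply (hf.of_le (natCast_le_infty _))]
  rfl

theorem jc_zero {k : ℕ} {z : Eu n} : jc k (0 : Eu n → ι → ℝ) z = 0 := by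
  ext a
  simp [jc]

theorem jc_sum {α : Type*} (s : Finset α) {k : ℕ} {f : α → Eu n → ι → ℝ} {z : Eu n}
    (hf : ∀ a, ContDiffAt ℝ ∞ (f a) z) : jc k (∑ a ∈ s, f a) z = ∑ a ∈ s, jc k (f a) z := by
  classical
  induction s using Finset.induction_on with
  | empty => simp [jc_zero]
  | insert a s ha ih =>
    rw [Finset.sum_insert ha, Finset.sum_insert ha, jc_add (hf a), ih]
    rw [show (∑ a ∈ s, f a) = fun w => ∑ a ∈ s, f a w by ext; simp]
    exact ContDiffAt.sum fun a _ => hf a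

theorem contDiffAt_jc_param {A : Type*} [NormedAddCommGroup A] [NormedSpace ℝ A] {k : ℕ}
    {g : A → Eu n → ι → ℝ} {ζ : A → Eu n} {a : A}
    (hg : ContDiffAt ℝ ∞ (Function.uncurry g) (a, ζ a)) (hζ : ContDiffAt ℝ ∞ ζ a) :
    ContDiffAt ℝ ∞ (fun a => jc k (g a) (ζ a)) a := by
  rw [contDiffAt_pi]
  intro b
  have h := (contDiffAt_iteratedFDeriv_param hg (b.2.1 : ℕ)).comp a
    (f := fun a => (a, ζ a)) (contDiffAt_id.prodMk hζ)
  have h2 := (ContinuousMultilinearMap.apply ℝ (fun _ : Fin b.2.1 => Eu n) (ι → ℝ)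
    (fun j => ev (b.2.2.1 j))).contDiff.contDiffAt.comp a h
  exact (contDiffAt_pi.1 h2) b.1

theorem contDiffAt_jc {k : ℕ} {f : Eu n → ι → ℝ} {z : Eu n} (hf : ContDiffAt ℝ ∞ f z) :
    ContDiffAt ℝ ∞ (jc k f) z :=
  contDiffAt_jc_param (g := fun _ : Eu n => f) (ζ := id)
    (hf.comp (z, z) contDiffAt_snd) contDiffAt_id

theorem contDiff_jc {k : ℕ} {f : Eu n → ι → ℝ} (hf : ContDiff ℝ ∞ f) : ContDiff ℝ ∞ (jc k f) :=
  contDiff_iff_contDiffAt.2 fun _ => contDiffAt_jc hf.contDiffAt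

/-- Jets are translation invariant; this is why `holo` can be defined at the origin. -/
theorem jc_comp_add {k : ℕ} {f : Eu n → ι → ℝ} (z w : Eu n) :
    jc k (fun y => f (y + z)) w = jc k f (w + z) := by
  ext a
  simp only [HigherOrderPhase.jc]
  rw [iteratedFDeriv_comp_add_right]

end JetCoords

/-! ### Monomials, and polynomials with a prescribed jet -/

section Monomials

variable {n : ℕ} {ι : Type} [Fintype ι]

/-- The monomial `∏ⱼ (w - z)_{κ j}`. -/
def mono (z : Eu n) {l : ℕ} (κ : Fin l → Fin n) (w : Eu n) : ℝ := ∏ j, (w (κ j) - z (κ j))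

open Classical in
/-- The vector-valued monomial `∏ⱼ (w - z)_{κ j} ∂_i`. -/
def vmono (z : Eu n) {l : ℕ} (κ : Fin l → Fin n) (i : ι) (w : Eu n) : ι → ℝ :=
  mono z κ w • Pi.single i 1

theorem contDiff_mono_param {l : ℕ} (κ : Fin l → Fin n) :
    ContDiff ℝ ∞ (fun p : Eu n × Eu n => mono p.1 κ p.2) := by
  unfold mono
  refine contDiff_prod fun j _ => ?_
  fun_prop

theorem contDiff_mono (z : Eu n) {l : ℕ} (κ : Fin l → Fin n) : ContDiff ℝ ∞ (mono z κ) :=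
  (contDiff_mono_param κ).comp (contDiff_const.prodMk contDiff_id)

theorem contDiff_vmono (z : Eu n) {l : ℕ} (κ : Fin l → Fin n) (i : ι) :
    ContDiff ℝ ∞ (vmono z κ i) :=
  (contDiff_mono z κ).smul contDiff_const

open Classical in
/-- The multilinear map whose diagonal is a monomial. -/
def monoMultilinear {l : ℕ} (κ : Fin l → Fin n) (i : ι) :
    ContinuousMultilinearMap ℝ (fun _ : Fin l => Eu n) (ι → ℝ) :=
  ((ContinuousMultilinearMap.mkPiAlgebra ℝ (Fin l) ℝ).compContinuousLinearMap
    fun j => EuclideanSpace.proj (κ j)).smulRight (Pi.single i 1)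

theorem vmono_eq (z : Eu n) {l : ℕ} (κ : Fin l → Fin n) (i : ι) :
    vmono z κ i = fun w => monoMultilinear κ i fun _ => w - z := by
  ext w
  simp [vmono, mono, monoMultilinear]

open Classical in
/-- The number of permutations which take `μ` to `κ`. -/
def permCount {l : ℕ} (μ κ : Fin l → Fin n) : ℕ := Fintype.card
    {σ : Equiv.Perm (Fin l) // μ ∘ σ = κ}

theorem permCount_self_pos {l : ℕ} (κ : Fin l → Fin n) : 0 < permCount κ κ := by
  classical
  exact Fintype.card_pos_iff.2 ⟨⟨1, rfl⟩⟩

theorem permCount_eq_zero {l : ℕ} {μ κ : Fin l → Fin n} (h : sorted μ ≠ sorted κ) :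
    permCount μ κ = 0 := by
  classical
  refine Fintype.card_eq_zero_iff.2 ⟨fun σ => h ?_⟩
  rw [← σ.2, sorted_comp_perm]

-- The derivative sums over all permutations of the arguments, and a term survives exactly when the
-- permuted indices equal `κ`.
open Classical in
theorem iteratedFDeriv_vmono (z : Eu n) {l : ℕ} (κ ν : Fin l → Fin n) (i : ι) :
    iteratedFDeriv ℝ l (vmono z κ i) z (fun j => ev (ν j)) =
      (permCount ν κ : ℝ) • Pi.single i 1 := by
  rw [vmono_eq, iteratedFDeriv_multilinear_diag]
  have : ∀ σ : Equiv.Perm (Fin l), monoMultilinear κ i (fun j => ev (ν (σ j))) =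
      (if ν ∘ σ = κ then (1 : ℝ) else 0) • Pi.single i (1 : ℝ) := by
    intro σ
    simp only [monoMultilinear, ContinuousMultilinearMap.smulRight_apply,
      ContinuousMultilinearMap.compContinuousLinearMap_apply,
      ContinuousMultilinearMap.mkPiAlgebra_apply, PiLp.proj_apply]
    congr 1
    split_ifs with h
    · refine Finset.prod_eq_one fun j _ => ?_
      rw [← h]; simp
    · obtain ⟨j, hj⟩ := Function.ne_iff.1 h
      refine Finset.prod_eq_zero (Finset.mem_univ j) ?_
      simp only [Function.comp] at hj
      simp [Ne.symm hj]
  simp_rw [this]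
  rw [← Finset.sum_smul]
  congr 1
  simp [permCount, Fintype.card_subtype]

open Classical in
theorem jc_vmono (z : Eu n) {l k : ℕ} (κ : Fin l → Fin n) (i : ι) (b : ι × JetIdx n k) :
    jc k (vmono z κ i) z b =
      if h : (b.2.1 : ℕ) = l then
        (permCount (b.2.2.1 ∘ Fin.cast h.symm) κ : ℝ) * (if b.1 = i then 1 else 0) else 0 := by
  obtain ⟨i', ⟨l', hl'⟩, μ⟩ := b
  simp only [jc]
  split_ifs with h h'
  · subst h h'
    rw [iteratedFDeriv_vmono]
    simp
  · subst h
    rw [iteratedFDeriv_vmono]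
    simp [Pi.single_eq_of_ne h']
  · rw [vmono_eq, iteratedFDeriv_multilinear_diag_of_ne h]
    rfl

/-- The polynomial with prescribed `k`-jet `a` at `z`. -/
def taylorPoly (k : ℕ) (z : Eu n) (a : ι × JetIdx n k → ℝ) : Eu n → ι → ℝ :=
  ∑ b : ι × JetIdx n k, (a b / permCount b.2.2.1 b.2.2.1) • vmono z b.2.2.1 b.1

theorem contDiff_taylorPoly_param (k : ℕ) : ContDiff ℝ ∞
    (fun p : (Eu n × (ι × JetIdx n k → ℝ)) × Eu n => taylorPoly k p.1.1 p.1.2 p.2) := by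
  unfold taylorPoly
  simp only [Finset.sum_apply, Pi.smul_apply]
  refine ContDiff.sum fun b _ => ContDiff.fun_smul ?_ ?_
  · exact ContDiff.div_const (by fun_prop) _
  · exact ((contDiff_mono_param b.2.2.1).comp (f := fun p : (Eu n × (ι × JetIdx n k → ℝ)) × Eu n =>
      (p.1.1, p.2)) (by fun_prop)).smul contDiff_const

theorem contDiff_taylorPoly (k : ℕ) (z : Eu n) (a : ι × JetIdx n k → ℝ) :
    ContDiff ℝ ∞ (taylorPoly k z a) :=
  (contDiff_taylorPoly_param k).comp (f := fun w => ((z, a), w)) (by fun_prop)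

theorem jc_taylorPoly (k : ℕ) (z : Eu n) (a : ι × JetIdx n k → ℝ) :
    jc k (taylorPoly k z a) z = a := by
  classical
  unfold taylorPoly
  rw [jc_sum]
  · simp_rw [jc_smul _ (contDiff_vmono _ _ _).contDiffAt]
    ext c
    -- Only the monomial with the same label has a nonzero derivative there. Its value is the number
    -- of permutations fixing the label, by which the coefficient was divided.
    rw [Finset.sum_apply, Finset.sum_eq_single c]
    · have := permCount_self_pos c.2.2.1
      rw [Pi.smul_apply, jc_vmono, dif_pos rfl, if_pos rfl]
      have h : c.2.2.1 ∘ Fin.cast rfl = c.2.2.1 := rfl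
      rw [h, mul_one, smul_eq_mul, div_mul_cancel₀]
      positivity
    · intro b _ hb
      obtain ⟨i, ⟨l, hl⟩, μ⟩ := b
      obtain ⟨i', ⟨l', hl'⟩, μ'⟩ := c
      rw [Pi.smul_apply, jc_vmono]
      split_ifs with h h'
      · change l' = l at h
        change i' = i at h'
        subst h h'
        -- Two nondecreasing sequences that are rearrangements of each other coincide.
        have hz : permCount μ'.1 μ.1 = 0 := permCount_eq_zero fun h => hb (by
          rw [sorted_val, sorted_val] at h
          rw [h])
        exact mul_eq_zero_of_right _ (mul_eq_zero_of_left (Nat.cast_eq_zero.2 hz) _)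
      · simp
      · simp
    · simp
  · intro b
    exact (contDiff_const (c := a b / permCount b.2.2.1 b.2.2.1)).contDiffAt.smul
      (contDiff_vmono z b.2.2.1 b.1).contDiffAt

end Monomials

end HigherOrderPhase

end

noncomputable section

namespace HigherOrderPhase

/-! ### First jets of jets, and the pairing of momenta with holonomic jets -/

section FirstJets

variable {m : ℕ} {ι : Type} [Fintype ι]

theorem jetIdx_one_cases (j : JetIdx (m + 1) 1) : j = ix0 ∨ ∃ lam, j = ix1 lam := by
  obtain ⟨⟨l, hl⟩, μ, hμ⟩ := j
  obtain rfl | rfl : l = 0 ∨ l = 1 := by omega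
  · left
    simp only [ix0]
    congr 1
    apply Subtype.ext
    ext i
    exact i.elim0
  · right
    refine ⟨μ 0, ?_⟩
    simp only [ix1]
    congr 1
    have : μ = fun _ => μ 0 := by
      ext i
      rw [Subsingleton.elim i 0]
    rw [← sorted_of_monotone hμ]
    exact congrArg sorted this

theorem jc_ix0 (f : Eu (m + 1) → ι → ℝ) (z : Eu (m + 1)) (i : ι) : jc 1 f z (i, ix0) = f z i := by
  simp only [jc, ix0]
  exact congrFun (iteratedFDeriv_zero_apply _) i

theorem jc_ix1 (f : Eu (m + 1) → ι → ℝ) (z : Eu (m + 1)) (i : ι) (lam : Fin (m + 1)) :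
    jc 1 f z (i, ix1 lam) = fderiv ℝ f z (ev lam) i := by
  simp only [jc, ix1]
  rw [show (fun j => ev ((sorted fun _ : Fin ((1 : Fin 2) : ℕ) => lam).1 j)) =
    fun _ => (ev lam : Eu (m + 1)) from rfl]
  exact congrFun (iteratedFDeriv_one_apply (𝕜 := ℝ) (f := f) (x := z) (fun _ => ev lam)) i

theorem fderiv_jc {k : ℕ} {f : Eu (m + 1) → ι → ℝ} {z : Eu (m + 1)} (hf : ContDiffAt ℝ ∞ f z)
    (i : ι) (l : Fin (k + 1)) (μ : {μ : Fin l → Fin (m + 1) // Monotone μ}) (v : Eu (m + 1)) :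
    fderiv ℝ (jc k f) z v (i, ⟨l, μ⟩) =
      iteratedFDeriv ℝ (l + 1) f z (Fin.cons v fun j => ev (μ.1 j)) i := by
  have hd : DifferentiableAt ℝ (jc k f) z := (contDiffAt_jc hf).differentiableAt (by simp)
  have h1 : fderiv ℝ (jc k f) z v (i, ⟨l, μ⟩) =
      fderiv ℝ (fun w => jc k f w (i, ⟨l, μ⟩)) z v := by
    rw [fderiv_apply hd]
    rfl
  rw [h1, iteratedFDeriv_succ_eq_fderiv (hf.of_le (natCast_le_infty _))]
  have hd2 : DifferentiableAt ℝ (fun w => iteratedFDeriv ℝ (l : ℕ) f w (fun j => ev (μ.1 j))) z :=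
    (contDiffAt_iteratedFDeriv_apply (i := 1) (hf.of_le (natCast_le_infty _)) _).differentiableAt
      (by simp)
  simp only [Fin.tail_cons, Fin.cons_zero]
  have h2 := fderiv_apply hd2 i
  have : fderiv ℝ (fun w => iteratedFDeriv ℝ (l : ℕ) f w (fun j => ev (μ.1 j))) z v i =
      fderiv ℝ (fun w => iteratedFDeriv ℝ (l : ℕ) f w (fun j => ev (μ.1 j)) i) z v := by
    rw [h2]
    rfl
  rw [this]
  rfl

/-- Differentiating a jet coordinate adds one index. It arises in the first slot and is rotated to
the last, where the momenta carry `λ`. -/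
theorem jc_jc_ix1 {k : ℕ} {f : Eu (m + 1) → ι → ℝ} {z : Eu (m + 1)} (hf : ContDiffAt ℝ ∞ f z)
    (i : ι) (l : Fin (k + 1)) (μ : {μ : Fin l → Fin (m + 1) // Monotone μ}) (lam : Fin (m + 1)) :
    jc 1 (jc k f) z ((i, ⟨l, μ⟩), ix1 lam) =
      iteratedFDeriv ℝ (l + 1) f z
        (fun j => ev ((Fin.snoc μ.1 lam : Fin (l + 1) → Fin (m + 1)) j)) i := by
  rw [jc_ix1, fderiv_jc hf, Fin.snoc_eq_cons_rotate,
    ← iteratedFDeriv_comp_perm (hf.of_le (natCast_le_infty _)) _ (finRotate (l + 1))]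
  refine congrFun (congrArg _ ?_) i
  funext j
  simp only [Function.comp]
  generalize finRotate (l + 1) j = j'
  induction j' using Fin.cases <;> simp

variable (m ι) in
/-- The coordinates, as points of `J^1 J^k`, of the holonomic jets. -/
def holo (k : ℕ) : Submodule ℝ ((ι × JetIdx (m + 1) k) × JetIdx (m + 1) 1 → ℝ) where
  carrier := {h | ∃ f : Eu (m + 1) → ι → ℝ, ContDiff ℝ ∞ f ∧ jc 1 (jc k f) 0 = h}
  add_mem' := by
    rintro _ _ ⟨f, hf, rfl⟩ ⟨g, hg, rfl⟩
    refine ⟨f + g, hf.add hg, ?_⟩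
    rw [← jc_add (contDiff_jc hf).contDiffAt (contDiff_jc hg).contDiffAt]
    congr 1
    ext w : 1
    exact jc_add hf.contDiffAt hg.contDiffAt
  zero_mem' := ⟨0, contDiff_const, by
    rw [← jc_zero]
    congr 1
    ext w : 1
    exact jc_zero⟩
  smul_mem' := by
    rintro c _ ⟨f, hf, rfl⟩
    refine ⟨c • f, (contDiff_const (c := c)).smul hf, ?_⟩
    rw [← jc_smul c (contDiff_jc hf).contDiffAt]
    congr 1
    ext w : 1
    exact jc_smul c hf.contDiffAt

/-- A jet depends only on the germ: cut `f` off to a global function and translate to the origin. -/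
theorem jc_jc_mem_holo {k : ℕ} {f : Eu (m + 1) → ι → ℝ} {z : Eu (m + 1)}
    (hf : ∀ᶠ w in 𝓝 z, ContDiffAt ℝ ∞ f w) : jc 1 (jc k f) z ∈ holo m ι k := by
  obtain ⟨g, hg, hgf⟩ := exists_contDiff_eventuallyEq hf
  refine ⟨fun w => g (w + z), by fun_prop, ?_⟩
  have h1 : jc k (fun w => g (w + z)) = fun w => jc k g (w + z) := by
    ext w : 1
    exact jc_comp_add z w
  have h2 : jc k g =ᶠ[𝓝 z] jc k f := hgf.eventually_nhds.mono fun w hw => jc_congr hw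
  rw [h1, jc_comp_add, zero_add, jc_congr h2]

theorem exists_of_mem_holo {k : ℕ} {h : (ι × JetIdx (m + 1) k) × JetIdx (m + 1) 1 → ℝ}
    (hh : h ∈ holo m ι k) (z : Eu (m + 1)) :
    ∃ f : Eu (m + 1) → ι → ℝ, ContDiff ℝ ∞ f ∧ jc 1 (jc k f) z = h := by
  obtain ⟨f, hf, rfl⟩ := hh
  refine ⟨fun w => f (w + -z), by fun_prop, ?_⟩
  have h1 : jc k (fun w => f (w + -z)) = fun w => jc k f (w + -z) := by
    ext w : 1
    exact jc_comp_add (-z) w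
  rw [h1, jc_comp_add, add_neg_cancel]

end FirstJets

/-! ### The pairing behind the two-form -/

section Pairing

variable {m : ℕ} {κ : Type} [Fintype κ]

/-- The components along the configuration bundle. -/
def confPart {J : Type} (u : (κ ⊕ κ × Fin (m + 1)) × J → ℝ) : κ × J → ℝ :=
  fun a => u (Sum.inl a.1, a.2)

/-- The components along the momenta. -/
def momPart {J : Type} (u : (κ ⊕ κ × Fin (m + 1)) × J → ℝ) : (κ × Fin (m + 1)) × J → ℝ :=
  fun a => u (Sum.inr a.1, a.2)

/-- The divergence `p^λ_{i,λ} φ^i + p^λ_i φ^i_{,λ}` of `p^λ_i φ^i`. -/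
def pair (P : (κ × Fin (m + 1)) × JetIdx (m + 1) 1 → ℝ) (h : κ × JetIdx (m + 1) 1 → ℝ) : ℝ :=
  ∑ i : κ, ∑ lam : Fin (m + 1),
    (P ((i, lam), ix1 lam) * h (i, ix0) + P ((i, lam), ix0) * h (i, ix1 lam))

/-- Reduces every question about the kernel of the two-form to annihilators under the bilinear
`pair`. -/
theorem omega_eq_pair (u v : (κ ⊕ κ × Fin (m + 1)) × JetIdx (m + 1) 1 → ℝ) :
    omega u v = pair (momPart u) (confPart v) - pair (momPart v) (confPart u) := by
  simp only [omega, pair, momPart, confPart, ← Finset.sum_sub_distrib]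
  refine Finset.sum_congr rfl fun i _ => Finset.sum_congr rfl fun lam _ => ?_
  ring

variable (m κ) in
/-- The pairing as a bilinear map. -/
def pairL : ((κ × Fin (m + 1)) × JetIdx (m + 1) 1 → ℝ) →ₗ[ℝ] (κ × JetIdx (m + 1) 1 → ℝ) →ₗ[ℝ] ℝ :=
  LinearMap.mk₂ ℝ pair
    (fun P P' h => by
      simp only [pair, ← Finset.sum_add_distrib]
      refine Finset.sum_congr rfl fun i _ => Finset.sum_congr rfl fun lam _ => ?_
      simp only [Pi.add_apply]; ring)
    (fun c P h => by
      simp only [pair, smul_eq_mul, Finset.mul_sum]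
      refine Finset.sum_congr rfl fun i _ => Finset.sum_congr rfl fun lam _ => ?_
      simp only [Pi.smul_apply, smul_eq_mul]; ring)
    (fun P h h' => by
      simp only [pair, ← Finset.sum_add_distrib]
      refine Finset.sum_congr rfl fun i _ => Finset.sum_congr rfl fun lam _ => ?_
      simp only [Pi.add_apply]; ring)
    (fun c P h => by
      simp only [pair, smul_eq_mul, Finset.mul_sum]
      refine Finset.sum_congr rfl fun i _ => Finset.sum_congr rfl fun lam _ => ?_
      simp only [Pi.smul_apply, smul_eq_mul]; ring)

end Pairing

/-! ### Symmetric momenta in coordinates -/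

section Tensors

variable {m N k : ℕ}

/-- The momenta of the theory in coordinates. -/
abbrev MomIdx (m N k : ℕ) : Type := (Fin N × JetIdx (m + 1) k) × Fin (m + 1)

/-- The tensor components `p^{μ₁ … μ_l λ}_K`. -/
def tens (P : MomIdx m N k → ℝ) (K : Fin N) (l : Fin (k + 1)) (ν : Fin (l + 1) → Fin (m + 1)) : ℝ :=
  P ((K, ⟨l, sorted (Fin.init ν)⟩), ν (Fin.last l)) /
    Nat.card {μ : Fin l → Fin (m + 1) // sorted μ = sorted (Fin.init ν)}

/-- The complete symmetrisation of the tensor components. -/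
def symTens (P : MomIdx m N k → ℝ) (K : Fin N) (l : Fin (k + 1)) (ν : Fin (l + 1) → Fin (m + 1)) :
    ℝ :=
  (∑ σ : Equiv.Perm (Fin (l + 1)), tens P K l (ν ∘ σ)) / Nat.factorial (l + 1)

theorem tens_add (P Q : MomIdx m N k → ℝ) (K : Fin N) (l : Fin (k + 1))
    (ν : Fin (l + 1) → Fin (m + 1)) : tens (P + Q) K l ν = tens P K l ν + tens Q K l ν := by
  simp [tens, add_div]

theorem tens_smul (c : ℝ) (P : MomIdx m N k → ℝ) (K : Fin N) (l : Fin (k + 1))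
    (ν : Fin (l + 1) → Fin (m + 1)) : tens (c • P) K l ν = c * tens P K l ν := by
  simp [tens, mul_div_assoc]

theorem symTens_add (P Q : MomIdx m N k → ℝ) (K : Fin N) (l : Fin (k + 1))
    (ν : Fin (l + 1) → Fin (m + 1)) : symTens (P + Q) K l ν =
        symTens P K l ν + symTens Q K l ν := by
  simp [symTens, tens_add, Finset.sum_add_distrib, add_div]

theorem symTens_smul (c : ℝ) (P : MomIdx m N k → ℝ) (K : Fin N) (l : Fin (k + 1))
    (ν : Fin (l + 1) → Fin (m + 1)) : symTens (c • P) K l ν = c * symTens P K l ν := by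
  simp [symTens, tens_smul, ← Finset.mul_sum, mul_div_assoc]

/-- The momenta which are totally symmetric at the levels in `L`. -/
def symSub (m N : ℕ) {k : ℕ} (L : Set (Fin (k + 1))) : Submodule ℝ (MomIdx m N k → ℝ) where
  carrier := {P | ∀ l ∈ L, ∀ K ν, tens P K l ν = symTens P K l ν}
  add_mem' := fun hP hQ l hl K ν => by rw [tens_add, symTens_add, hP l hl, hQ l hl]
  zero_mem' := fun _ _ _ _ => by simp [tens, symTens]
  smul_mem' := fun c _ hP l hl K ν => by rw [tens_smul, symTens_smul, hP l hl]

theorem symSub_anti {L L' : Set (Fin (k + 1))} (h : L ⊆ L') : symSub m N L' ≤ symSub m N L :=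
  fun _ hP l hl => hP l (h hl)

/-- Momenta and their first derivatives, all symmetric at the levels in `L`. -/
def symJet (m N : ℕ) {k : ℕ} (L : Set (Fin (k + 1))) :
    Submodule ℝ (MomIdx m N k × JetIdx (m + 1) 1 → ℝ) where
  carrier := {P | ∀ j, (fun a => P (a, j)) ∈ symSub m N L}
  add_mem' := fun hP hQ j => (symSub m N L).add_mem (hP j) (hQ j)
  zero_mem' := fun _ => (symSub m N L).zero_mem
  smul_mem' := fun c _ hP j => (symSub m N L).smul_mem c (hP j)

theorem symJet_anti {L L' : Set (Fin (k + 1))} (h : L ⊆ L') : symJet m N L' ≤ symJet m N L :=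
  fun _ hP j => symSub_anti h (hP j)

theorem mem_symSub_of_perm {P : MomIdx m N k → ℝ} {L : Set (Fin (k + 1))}
    (h : ∀ l ∈ L, ∀ K ν (σ : Equiv.Perm (Fin (l + 1))), tens P K l (ν ∘ σ) = tens P K l ν) :
    P ∈ symSub m N L := by
  intro l hl K ν
  simp only [symTens, h l hl, Finset.sum_const, Finset.card_univ, Fintype.card_perm,
    Fintype.card_fin, nsmul_eq_mul]
  rw [mul_div_cancel_left₀]
  exact_mod_cast (Nat.factorial_pos _).ne'

theorem symTens_comp_perm (P : MomIdx m N k → ℝ) (K : Fin N) (l : Fin (k + 1))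
    (ν : Fin (l + 1) → Fin (m + 1)) (σ : Equiv.Perm (Fin (l + 1))) :
    symTens P K l (ν ∘ σ) = symTens P K l ν := by
  simp only [symTens]
  congr 1
  exact Fintype.sum_equiv (Equiv.mulLeft σ) _ _ fun τ => by
    simp [Equiv.coe_mulLeft, Equiv.Perm.coe_mul, Function.comp_assoc]

theorem card_sorted_pos {l n : ℕ} (s : {μ : Fin l → Fin n // Monotone μ}) :
    0 < Nat.card {μ : Fin l → Fin n // sorted μ = s} :=
  Nat.card_pos_iff.2 ⟨⟨⟨s.1, sorted_val s⟩⟩, inferInstance⟩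

/-- A sum over independent components is a sum over all components of the tensor. -/
theorem sum_tens_mul (P : MomIdx m N k → ℝ) (K : Fin N) (l : Fin (k + 1))
    (S : (Fin (l + 1) → Fin (m + 1)) → ℝ) (hS : ∀ ν
        (σ : Equiv.Perm (Fin (l + 1))), S (ν ∘ σ) = S ν) :
    ∑ ν, tens P K l ν * S ν =
      ∑ s : {μ : Fin l → Fin (m + 1) // Monotone μ}, ∑ lam : Fin (m + 1),
        P ((K, ⟨l, s⟩), lam) * S (Fin.snoc s.1 lam) := by
  classical
  refine (Equiv.sum_comp (Fin.snocEquiv fun _ : Fin (l + 1) => Fin (m + 1))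
    (fun ν : Fin (l + 1) → Fin (m + 1) => tens P K l ν * S ν)).symm.trans ?_
  rw [Fintype.sum_prod_type]
  refine Eq.trans ?_ Finset.sum_comm
  refine Finset.sum_congr rfl fun lam _ => ?_
  -- Group the sequences by their nondecreasing rearrangement. Each class contributes equal terms,
  -- and their number cancels the denominator in `tens`.
  refine (Finset.sum_fiberwise (M := ℝ) Finset.univ
    (fun μ : Fin l → Fin (m + 1) => sorted μ) _).symm.trans ?_
  refine Finset.sum_congr rfl fun s _ => ?_
  have : ∀ μ ∈ Finset.univ.filter (fun μ : Fin l → Fin (m + 1) => sorted μ = s),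
      tens P K l (Fin.snocEquiv (fun _ : Fin (l + 1) => Fin (m + 1)) (lam, μ)) *
        S (Fin.snocEquiv (fun _ : Fin (l + 1) => Fin (m + 1)) (lam, μ)) =
      P ((K, ⟨l, s⟩), lam) * S (Fin.snoc s.1 lam) /
        Nat.card {μ : Fin l → Fin (m + 1) // sorted μ = s} := by
    intro μ hμ
    have hμ' : sorted μ = s := (Finset.mem_filter.1 hμ).2
    have h1 : (Fin.snocEquiv (fun _ : Fin (l + 1) => Fin (m + 1)) (lam, μ)) = Fin.snoc μ lam := rfl
    have h2 : S (Fin.snoc s.1 lam) = S (Fin.snoc μ lam) := by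
      obtain ⟨σ, hσ⟩ := exists_perm_sorted μ
      -- Rotating the last index to the front makes it easy to extend `σ` by a fixed point.
      obtain ⟨τ, hτ⟩ : ∃ τ : Equiv.Perm (Fin (l + 1)),
          (Fin.snoc μ lam : Fin (l + 1) → Fin (m + 1)) ∘ τ = Fin.snoc (μ ∘ σ) lam := by
        apply exists_perm_of_sorted_eq
        rw [Fin.snoc_eq_cons_rotate, Fin.snoc_eq_cons_rotate]
        have e1 : ∀ μ : Fin l → Fin (m + 1), sorted (fun i : Fin (l + 1) =>
            (Fin.cons lam μ : Fin (l + 1) → Fin (m + 1)) (finRotate (l + 1) i)) =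
            sorted (Fin.cons lam μ : Fin (l + 1) → Fin (m + 1)) :=
          fun μ => sorted_comp_perm _ (finRotate (l + 1))
        rw [e1, e1]
        have e2 : (Fin.cons lam (μ ∘ σ) : Fin (l + 1) → Fin (m + 1)) =
            (Fin.cons lam μ : Fin (l + 1) → Fin (m + 1)) ∘
              (Equiv.Perm.decomposeFin.symm (0, σ)) := by
          ext j : 1
          induction j using Fin.cases with
          | zero => simp
          | succ j => simp
        rw [e2, sorted_comp_perm]
      rw [← hμ', hσ, ← hτ, hS]
    rw [h1, h2]
    simp only [tens, Fin.init_snoc, Fin.snoc_last, hμ']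
    ring
  rw [Finset.sum_congr rfl this, Finset.sum_const, nsmul_eq_mul]
  have hc : ((Finset.univ.filter (fun μ : Fin l → Fin (m + 1) => sorted μ = s)).card : ℝ) =
      Nat.card {μ : Fin l → Fin (m + 1) // sorted μ = s} := by
    rw [Nat.card_eq_fintype_card, Fintype.card_subtype]
  rw [hc, mul_div_cancel₀]
  exact_mod_cast (card_sorted_pos s).ne'

/-- On a holonomic jet the sum over independent components becomes a full contraction with the
totally symmetric tensor `D^{l+1} f`. This is the reason why non-symmetric momenta are invisible. -/
theorem pair_jc_jc (P : MomIdx m N k × JetIdx (m + 1) 1 → ℝ) {f : Eu (m + 1) → Fin N → ℝ}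
    {z : Eu (m + 1)} (hf : ContDiffAt ℝ ∞ f z) :
    pair P (jc 1 (jc k f) z) = ∑ i, ∑ lam, P ((i, lam), ix1 lam) * jc k f z i +
      ∑ K, ∑ l, ∑ ν, tens (fun a => P (a, ix0)) K l ν *
        iteratedFDeriv ℝ (l + 1) f z (fun j => ev (ν j)) K := by
  simp only [pair, Finset.sum_add_distrib, jc_ix0]
  congr 1
  rw [Fintype.sum_prod_type]
  refine Finset.sum_congr rfl fun K _ => ?_
  rw [Fintype.sum_sigma]
  refine Finset.sum_congr rfl fun l _ => ?_
  rw [sum_tens_mul]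
  · refine Finset.sum_congr rfl fun s _ => Finset.sum_congr rfl fun lam _ => ?_
    rw [jc_jc_ix1 hf]
  · intro ν σ
    exact congrFun (iteratedFDeriv_comp_perm (hf.of_le (natCast_le_infty _)) (fun j => ev (ν j)) σ)
        K

/-- The pairing with holonomic jets only sees the symmetrised momenta. -/
theorem pair_eq_of_symTens_eq {P Q : MomIdx m N k × JetIdx (m + 1) 1 → ℝ}
    (h1 : ∀ a lam, P (a, ix1 lam) = Q (a, ix1 lam))
    (h0 : ∀ K l ν, symTens (fun a => P (a, ix0)) K l ν = symTens (fun a => Q (a, ix0)) K l ν)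
    {h : (Fin N × JetIdx (m + 1) k) × JetIdx (m + 1) 1 → ℝ} (hh : h ∈ holo m (Fin N) k) :
    pair P h = pair Q h := by
  obtain ⟨f, hf, rfl⟩ := hh
  rw [pair_jc_jc P hf.contDiffAt, pair_jc_jc Q hf.contDiffAt]
  simp only [h1]
  congr 1
  refine Finset.sum_congr rfl fun K _ => Finset.sum_congr rfl fun l _ => ?_
  -- The symmetrisation can be moved from the momentum to the derivative by renaming summation
  -- indices, and the derivative is already symmetric.
  have key : ∀ R : MomIdx m N k → ℝ, ∑ ν, symTens R K l ν *
      iteratedFDeriv ℝ (l + 1) f 0 (fun j => ev (ν j)) K =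
      ∑ ν, tens R K l ν * iteratedFDeriv ℝ (l + 1) f 0 (fun j => ev (ν j)) K := by
    intro R
    simp only [symTens, div_mul_eq_mul_div, Finset.sum_mul]
    rw [← Finset.sum_div, Finset.sum_comm]
    have : ∀ σ : Equiv.Perm (Fin (l + 1)), ∑ ν, tens R K l (ν ∘ σ) *
        iteratedFDeriv ℝ (l + 1) f 0 (fun j => ev (ν j)) K =
        ∑ ν, tens R K l ν * iteratedFDeriv ℝ (l + 1) f 0 (fun j => ev (ν j)) K := by
      intro σ
      refine Fintype.sum_equiv (Equiv.arrowCongr σ.symm (Equiv.refl _)) _ _ fun ν => ?_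
      have e : (Equiv.arrowCongr σ.symm (Equiv.refl (Fin (m + 1)))) ν = ν ∘ σ := by
        ext j; simp
      rw [e]
      congr 1
      exact (congrFun (iteratedFDeriv_comp_perm (hf.contDiffAt.of_le (natCast_le_infty _))
        (fun j => ev (ν j)) σ) K).symm
    rw [Finset.sum_congr rfl fun σ _ => this σ, Finset.sum_const, Finset.card_univ,
      Fintype.card_perm, Fintype.card_fin, nsmul_eq_mul, mul_div_cancel_left₀]
    exact_mod_cast (Nat.factorial_pos _).ne'
  rw [← key, ← key]
  simp only [h0]

/-- The rearrangement class of a multi-index. -/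
def lab {l n : ℕ} (ν : Fin l → Fin n) : Σ l : ℕ, {μ : Fin l → Fin n // Monotone μ} := ⟨l, sorted ν⟩

theorem sorted_eq_of_lab_eq {l n : ℕ} {μ ν : Fin l → Fin n} (h : lab μ = lab ν) :
    sorted μ = sorted ν := by
  simpa [lab] using h

theorem lab_comp_perm {l n : ℕ} (ν : Fin l → Fin n) (σ : Equiv.Perm (Fin l)) :
    lab (ν ∘ σ) = lab ν := by
  simp only [lab, sorted_comp_perm]

theorem lab_snoc_comp_perm {l n : ℕ} (μ : Fin l → Fin n) (lam : Fin n) (σ : Equiv.Perm (Fin l)) :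
    lab (Fin.snoc (μ ∘ σ) lam : Fin (l + 1) → Fin n) = lab (Fin.snoc μ lam :
        Fin (l + 1) → Fin n) := by
  have e1 : ∀ μ : Fin l → Fin n, lab (Fin.snoc μ lam : Fin (l + 1) → Fin n) =
      lab (Fin.cons lam μ : Fin (l + 1) → Fin n) := fun μ => by
    rw [Fin.snoc_eq_cons_rotate]
    exact lab_comp_perm _ (finRotate (l + 1))
  have e2 : (Fin.cons lam (μ ∘ σ) : Fin (l + 1) → Fin n) =
      (Fin.cons lam μ : Fin (l + 1) → Fin n) ∘ (Equiv.Perm.decomposeFin.symm (0, σ)) := by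
    ext j : 1
    induction j using Fin.cases with
    | zero => simp
    | succ j => simp
  rw [e1, e1, e2, lab_comp_perm]

open Classical in
/-- Totally symmetric momenta which detect the derivative `∂_κ`. -/
def testMom (k : ℕ) (K : Fin N) {l : ℕ} (κ : Fin l → Fin (m + 1)) : MomIdx m N k → ℝ :=
  fun a => if a.1.1 = K ∧ lab (Fin.snoc a.1.2.2.1 a.2 :
    Fin (a.1.2.1 + 1) → Fin (m + 1)) = lab κ then
    Nat.card {μ : Fin a.1.2.1 → Fin (m + 1) // sorted μ = a.1.2.2} else 0

-- The cardinality in `testMom` cancels the one in `tens`, leaving the indicator function of a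
-- rearrangement class, which is manifestly symmetric.
open Classical in
theorem tens_testMom (K K' : Fin N) {l : ℕ} (l' : Fin (k + 1)) (κ : Fin l → Fin (m + 1))
    (ν : Fin (l' + 1) → Fin (m + 1)) : tens (testMom k K κ) K' l' ν =
      if K' = K ∧ lab ν = lab κ then 1 else 0 := by
  have h : lab (Fin.snoc (sorted (Fin.init ν)).1 (ν (Fin.last l')) : Fin (l' + 1) → Fin (m + 1)) =
      lab ν := by
    obtain ⟨σ, hσ⟩ := exists_perm_sorted (Fin.init ν)
    rw [hσ, lab_snoc_comp_perm, Fin.snoc_init_self]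
  simp only [tens, testMom, h]
  split_ifs
  · rw [div_self]
    exact_mod_cast (card_sorted_pos _).ne'
  · simp

theorem testMom_mem (K : Fin N) {l : ℕ} (κ : Fin l → Fin (m + 1)) (L : Set (Fin (k + 1))) :
    testMom k K κ ∈ symSub m N L := by
  refine mem_symSub_of_perm fun l _ K' ν σ => ?_
  rw [tens_testMom, tens_testMom, lab_comp_perm]

open Classical in
/-- A momentum together with the given derivatives, concentrated at one label `j` of the jet. -/
def atJet (j : JetIdx (m + 1) 1) (P : MomIdx m N k → ℝ) : MomIdx m N k × JetIdx (m + 1) 1 → ℝ :=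
  fun a => if a.2 = j then P a.1 else 0

theorem atJet_mem {L : Set (Fin (k + 1))} (j : JetIdx (m + 1) 1) {P : MomIdx m N k → ℝ}
    (hP : P ∈ symSub m N L) : atJet j P ∈ symJet m N L := by
  intro j'
  by_cases h : j' = j
  · simpa [atJet, h] using hP
  · simp only [atJet, h, if_false]
    exact (symSub m N L).zero_mem

theorem ix0_ne_ix1 (lam : Fin (m + 1)) : (ix0 : JetIdx (m + 1) 1) ≠ ix1 lam := by
  intro h
  have := congrArg Sigma.fst h
  simp [ix0, ix1] at this

theorem ix1_injective : Function.Injective (ix1 : Fin (m + 1) → JetIdx (m + 1) 1) := by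
  intro a b h
  have h' : sorted (fun _ : Fin ((1 : Fin 2) : ℕ) => a) = sorted fun _ => b := by
    simpa [ix1] using h
  exact congrFun (congrArg Subtype.val h') (0 : Fin 1)

open Classical in
/-- Symmetric momenta separate the holonomic jets. -/
theorem eq_zero_of_pair_eq_zero {h : (Fin N × JetIdx (m + 1) k) × JetIdx (m + 1) 1 → ℝ}
    (hh : h ∈ holo m (Fin N) k) (H : ∀ P ∈ symJet m N (univ : Set (Fin (k + 1))), pair P h = 0) :
    h = 0 := by
  obtain ⟨f, hf, rfl⟩ := hh
  -- Undifferentiated test momenta detect the derivatives of orders `1, …, k + 1`: the pairing is a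
  -- positive multiple of `∂_κ f`.
  have hD : ∀ (l : Fin (k + 1)) (κ : Fin (l + 1) → Fin (m + 1)) (K : Fin N),
      iteratedFDeriv ℝ (l + 1) f 0 (fun j => ev (κ j)) K = 0 := by
    intro l κ K
    have h1 := H _ (atJet_mem ix0 (testMom_mem (k := k) K κ univ))
    rw [pair_jc_jc _ hf.contDiffAt] at h1
    have h2 : (fun a => atJet ix0 (testMom k K κ) (a, ix0)) = testMom k K κ := by
      ext a; simp [atJet]
    have h3 : ∀ a lam, atJet ix0 (testMom k K κ) (a, ix1 lam) = 0 := by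
      intro a lam; simp [atJet, (ix0_ne_ix1 lam).symm]
    rw [h2] at h1
    simp only [h3, zero_mul, Finset.sum_const_zero, zero_add, tens_testMom] at h1
    rw [Finset.sum_eq_single K, Finset.sum_eq_single l] at h1
    · have h4 : ∀ ν : Fin (l + 1) → Fin (m + 1),
          (if K = K ∧ lab ν = lab κ then (1 : ℝ) else 0) *
            iteratedFDeriv ℝ (l + 1) f 0 (fun j => ev (ν j)) K =
          (if lab ν = lab κ then (1 : ℝ) else 0) *
            iteratedFDeriv ℝ (l + 1) f 0 (fun j => ev (κ j)) K := by
        intro ν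
        by_cases hν : lab ν = lab κ
        · obtain ⟨σ, rfl⟩ := exists_perm_of_sorted_eq (sorted_eq_of_lab_eq hν)
          simp only [hν, and_self, if_true]
          congr 1
          exact congrFun (iteratedFDeriv_comp_perm (hf.contDiffAt.of_le (natCast_le_infty _))
            (fun j => ev (κ j)) σ) K
        · simp [hν]
      rw [Finset.sum_congr rfl fun ν _ => h4 ν, ← Finset.sum_mul] at h1
      -- The factor is the number of rearrangements of `κ`, which include `κ` itself.
      refine (mul_eq_zero.1 h1).resolve_left (ne_of_gt ?_)
      refine Finset.sum_pos' (fun ν _ => by split_ifs <;> norm_num) ⟨κ, Finset.mem_univ _, ?_⟩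
      simp
    · intro l' _ hl'
      refine Finset.sum_eq_zero fun ν _ => ?_
      rw [if_neg, zero_mul]
      rintro ⟨-, h5⟩
      have := congrArg Sigma.fst h5
      simp only [lab] at this
      exact hl' (Fin.ext (by omega))
    · simp
    · intro K' _ hK'
      refine Finset.sum_eq_zero fun l' _ => Finset.sum_eq_zero fun ν _ => ?_
      rw [if_neg, zero_mul]
      exact fun h5 => hK' h5.1
    · simp
  -- Order zero is not reached by undifferentiated momenta. It is detected by the derivative of a
  -- momentum of level `0`, where the tensor has a single index and symmetry is automatic.
  have hv : ∀ K (μ : {μ : Fin ((0 : Fin (k + 1)) : ℕ) → Fin (m + 1) // Monotone μ}),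
      jc k f 0 (K, ⟨0, μ⟩) = 0 := by
    intro K μ
    let P : MomIdx m N k → ℝ := fun a => if a.2 = 0 ∧ a.1 = (K, ⟨0, μ⟩) then 1 else 0
    have hP : P ∈ symSub m N (univ : Set (Fin (k + 1))) := by
      refine mem_symSub_of_perm fun l _ K' ν σ => ?_
      by_cases hl : l = 0
      · subst hl
        rw [show σ = 1 from Subsingleton.elim (α := Equiv.Perm (Fin 1)) _ _]
        rfl
      · have h0 : ∀ ν' : Fin (l + 1) → Fin (m + 1), tens P K' l ν' = 0 := by
          intro ν'
          simp only [tens, P]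
          rw [if_neg, zero_div]
          rintro ⟨-, h6⟩
          exact hl (congrArg (fun q => q.2.1) h6)
        rw [h0, h0]
    have h1 := H _ (atJet_mem (ix1 0) hP)
    simp only [pair, jc_ix0] at h1
    have h3 : ∀ a, atJet (ix1 0) P (a, ix0) = 0 := by
      intro a; simp [atJet, ix0_ne_ix1]
    have h4 : ∀ i (lam : Fin (m + 1)), atJet (ix1 0) P ((i, lam), ix1 lam) =
        if lam = 0 ∧ i = (K, ⟨0, μ⟩) then 1 else 0 := by
      intro i lam
      simp only [atJet, P, ix1_injective.eq_iff]
      split_ifs <;> simp_all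
    simp only [h3, h4, zero_mul, add_zero] at h1
    rw [Finset.sum_eq_single (K, ⟨0, μ⟩), Finset.sum_eq_single 0] at h1
    · simpa using h1
    · intro lam _ hl; simp [hl]
    · simp
    · intro i _ hi; simp [hi]
    · simp
  -- Every coordinate of `j^1 j^k f` is a derivative of `f` of order between `0` and `k + 1`.
  ext ⟨⟨K, l, μ⟩, j⟩
  obtain rfl | ⟨lam, rfl⟩ := jetIdx_one_cases j
  · rw [jc_ix0]
    induction l using Fin.cases with
    | zero => exact hv K μ
    | succ l => exact hD l.castSucc μ.1 K
  · rw [jc_jc_ix1 hf.contDiffAt]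
    exact hD l _ K

/-- Momenta can be made symmetric without changing the pairing with holonomic jets. -/
theorem exists_symmetrisation (L : Set (Fin (k + 1))) :
    ∃ R : (MomIdx m N k × JetIdx (m + 1) 1 → ℝ) →ₗ[ℝ] (MomIdx m N k × JetIdx (m + 1) 1 → ℝ),
      ∀ P, R P ∈ symJet m N L ∧ ∀ h ∈ holo m (Fin N) k, pair (R P) h = pair P h := by
  let T : (MomIdx m N k × JetIdx (m + 1) 1 → ℝ) →ₗ[ℝ] Module.Dual ℝ (holo m (Fin N) k) :=
    (LinearMap.lcomp ℝ ℝ (holo m (Fin N) k).subtype).comp (pairL m _)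
  let T' := T.comp (symJet m N (univ : Set (Fin (k + 1)))).subtype
  -- Finite-dimensional duality: a subspace of the dual with no common zero except `0` is the whole
  -- dual.
  have hT' : Function.Surjective T' := by
    rw [← LinearMap.range_eq_top, ← Subspace.dualCoannihilator_dualAnnihilator_eq (W := T'.range),
      ← Submodule.dualAnnihilator_bot]
    congr 1
    rw [Submodule.eq_bot_iff]
    rintro ⟨h, hh⟩ hx
    rw [Submodule.mem_dualCoannihilator] at hx
    apply Subtype.ext
    exact eq_zero_of_pair_eq_zero hh fun P hP => hx _ ⟨⟨P, hP⟩, rfl⟩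
  -- A linear section of `T'` turns functionals back into momenta. Its values are symmetric at all
  -- levels, so the construction serves every `L`.
  obtain ⟨g, hg⟩ := T'.exists_rightInverse_of_surjective (LinearMap.range_eq_top.2 hT')
  refine ⟨(symJet m N univ).subtype.comp (g.comp T), fun P => ⟨?_, fun h hh => ?_⟩⟩
  · exact symJet_anti (subset_univ L) (g (T P)).2
  · have := congrArg (fun φ => φ (T P) ⟨h, hh⟩) hg
    exact this

end Tensors
end HigherOrderPhase
end

noncomputable section

namespace HigherOrderPhase

/-! ### Transition functions of charts -/

section Charts

theorem contDiffAt_transition {d : ℕ} {M : Type*} [TopologicalSpace M] [ChartedSpace (Eu d) M]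
    [IsManifold (𝓡 d) ∞ M] {c c' : OpenPartialHomeomorph M (Eu d)}
    (hc : c ∈ IsManifold.maximalAtlas (𝓡 d) ∞ M) (hc' : c' ∈ IsManifold.maximalAtlas (𝓡 d) ∞ M)
    {z : Eu d} (hz : z ∈ c.target) (hz' : c.symm z ∈ c'.source) :
    ContDiffAt ℝ ∞ (fun w => c' (c.symm w)) z := by
  rw [← contMDiffAt_iff_contDiffAt]
  have h1 := (contMDiffOn_symm_of_mem_maximalAtlas hc).contMDiffAt (c.open_target.mem_nhds hz)
  have h2 := (contMDiffOn_of_mem_maximalAtlas hc').contMDiffAt (c'.open_source.mem_nhds hz')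
  exact h2.comp z h1

end Charts

variable {m N : ℕ} {M Φ : Type*}
  [TopologicalSpace M] [ChartedSpace (EuclideanSpace ℝ (Fin (m + 1))) M]
  [TopologicalSpace Φ] [ChartedSpace (EuclideanSpace ℝ (Fin (m + 1 + N))) Φ]
  {π : Φ → M}

theorem FibredChart.contDiffAt_base [IsManifold (𝓡 (m + 1)) ∞ M] (e e' : FibredChart m N π)
    {z : Eu (m + 1)} (hz : z ∈ e.base.target) (hz' : e.base.symm z ∈ e'.base.source) :
    ContDiffAt ℝ ∞ (fun w => e'.base (e.base.symm w)) z :=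
  contDiffAt_transition e.base_mem e'.base_mem hz hz'

theorem FibredChart.eventually_base (e : FibredChart m N π) {x : M} (hx : x ∈ e.base.source)
    {p : Eu (m + 1) → Prop} (h : ∀ᶠ z in 𝓝 (e.base x), p z) : ∀ᶠ y in 𝓝 x, p (e.base y) :=
  (e.base.continuousAt hx).eventually h

theorem FibredChart.eventually_base_symm (e : FibredChart m N π) {z : Eu (m + 1)}
    (hz : z ∈ e.base.target) {p : M → Prop} (h : ∀ᶠ y in 𝓝 (e.base.symm z), p y) :
    ∀ᶠ w in 𝓝 z, p (e.base.symm w) :=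
  (e.base.continuousAt_symm hz).eventually h

/-! ### Bundles with smooth coordinates -/

namespace BundleCoords

variable {B : Type*} {ι : Type} [Fintype ι] (X : BundleCoords m N π B ι)

/-- All coordinates, of the base and of the fibre. -/
def cc (e : FibredChart m N π) (b : B) : Eu (m + 1) × (ι → ℝ) := (e.base (X.proj b), X.coord e b)

/-- The point with given coordinates. -/
def inv [Nonempty B] (e : FibredChart m N π) (z : Eu (m + 1) × (ι → ℝ)) : B :=
  Function.invFunOn (X.cc e) (X.dom e) z

/-- The range of the coordinates. -/
def range (e : FibredChart m N π) : Set (Eu (m + 1) × (ι → ℝ)) := X.cc e '' X.dom e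

/-- The coordinates make `B` a smooth bundle. -/
structure Nice : Prop where
  cover : ∀ b, ∃ e, b ∈ X.dom e
  proj_mem : ∀ e, ∀ b ∈ X.dom e, X.proj b ∈ e.base.source
  injOn : ∀ e, InjOn (X.cc e) (X.dom e)
  isOpen : ∀ e, IsOpen (X.range e)
  smooth : ∀ [Nonempty B] e, ∀ z ∈ X.range e, X.SmoothAt (X.inv e) z

variable {X}

theorem SmoothAt.congr {G : Type*} [NormedAddCommGroup G] [NormedSpace ℝ G] {c c' : G → B} {u : G}
    (h : X.SmoothAt c u) (hc : c =ᶠ[𝓝 u] c') : X.SmoothAt c' u := by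
  intro e he
  obtain ⟨h1, h2⟩ := h e (hc.eq_of_nhds ▸ he)
  refine ⟨?_, h2.congr_of_eventuallyEq ?_⟩
  · filter_upwards [h1, hc] with w hw hcw
    exact hcw ▸ hw
  · filter_upwards [hc] with w hw
    rw [hw]

theorem SmoothAt.comp {G G' : Type*} [NormedAddCommGroup G] [NormedSpace ℝ G]
    [NormedAddCommGroup G'] [NormedSpace ℝ G'] {c : G → B} {v : G' → G} {u : G'}
    (h : X.SmoothAt c (v u)) (hv : ContDiffAt ℝ ∞ v u) : X.SmoothAt (c ∘ v) u := by
  intro e he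
  obtain ⟨h1, h2⟩ := h e he
  exact ⟨hv.continuousAt.eventually h1, h2.comp u hv⟩

theorem SmoothAt.contDiffAt_cc {G : Type*} [NormedAddCommGroup G] [NormedSpace ℝ G] {c : G → B}
    {u : G} (h : X.SmoothAt c u) {e : FibredChart m N π} (he : c u ∈ X.dom e) :
    ContDiffAt ℝ ∞ (fun w => X.cc e (c w)) u :=
  (h e he).2

theorem SmoothAt.contDiffAt_coord {G : Type*} [NormedAddCommGroup G] [NormedSpace ℝ G] {c : G → B}
    {u : G} (h : X.SmoothAt c u) {e : FibredChart m N π} (he : c u ∈ X.dom e) :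
    ContDiffAt ℝ ∞ (fun w => X.coord e (c w)) u :=
  contDiffAt_snd.comp u (h e he).2

/-- Local smooth right inverses of the coordinates suffice: they show that the range is open, and by
injectivity they agree with the chosen inverse `inv`. -/
theorem Nice.of_local_inverse (cover : ∀ b, ∃ e, b ∈ X.dom e)
    (proj_mem : ∀ e, ∀ b ∈ X.dom e, X.proj b ∈ e.base.source)
    (injOn : ∀ e, InjOn (X.cc e) (X.dom e))
    (h : ∀ e, ∀ b ∈ X.dom e, ∃ g : Eu (m + 1) × (ι → ℝ) → B,
      (∀ᶠ z in 𝓝 (X.cc e b), g z ∈ X.dom e ∧ X.cc e (g z) = z) ∧ X.SmoothAt g (X.cc e b)) :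
    X.Nice where
  cover := cover
  proj_mem := proj_mem
  injOn := injOn
  isOpen e := by
    rw [isOpen_iff_mem_nhds]
    rintro _ ⟨b, hb, rfl⟩
    obtain ⟨g, hg, -⟩ := h e b hb
    filter_upwards [hg] with z hz
    exact ⟨g z, hz⟩
  smooth e := by
    rintro _ ⟨b, hb, rfl⟩
    obtain ⟨g, hg, hs⟩ := h e b hb
    refine hs.congr ?_
    filter_upwards [hg] with z hz
    have hz' : z ∈ X.cc e '' X.dom e := ⟨g z, hz⟩
    exact injOn e hz.1 (Function.invFunOn_mem hz') (hz.2.trans (Function.invFunOn_eq hz').symm)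

theorem inv_mem [Nonempty B] {e : FibredChart m N π}
    {z : Eu (m + 1) × (ι → ℝ)} (hz : z ∈ X.range e) : X.inv e z ∈ X.dom e :=
  Function.invFunOn_mem hz

theorem cc_inv [Nonempty B] {e : FibredChart m N π}
    {z : Eu (m + 1) × (ι → ℝ)} (hz : z ∈ X.range e) : X.cc e (X.inv e z) = z :=
  Function.invFunOn_eq hz

theorem cc_mem_range {e : FibredChart m N π} {b : B} (hb : b ∈ X.dom e) : X.cc e b ∈ X.range e :=
  ⟨b, hb, rfl⟩

theorem Nice.inv_cc [Nonempty B] (hX : X.Nice) {e : FibredChart m N π} {b : B} (hb : b ∈ X.dom e) :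
    X.inv e (X.cc e b) = b :=
  hX.injOn e (inv_mem (cc_mem_range hb)) hb (cc_inv (cc_mem_range hb))

theorem Nice.mem_target (hX : X.Nice) {e : FibredChart m N π} {z : Eu (m + 1) × (ι → ℝ)}
    (hz : z ∈ X.range e) : z.1 ∈ e.base.target := by
  obtain ⟨b, hb, rfl⟩ := hz
  exact e.base.map_source (hX.proj_mem e b hb)

theorem Nice.proj_inv [Nonempty B] (hX : X.Nice) {e : FibredChart m N π}
    {z : Eu (m + 1) × (ι → ℝ)} (hz : z ∈ X.range e) : X.proj (X.inv e z) = e.base.symm z.1 := by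
  rw [← congrArg Prod.fst (cc_inv hz)]
  exact (e.base.left_inv (hX.proj_mem e _ (inv_mem hz))).symm

theorem Nice.eventually_range (hX : X.Nice) {e : FibredChart m N π} {z : Eu (m + 1) × (ι → ℝ)}
    (hz : z ∈ X.range e) : ∀ᶠ w in 𝓝 z, w ∈ X.range e :=
  (hX.isOpen e).mem_nhds hz

/-- Smoothness of a map to the bundle may be tested in one chart. -/
theorem Nice.smoothAt_of_chart (hX : X.Nice) {G : Type*} [NormedAddCommGroup G] [NormedSpace ℝ G]
    {c : G → B} {u : G} (e : FibredChart m N π) (h : ∀ᶠ w in 𝓝 u, c w ∈ X.dom e)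
    (hc : ContDiffAt ℝ ∞ (fun w => X.cc e (c w)) u) : X.SmoothAt c u := by
  have : Nonempty B := ⟨c u⟩
  have h1 := SmoothAt.comp (v := fun w => X.cc e (c w)) (u := u)
    (hX.smooth e (X.cc e (c u)) (cc_mem_range h.self_of_nhds)) hc
  refine h1.congr ?_
  filter_upwards [h] with w hw
  exact hX.inv_cc hw

theorem Nice.smoothAt_inv_comp [Nonempty B] (hX : X.Nice) {G : Type*} [NormedAddCommGroup G]
    [NormedSpace ℝ G] {v : G → Eu (m + 1) × (ι → ℝ)} {u : G} (e : FibredChart m N π)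
    (h : v u ∈ X.range e) (hv : ContDiffAt ℝ ∞ v u) : X.SmoothAt (fun w => X.inv e (v w)) u :=
  SmoothAt.comp (v := v) (u := u) (hX.smooth e (v u) h) hv

theorem Nice.proj_eq {s : M → B} {x : M} (hs : X.IsSection s x) : X.proj (s x) = x :=
  hs.1.self_of_nhds

theorem Nice.base_mem (hX : X.Nice) {s : M → B} {x : M} (hs : X.IsSection s x)
    {e : FibredChart m N π} (he : s x ∈ X.dom e) : x ∈ e.base.source := by
  have := hX.proj_mem e _ he
  rwa [Nice.proj_eq hs] at this

/-- In coordinates, a section is a smooth function. -/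
theorem Nice.contDiffAt_rep (hX : X.Nice) {s : M → B} {x : M} (hs : X.IsSection s x)
    {e : FibredChart m N π} (he : s x ∈ X.dom e) :
    ∀ᶠ z in 𝓝 (e.base x), ContDiffAt ℝ ∞ (X.rep e s) z := by
  have hx := hX.base_mem hs he
  have h := (hs.2 e he).and (e.base.open_source.mem_nhds hx)
  have h' : ∀ᶠ z in 𝓝 (e.base x), (s (e.base.symm z) ∈ X.dom e ∧
      ContDiffAt ℝ ∞ (X.rep e s) (e.base (e.base.symm z))) ∧ e.base.symm z ∈ e.base.source := by
    refine e.eventually_base_symm (e.base.map_source hx) (p := fun y => (s y ∈ X.dom e ∧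
      ContDiffAt ℝ ∞ (X.rep e s) (e.base y)) ∧ y ∈ e.base.source) ?_
    rwa [e.base.left_inv hx]
  filter_upwards [h', e.base.open_target.mem_nhds (e.base.map_source hx)] with z hz hzt
  have := hz.1.2
  rwa [e.base.right_inv hzt] at this

theorem IsSection.eventually_dom {s : M → B} {x : M} (hs : X.IsSection s x)
    {e : FibredChart m N π} (he : s x ∈ X.dom e) : ∀ᶠ y in 𝓝 x, s y ∈ X.dom e :=
  (hs.2 e he).mono fun _ h => h.1

theorem Nice.cc_section (hX : X.Nice) {s : M → B} {x : M} (hs : X.IsSection s x)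
    {e : FibredChart m N π} (he : s x ∈ X.dom e) :
    ∀ᶠ z in 𝓝 (e.base x), s (e.base.symm z) ∈ X.dom e ∧
      X.cc e (s (e.base.symm z)) = (z, X.rep e s z) := by
  have hx := hX.base_mem hs he
  have h' : ∀ᶠ z in 𝓝 (e.base x), s (e.base.symm z) ∈ X.dom e ∧
      X.proj (s (e.base.symm z)) = e.base.symm z := by
    refine e.eventually_base_symm (e.base.map_source hx) (p := fun y => s y ∈ X.dom e ∧
      X.proj (s y) = y) ?_
    rw [e.base.left_inv hx]
    exact (IsSection.eventually_dom hs he).and hs.1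
  filter_upwards [h', e.base.open_target.mem_nhds (e.base.map_source hx)] with z hz hzt
  refine ⟨hz.1, ?_⟩
  simp only [cc, rep]
  rw [hz.2, e.base.right_inv hzt]

/-- The property of being a section may be tested in one chart. -/
theorem Nice.isSection_of_chart [IsManifold (𝓡 (m + 1)) ∞ M] (hX : X.Nice) {s : M → B} {x : M}
    (e : FibredChart m N π)
    (hp : ∀ᶠ y in 𝓝 x, X.proj (s y) = y) (hd : ∀ᶠ y in 𝓝 x, s y ∈ X.dom e)
    (hr : ∀ᶠ z in 𝓝 (e.base x), ContDiffAt ℝ ∞ (X.rep e s) z) : X.IsSection s x := by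
  have hx : x ∈ e.base.source := by
    have := hX.proj_mem e _ hd.self_of_nhds
    rwa [hp.self_of_nhds] at this
  refine ⟨hp, fun e' he' => ?_⟩
  -- In the coordinates of `e` the section is a smooth map from the model space to the bundle, and
  -- that notion already refers to all charts.
  have hsm : ∀ᶠ y in 𝓝 x, X.SmoothAt (fun z => s (e.base.symm z)) (e.base y) := by
    filter_upwards [hp.eventually_nhds, hd.eventually_nhds, e.eventually_base hx hr,
      e.base.open_source.mem_nhds hx] with y hpy hdy hry hy
    have hyt := e.base.map_source hy
    have h1 : ∀ᶠ z in 𝓝 (e.base y), s (e.base.symm z) ∈ X.dom e :=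
      e.eventually_base_symm hyt (p := fun y => s y ∈ X.dom e) (by rwa [e.base.left_inv hy])
    have h2 : ∀ᶠ z in 𝓝 (e.base y), X.proj (s (e.base.symm z)) = e.base.symm z :=
      e.eventually_base_symm hyt (p := fun y => X.proj (s y) = y) (by rwa [e.base.left_inv hy])
    refine hX.smoothAt_of_chart e h1 ?_
    refine (contDiffAt_id.prodMk hry).congr_of_eventuallyEq ?_
    filter_upwards [h2, e.base.open_target.mem_nhds hyt] with z hz hzt
    simp only [cc, rep, id]
    rw [hz, e.base.right_inv hzt]
  have hd' : ∀ᶠ y in 𝓝 x, s y ∈ X.dom e' := by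
    have h1 := (hsm.self_of_nhds e' (by simpa only [e.base.left_inv hx] using he')).1
    have h2 := e.eventually_base hx h1
    filter_upwards [h2, e.base.open_source.mem_nhds hx] with y hy hys
    rwa [e.base.left_inv hys] at hy
  filter_upwards [hsm, hd', e.base.open_source.mem_nhds hx, hp] with y hy hdy hys hpy
  refine ⟨hdy, ?_⟩
  have hy' : y ∈ e'.base.source := by
    have := hX.proj_mem e' _ hdy
    rwa [hpy] at this
  have hy't := e'.base.map_source hy'
  have h1 : ContDiffAt ℝ ∞ (fun z => X.coord e' (s (e.base.symm z))) (e.base y) :=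
    hy.contDiffAt_coord (by rwa [e.base.left_inv hys])
  have h2 : ContDiffAt ℝ ∞ (fun w => e.base (e'.base.symm w)) (e'.base y) :=
    e'.contDiffAt_base e hy't (by rwa [e'.base.left_inv hy'])
  have h3 : ContDiffAt ℝ ∞ (fun w => X.coord e' (s (e.base.symm (e.base (e'.base.symm w)))))
      (e'.base y) := by
    refine ContDiffAt.comp (g := fun z => X.coord e' (s (e.base.symm z)))
      (f := fun w => e.base (e'.base.symm w)) (e'.base y) ?_ h2
    rwa [e'.base.left_inv hy']
  refine h3.congr_of_eventuallyEq ?_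
  have h4 : ∀ᶠ w in 𝓝 (e'.base y), e'.base.symm w ∈ e.base.source :=
    e'.eventually_base_symm hy't (p := fun y => y ∈ e.base.source)
      (by rw [e'.base.left_inv hy']; exact e.base.open_source.mem_nhds hys)
  filter_upwards [h4] with w hw
  simp only [rep]
  rw [e.base.left_inv hw]

/-- Being a section is an open condition on the point; this allows all jets of a section near `x` to
be formed. -/
theorem Nice.eventually_isSection [IsManifold (𝓡 (m + 1)) ∞ M] (hX : X.Nice) {s : M → B}
    {x : M} (hs : X.IsSection s x) :
    ∀ᶠ y in 𝓝 x, X.IsSection s y := by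
  obtain ⟨e, he⟩ := hX.cover (s x)
  have hx := hX.base_mem hs he
  filter_upwards [hs.1.eventually_nhds, (IsSection.eventually_dom hs he).eventually_nhds,
    e.eventually_base hx (hX.contDiffAt_rep hs he).eventually_nhds] with y h1 h2 h3
  exact hX.isSection_of_chart e h1 h2 h3

/-- The transition of representations of a section. -/
theorem Nice.rep_trans [Nonempty B] (hX : X.Nice) {s : M → B} {x : M} (hs : X.IsSection s x)
    {e e' : FibredChart m N π} (he : s x ∈ X.dom e) (he' : s x ∈ X.dom e') :
    X.rep e' s =ᶠ[𝓝 (e'.base x)] fun w => X.coord e' (X.inv e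
      (e.base (e'.base.symm w), X.rep e s (e.base (e'.base.symm w)))) := by
  have hx := hX.base_mem hs he
  have hx' := hX.base_mem hs he'
  have h : ∀ᶠ w in 𝓝 (e'.base x), X.cc e (s (e'.base.symm w)) =
      (e.base (e'.base.symm w), X.rep e s (e.base (e'.base.symm w))) ∧
      s (e'.base.symm w) ∈ X.dom e := by
    refine e'.eventually_base_symm (e'.base.map_source hx') (p := fun y => X.cc e (s y) =
      (e.base y, X.rep e s (e.base y)) ∧ s y ∈ X.dom e) ?_
    rw [e'.base.left_inv hx']
    filter_upwards [hs.1, e.base.open_source.mem_nhds hx, IsSection.eventually_dom hs he]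
      with y hy hys hd
    refine ⟨?_, hd⟩
    simp only [cc, rep]
    rw [hy, e.base.left_inv hys]
  filter_upwards [h] with w hw
  rw [← hw.1, hX.inv_cc hw.2]
  rfl

theorem Nice.contDiffAt_trans [Nonempty B] (hX : X.Nice) {e e' : FibredChart m N π}
    {z : Eu (m + 1) × (ι → ℝ)} (hz : z ∈ X.range e) (he' : X.inv e z ∈ X.dom e') :
    ContDiffAt ℝ ∞ (fun w => X.coord e' (X.inv e w)) z :=
  (hX.smooth e z hz).contDiffAt_coord he'

/-- Equality of jets in one chart implies equality of jets in every chart. -/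
theorem Nice.jetEq_trans [IsManifold (𝓡 (m + 1)) ∞ M] (hX : X.Nice) {s t : M → B} {x : M}
    (hs : X.IsSection s x)
    (ht : X.IsSection t x) {e e' : FibredChart m N π} (he : s x ∈ X.dom e) (he' : s x ∈ X.dom e')
    (hst : s x = t x) {r : ℕ} (h : JetEq r (X.rep e s) (X.rep e t) (e.base x)) :
    JetEq r (X.rep e' s) (X.rep e' t) (e'.base x) := by
  have : Nonempty B := ⟨s x⟩
  have hx := hX.base_mem hs he
  have hx' := hX.base_mem hs he'
  have h1 : ContDiffAt ℝ ∞ (fun w => e.base (e'.base.symm w)) (e'.base x) :=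
    e'.contDiffAt_base e (e'.base.map_source hx') (by rwa [e'.base.left_inv hx'])
  have hb : e.base (e'.base.symm (e'.base x)) = e.base x := by rw [e'.base.left_inv hx']
  have hfs := (hX.contDiffAt_rep hs he).self_of_nhds
  have hft := (hX.contDiffAt_rep ht (hst ▸ he)).self_of_nhds
  have hcc : (e.base x, X.rep e s (e.base x)) = X.cc e (s x) := by
    simp only [cc, rep, e.base.left_inv hx, Nice.proj_eq hs]
  have h2 : ContDiffAt ℝ ∞ (fun w => X.coord e' (X.inv e w)) (e.base x, X.rep e s (e.base x)) := by
    rw [hcc]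
    exact hX.contDiffAt_trans (cc_mem_range he) (by rwa [hX.inv_cc he])
  -- The representation in `e'` is the fibre transition applied to `(id, rep e)` and then composed
  -- with the change of base coordinates; both compositions respect equality of jets.
  have h3 := (JetEq.prodMk (JetEq.refl r id _) h contDiffAt_id contDiffAt_id hfs hft)
  have h4 := JetEq.comp_left h3 (contDiffAt_id.prodMk hfs) (contDiffAt_id.prodMk hft) h2
  rw [← hb] at h4
  have hst' : X.rep e t (e.base x) = X.rep e s (e.base x) := by
    simp only [rep, e.base.left_inv hx, hst]
  have h5 := JetEq.comp_right (z := e'.base x) (h := fun w => e.base (e'.base.symm w)) h4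
    (by
      rw [hb]
      exact ContDiffAt.comp (e.base x) h2 (contDiffAt_id.prodMk hfs))
    (by
      rw [hb]
      refine ContDiffAt.comp (e.base x) ?_ (contDiffAt_id.prodMk hft)
      simp only [id, hst']
      exact h2)
    h1
  exact ((JetEq.of_eventuallyEq (hX.rep_trans hs he he')).trans h5).trans
    (JetEq.of_eventuallyEq (hX.rep_trans ht (hst ▸ he) (hst ▸ he'))).symm

/-- A smooth function gives a section. -/
theorem Nice.section_of_function [IsManifold (𝓡 (m + 1)) ∞ M] [Nonempty B] (hX : X.Nice)
    (e : FibredChart m N π)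
    {f : Eu (m + 1) → ι → ℝ} {z : Eu (m + 1)} (hz : (z, f z) ∈ X.range e)
    (hf : ∀ᶠ w in 𝓝 z, ContDiffAt ℝ ∞ f w) :
    X.IsSection (fun y => X.inv e (e.base y, f (e.base y))) (e.base.symm z) ∧
    (∀ᶠ y in 𝓝 (e.base.symm z), (e.base y, f (e.base y)) ∈ X.range e) ∧
    X.rep e (fun y => X.inv e (e.base y, f (e.base y))) =ᶠ[𝓝 z] f := by
  have hzt := hX.mem_target hz
  have hzs := e.base.map_target hzt
  have hzr : e.base (e.base.symm z) = z := e.base.right_inv hzt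
  have h1 : ∀ᶠ w in 𝓝 z, (w, f w) ∈ X.range e :=
    (continuousAt_id.prodMk hf.self_of_nhds.continuousAt).eventually (hX.eventually_range hz)
  have h2 : ∀ᶠ y in 𝓝 (e.base.symm z), (e.base y, f (e.base y)) ∈ X.range e :=
    e.eventually_base hzs (p := fun w => (w, f w) ∈ X.range e) (by rwa [hzr])
  have h3 : X.rep e (fun y => X.inv e (e.base y, f (e.base y))) =ᶠ[𝓝 z] f := by
    filter_upwards [h1, e.base.open_target.mem_nhds hzt] with w hw hwt
    simp only [rep]
    rw [e.base.right_inv hwt]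
    exact congrArg Prod.snd (cc_inv hw)
  refine ⟨hX.isSection_of_chart e ?_ ?_ ?_, h2, h3⟩
  · filter_upwards [h2, e.base.open_source.mem_nhds hzs] with y hy hys
    rw [hX.proj_inv hy]
    exact e.base.left_inv hys
  · filter_upwards [h2] with y hy
    exact inv_mem hy
  · rw [hzr]
    filter_upwards [hf, h3.eventually_nhds] with w hw hw3
    exact hw.congr_of_eventuallyEq hw3

end BundleCoords

end HigherOrderPhase
end

noncomputable section

namespace HigherOrderPhase

open BundleCoords

variable {m N : ℕ} {M Φ : Type*}
  [TopologicalSpace M] [ChartedSpace (EuclideanSpace ℝ (Fin (m + 1))) M]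
  [TopologicalSpace Φ] [ChartedSpace (EuclideanSpace ℝ (Fin (m + 1 + N))) Φ]
  {π : Φ → M}

/-! ### Jet bundles have smooth coordinates -/

section JetNice

variable {B : Type*} {ι : Type} [Fintype ι] {X : BundleCoords m N π B ι}

theorem Jet.exists_rep {k : ℕ} (ζ : Jet X k) :
    ∃ (s : M → B) (hs : X.IsSection s ζ.1), ζ = Jet.mk k s hs := by
  obtain ⟨x, q⟩ := ζ
  induction q using Quotient.inductionOn with
  | h s => exact ⟨s.1, s.2, rfl⟩

/-- Equality of jets is defined through all charts, but testing it in a single one is enough. -/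
theorem Jet.mk_eq_of_jetEq [IsManifold (𝓡 (m + 1)) ∞ M] (hX : X.Nice) {k : ℕ} {s t : M → B} {x : M}
    (hs : X.IsSection s x) (ht : X.IsSection t x) {e : FibredChart m N π} (he : s x ∈ X.dom e)
    (he' : t x ∈ X.dom e) (h : JetEq (k + 1) (X.rep e s) (X.rep e t) (e.base x)) :
    Jet.mk k s hs = Jet.mk k t ht := by
  have hx := hX.base_mem hs he
  have h0 := h.eq (Nat.succ_pos _)
  have hst : s x = t x := by
    refine hX.injOn e he he' ?_
    simp only [rep, e.base.left_inv hx] at h0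
    simp only [cc, Nice.proj_eq hs, Nice.proj_eq ht, h0]
  simp only [Jet.mk]
  congr 1
  refine Quotient.sound ⟨hst, fun e' he'' l hl => ?_⟩
  exact hX.jetEq_trans hs ht he he'' hst h l (Nat.lt_succ_of_le hl)

/-- The coordinates use an arbitrarily chosen representative; on `dom e` the defining equivalence
makes the choice irrelevant. -/
theorem jetB_coord_mk {k : ℕ} {s : M → B} {x : M} (hs : X.IsSection s x) {e : FibredChart m N π}
    (he : s x ∈ X.dom e) : (jetB X k).coord e (Jet.mk k s hs) = jc k (X.rep e s) (e.base x) := by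
  have h1 : (jetSetoid X k x).r (Quotient.out (Jet.mk k s hs).2) ⟨s, hs⟩ :=
    Quotient.exact (s := jetSetoid X k x) (Quotient.out_eq _)
  have h2 : s x = (Quotient.out (Jet.mk k s hs).2).1 x := h1.1.symm
  have h3 : JetEq (k + 1) (X.rep e (Quotient.out (Jet.mk k s hs).2).1) (X.rep e s) (e.base x) :=
    fun l hl => h1.2 e (h2 ▸ he) l (Nat.le_of_lt_succ hl)
  exact h3.jc_eq

theorem jetB_mem_dom_mk {k : ℕ} {s : M → B} {x : M} (hs : X.IsSection s x) {e : FibredChart m N π} :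
    Jet.mk k s hs ∈ (jetB X k).dom e ↔ s x ∈ X.dom e := Iff.rfl

/-- The value part of the jet coordinates. -/
def jetVal {k : ℕ} (a : ι × JetIdx (m + 1) k → ℝ) : ι → ℝ := fun i => a (i, ⟨0, sorted Fin.elim0⟩)

theorem jetVal_jc {k : ℕ} (f : Eu (m + 1) → ι → ℝ) (z : Eu (m + 1)) :
    jetVal (jc k f z) = f z := by
  ext i
  exact congrFun (iteratedFDeriv_zero_apply _) i

theorem continuous_jetVal {k : ℕ} :
    Continuous (jetVal : (ι × JetIdx (m + 1) k → ℝ) → ι → ℝ) := by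
  unfold jetVal
  fun_prop

theorem jetVal_coord {k : ℕ} {ζ : Jet X k} {e : FibredChart m N π} (h : ζ ∈ (jetB X k).dom e)
    (hX : X.Nice) : jetVal ((jetB X k).coord e ζ) = X.coord e ζ.target := by
  obtain ⟨s, hs, hζ⟩ := Jet.exists_rep ζ
  generalize ζ.1 = x at s hs hζ
  subst hζ
  have he : s x ∈ X.dom e := h
  rw [jetB_coord_mk hs he, jetVal_jc]
  simp only [rep, e.base.left_inv (hX.base_mem hs he)]
  rfl

theorem Jet.proj_target {k : ℕ} (ζ : Jet X k) : X.proj ζ.target = ζ.1 := by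
  obtain ⟨s, hs, hζ⟩ := Jet.exists_rep ζ
  generalize ζ.1 = x at s hs hζ ⊢
  subst hζ
  exact Nice.proj_eq hs

theorem Jet.cc_target (hX : X.Nice) {k : ℕ} {ζ : Jet X k} {e : FibredChart m N π}
    (h : ζ ∈ (jetB X k).dom e) :
    X.cc e ζ.target = (((jetB X k).cc e ζ).1, jetVal ((jetB X k).cc e ζ).2) := by
  simp only [cc, jetVal_coord h hX, Jet.proj_target]
  rfl

/-- The section of polynomial form with given jet coordinates. -/
def polySection [Nonempty B] (X : BundleCoords m N π B ι) (e : FibredChart m N π) (k : ℕ)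
    (z : Eu (m + 1)) (a : ι × JetIdx (m + 1) k → ℝ) (y : M) : B :=
  X.inv e (e.base y, taylorPoly k z a (e.base y))

theorem taylorPoly_self (k : ℕ) (z : Eu (m + 1)) (a : ι × JetIdx (m + 1) k → ℝ) :
    taylorPoly k z a z = jetVal a := by
  rw [← jetVal_jc (k := k) (taylorPoly k z a) z, jc_taylorPoly]

variable [IsManifold (𝓡 (m + 1)) ∞ M]

theorem Nice.polySection [Nonempty B] (hX : X.Nice) (e : FibredChart m N π) (k : ℕ)
    {z : Eu (m + 1)} {a : ι × JetIdx (m + 1) k → ℝ} (h : (z, jetVal a) ∈ X.range e) :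
    X.IsSection (polySection X e k z a) (e.base.symm z) ∧
      polySection X e k z a (e.base.symm z) = X.inv e (z, jetVal a) ∧
      X.rep e (polySection X e k z a) =ᶠ[𝓝 z] taylorPoly k z a := by
  have h' : (z, taylorPoly k z a z) ∈ X.range e := by rwa [taylorPoly_self]
  obtain ⟨h1, h2, h3⟩ := hX.section_of_function e h'
    (Eventually.of_forall fun w => (contDiff_taylorPoly k z a).contDiffAt)
  refine ⟨h1, ?_, h3⟩
  simp only [HigherOrderPhase.polySection]
  rw [e.base.right_inv (hX.mem_target h), taylorPoly_self]

open Classical in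
/-- The jet with given coordinates. -/
def jetOf [Nonempty B] (X : BundleCoords m N π B ι) (e : FibredChart m N π) (k : ℕ) (ζ₀ : Jet X k)
    (p : Eu (m + 1) × (ι × JetIdx (m + 1) k → ℝ)) : Jet X k :=
  -- The default `ζ₀` is never taken when the value part of the coordinates lies in the range of the
  -- chart.
  if h : X.IsSection (polySection X e k p.1 p.2) (e.base.symm p.1) then Jet.mk k _ h else ζ₀

theorem jetOf_spec [Nonempty B] (hX : X.Nice) (e : FibredChart m N π) (k : ℕ) (ζ₀ : Jet X k)
    {p : Eu (m + 1) × (ι × JetIdx (m + 1) k → ℝ)} (hp : (p.1, jetVal p.2) ∈ X.range e) :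
    jetOf X e k ζ₀ p ∈ (jetB X k).dom e ∧ (jetB X k).cc e (jetOf X e k ζ₀ p) = p := by
  obtain ⟨h1, h2, h3⟩ := Nice.polySection hX e k hp
  have hd : polySection X e k p.1 p.2 (e.base.symm p.1) ∈ X.dom e := by
    rw [h2]
    exact inv_mem hp
  simp only [jetOf]
  rw [dif_pos h1]
  refine ⟨hd, ?_⟩
  have hr := e.base.right_inv (hX.mem_target hp)
  refine Prod.ext hr ?_
  change (jetB X k).coord e (Jet.mk k _ h1) = p.2
  rw [jetB_coord_mk h1 hd, hr, jc_congr h3, jc_taylorPoly]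

/-- In another chart the polynomial sections form a smooth family of functions, evaluated at a
smoothly moving point; their jets then depend smoothly on the prescribed coordinates. -/
theorem jetOf_smooth [Nonempty B] (hX : X.Nice) (e : FibredChart m N π) (k : ℕ) (ζ₀ : Jet X k)
    {p : Eu (m + 1) × (ι × JetIdx (m + 1) k → ℝ)} (hp : (p.1, jetVal p.2) ∈ X.range e) :
    (jetB X k).SmoothAt (jetOf X e k ζ₀) p := by
  intro e' he'
  have hcont : ContDiff ℝ ∞ (fun p : Eu (m + 1) × (ι × JetIdx (m + 1) k → ℝ) =>
      (p.1, jetVal p.2)) := by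
    unfold jetVal
    fun_prop
  have hrange : ∀ᶠ q : Eu (m + 1) × (ι × JetIdx (m + 1) k → ℝ) in 𝓝 p,
      (q.1, jetVal q.2) ∈ X.range e :=
    hcont.continuous.continuousAt.eventually (hX.eventually_range hp)
  have hval : ∀ q : Eu (m + 1) × (ι × JetIdx (m + 1) k → ℝ), (q.1, jetVal q.2) ∈ X.range e →
      ∃ h : X.IsSection (polySection X e k q.1 q.2) (e.base.symm q.1),
        jetOf X e k ζ₀ q = Jet.mk k _ h := fun q hq => by
    have h := (Nice.polySection hX e k hq).1
    exact ⟨h, by simp only [jetOf, dif_pos h]⟩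
  have hmem : ∀ q : Eu (m + 1) × (ι × JetIdx (m + 1) k → ℝ), (q.1, jetVal q.2) ∈ X.range e →
      (jetOf X e k ζ₀ q ∈ (jetB X k).dom e' ↔ X.inv e (q.1, jetVal q.2) ∈ X.dom e') :=
    fun q hq => by
      obtain ⟨h, hj⟩ := hval q hq
      rw [hj, jetB_mem_dom_mk, (Nice.polySection hX e k hq).2.1]
  have hsm : X.SmoothAt (fun q : Eu (m + 1) × (ι × JetIdx (m + 1) k → ℝ) =>
      X.inv e (q.1, jetVal q.2)) p := hX.smoothAt_inv_comp e hp hcont.contDiffAt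
  have hpd := (hmem p hp).1 he'
  have hdom : ∀ᶠ q in 𝓝 p, jetOf X e k ζ₀ q ∈ (jetB X k).dom e' := by
    filter_upwards [hrange, (hsm e' hpd).1] with q hq hq'
    exact (hmem q hq).2 hq'
  refine ⟨hdom, ?_⟩
  have hzt := hX.mem_target hp
  have hzs := e.base.map_target hzt
  have hzs' : e.base.symm p.1 ∈ e'.base.source := by
    have := hX.proj_mem e' _ hpd
    rwa [hX.proj_inv hp] at this
  have hψ' : ContDiffAt ℝ ∞ (fun w => e'.base (e.base.symm w)) p.1 := e.contDiffAt_base e' hzt hzs'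
  let z' := e'.base (e.base.symm p.1)
  have hz't : z' ∈ e'.base.target := e'.base.map_source hzs'
  have hz'1 : e'.base.symm z' = e.base.symm p.1 := e'.base.left_inv hzs'
  have hψ : ContDiffAt ℝ ∞ (fun w => e.base (e'.base.symm w)) z' :=
    e'.contDiffAt_base e hz't (by rwa [hz'1])
  have hψz : e.base (e'.base.symm z') = p.1 := by rw [hz'1, e.base.right_inv hzt]
  -- The polynomial section with jet coordinates `q`, written in the chart `e'`.
  let g : (Eu (m + 1) × (ι × JetIdx (m + 1) k → ℝ)) → Eu (m + 1) → ι → ℝ := fun q w =>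
    X.coord e' (X.inv e (e.base (e'.base.symm w), taylorPoly k q.1 q.2 (e.base (e'.base.symm w))))
  have hg : ContDiffAt ℝ ∞ (Function.uncurry g) (p, z') := by
    have h1 : ContDiffAt ℝ ∞ (fun r : (Eu (m + 1) × (ι × JetIdx (m + 1) k → ℝ)) × Eu (m + 1) =>
        e.base (e'.base.symm r.2)) (p, z') :=
      ContDiffAt.comp (g := fun w => e.base (e'.base.symm w)) (p, z') hψ contDiffAt_snd
    have h2 : ContDiffAt ℝ ∞ (fun r : (Eu (m + 1) × (ι × JetIdx (m + 1) k → ℝ)) × Eu (m + 1) =>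
        taylorPoly k r.1.1 r.1.2 (e.base (e'.base.symm r.2))) (p, z') :=
      (contDiff_taylorPoly_param k).contDiffAt.comp (p, z')
        (f := fun r : (Eu (m + 1) × (ι × JetIdx (m + 1) k → ℝ)) × Eu (m + 1) =>
          (r.1, e.base (e'.base.symm r.2))) (contDiffAt_fst.prodMk h1)
    have h3 : (e.base (e'.base.symm z'), taylorPoly k p.1 p.2 (e.base (e'.base.symm z'))) =
        (p.1, jetVal p.2) := by
      simp only [hψz, taylorPoly_self]
    refine ContDiffAt.comp (g := fun w => X.coord e' (X.inv e w)) (p, z') ?_ (h1.prodMk h2)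
    change ContDiffAt ℝ ∞ _ (e.base (e'.base.symm z'), taylorPoly k p.1 p.2
        (e.base (e'.base.symm z')))
    rw [h3]
    exact hX.contDiffAt_trans hp hpd
  have hbase : ContDiffAt ℝ ∞ (fun q : Eu (m + 1) × (ι × JetIdx (m + 1) k → ℝ) =>
      e'.base (e.base.symm q.1)) p := hψ'.comp p contDiffAt_fst
  have hmain := contDiffAt_jc_param (k := k) hg hbase
  refine (hbase.prodMk hmain).congr_of_eventuallyEq ?_
  filter_upwards [hdom, hrange] with q hqd hq
  obtain ⟨h, hj⟩ := hval q hq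
  rw [hj] at hqd ⊢
  refine Prod.ext rfl ?_
  change (jetB X k).coord e' (Jet.mk k _ h) = _
  rw [jetB_coord_mk h hqd]
  have hqs := e.base.map_target (hX.mem_target hq)
  have hqd1 : polySection X e k q.1 q.2 (e.base.symm q.1) ∈ X.dom e := by
    rw [(Nice.polySection hX e k hq).2.1]
    exact inv_mem hq
  have hqs' := hX.base_mem h hqd
  refine jc_congr ((hX.rep_trans h hqd1 hqd).trans ?_)
  have h5 : ∀ᶠ w in 𝓝 (e'.base (e.base.symm q.1)), X.rep e
    (HigherOrderPhase.polySection X e k q.1 q.2)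
      (e.base (e'.base.symm w)) = taylorPoly k q.1 q.2 (e.base (e'.base.symm w)) := by
    refine e'.eventually_base_symm (e'.base.map_source hqs') (p := fun y =>
      X.rep e (HigherOrderPhase.polySection X e k q.1 q.2) (e.base y) =
        taylorPoly k q.1 q.2 (e.base y)) ?_
    rw [e'.base.left_inv hqs']
    refine e.eventually_base hqs (p := fun z =>
      X.rep e (HigherOrderPhase.polySection X e k q.1 q.2) z = taylorPoly k q.1 q.2 z) ?_
    rw [e.base.right_inv (hX.mem_target hq)]
    exact (Nice.polySection hX e k hq).2.2
  filter_upwards [h5] with w hw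
  simp only [g, hw]

theorem jetB_injOn (hX : X.Nice) (k : ℕ) (e : FibredChart m N π) :
    InjOn ((jetB X k).cc e) ((jetB X k).dom e) := by
  intro ζ hζ η hη h
  obtain ⟨s, hs, hζ'⟩ := Jet.exists_rep ζ
  obtain ⟨t, ht, hη'⟩ := Jet.exists_rep η
  generalize ζ.1 = x at s hs hζ'
  generalize η.1 = y at t ht hη'
  subst hζ' hη'
  have hs' : s x ∈ X.dom e := hζ
  have ht' : t y ∈ X.dom e := hη
  have h1 : e.base x = e.base y := congrArg Prod.fst h
  have hxy : x = y := e.base.injOn (hX.base_mem hs hs') (hX.base_mem ht ht') h1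
  subst hxy
  have h2 : (jetB X k).coord e (Jet.mk k s hs) = (jetB X k).coord e (Jet.mk k t ht) :=
    congrArg Prod.snd h
  rw [jetB_coord_mk hs hs', jetB_coord_mk ht ht'] at h2
  exact Jet.mk_eq_of_jetEq hX hs ht hs' ht' (jetEq_of_jc_eq (hX.contDiffAt_rep hs hs').self_of_nhds
    (hX.contDiffAt_rep ht ht').self_of_nhds h2)

/-- Derivatives can be prescribed freely by a polynomial; only the value has to lie in the range of
the chart. -/
theorem jetB_range (hX : X.Nice) (k : ℕ) (e : FibredChart m N π)
    (p : Eu (m + 1) × (ι × JetIdx (m + 1) k → ℝ)) :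
    p ∈ (jetB X k).range e ↔ (p.1, jetVal p.2) ∈ X.range e := by
  constructor
  · rintro ⟨ζ, hζ, rfl⟩
    rw [← Jet.cc_target hX hζ]
    exact cc_mem_range hζ
  · intro hp
    obtain ⟨b, hb, hb'⟩ := id hp
    have : Nonempty B := ⟨b⟩
    have h := (Nice.polySection hX e k hp).1
    exact ⟨_, jetOf_spec hX e k (Jet.mk k _ h) hp⟩

theorem jetB_nice (hX : X.Nice) (k : ℕ) : (jetB X k).Nice := by
  refine Nice.of_local_inverse (fun ζ => hX.cover ζ.target) (fun e ζ hζ => ?_)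
    (jetB_injOn hX k) (fun e ζ hζ => ?_)
  · have := hX.proj_mem e _ hζ
    rwa [Jet.proj_target] at this
  · have : Nonempty B := ⟨ζ.target⟩
    have hr : (((jetB X k).cc e ζ).1, jetVal ((jetB X k).cc e ζ).2) ∈ X.range e :=
      (jetB_range hX k e _).1 (cc_mem_range hζ)
    refine ⟨jetOf X e k ζ, ?_, jetOf_smooth hX e k ζ hr⟩
    have hc : Continuous (fun p : Eu (m + 1) × (ι × JetIdx (m + 1) k → ℝ) => (p.1, jetVal p.2)) :=
      continuous_fst.prodMk (continuous_jetVal.comp continuous_snd)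
    filter_upwards [hc.continuousAt.eventually (hX.eventually_range hr)] with p hp
    exact jetOf_spec hX e k ζ hp

end JetNice

end HigherOrderPhase
end

noncomputable section

namespace HigherOrderPhase

/-! ### `(n - 1)`-forms and vector densities -/

section Forms

variable {m : ℕ}

/-- The standard basis of the model space. -/
abbrev stdB (n : ℕ) : Module.Basis (Fin n) ℝ (Eu n) := (EuclideanSpace.basisFun (Fin n) ℝ).toBasis

theorem stdB_apply {n : ℕ} (i : Fin n) : stdB n i = ev i := by
  simp [stdB]

/-- The determinant as a continuous alternating form. -/
def detForm (n : ℕ) : Eu n [⋀^Fin n]→L[ℝ] ℝ :=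
  { (stdB n).det with
    cont := by
      have : Continuous fun v : Fin n → Eu n => Matrix.det (fun i j => v j i) :=
        Continuous.matrix_det (by fun_prop)
      convert this using 2 with v
      change (stdB n).det v = _
      rw [Module.Basis.det_apply]
      rfl }

theorem detForm_apply {n : ℕ} (v : Fin n → Eu n) : detForm n v = (stdB n).det v := rfl

/-- The `(n - 1)`-form which corresponds to a vector density `V^λ`, i.e. `V^λ d_λ`. -/
def star : Eu (m + 1) →L[ℝ] Eu (m + 1) [⋀^Fin m]→L[ℝ] ℝ := (detForm (m + 1)).curryLeft

theorem star_apply (V : Eu (m + 1)) (v : Fin m → Eu (m + 1)) :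
    star V v = (stdB (m + 1)).det (Matrix.vecCons V v) := rfl

/-- The vector density of an `(n - 1)`-form. -/
def coef (α : Eu (m + 1) [⋀^Fin m]→L[ℝ] ℝ) : Eu (m + 1) :=
  WithLp.toLp 2 fun lam => (-1) ^ (lam : ℕ) * α fun j => ev (lam.succAbove j)

theorem coef_apply (α : Eu (m + 1) [⋀^Fin m]→L[ℝ] ℝ) (lam : Fin (m + 1)) :
    coef α lam = (-1) ^ (lam : ℕ) * α fun j => ev (lam.succAbove j) := rfl

/-- Expand the determinant along the column of `V`: once the basis vectors other than the one
labelled `lam` are inserted, only the component `lam` survives, and the signs cancel. -/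
theorem coef_star (V : Eu (m + 1)) : coef (star V) = V := by
  ext lam
  rw [coef_apply, star_apply, Module.Basis.det_apply, Matrix.det_succ_column_zero,
    Finset.sum_eq_single lam]
  · have h1 : ((stdB (m + 1)).toMatrix
        (Matrix.vecCons V fun j => ev (lam.succAbove j))).submatrix lam.succAbove Fin.succ = 1 := by
      ext i j
      simp [Module.Basis.toMatrix_apply, Matrix.one_apply, stdB]
    rw [h1, Matrix.det_one]
    simp only [Module.Basis.toMatrix_apply, Matrix.cons_val_zero, mul_one]
    rw [← mul_assoc, ← mul_pow]
    simp [stdB]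
  · intro i _ hi
    obtain ⟨c, hc⟩ := Fin.exists_succAbove_eq (Ne.symm hi)
    rw [Matrix.det_eq_zero_of_row_eq_zero c, mul_zero]
    intro j
    simp [Module.Basis.toMatrix_apply, stdB, hc, (Fin.succAbove_ne lam j).symm]
  · simp

/-- An injective choice of `m` out of `m + 1` basis vectors omits one of them, hence is a
permutation of the list on which `coef` evaluates. -/
theorem form_ext {α β : Eu (m + 1) [⋀^Fin m]→L[ℝ] ℝ} (h : coef α = coef β) : α = β := by
  apply ContinuousAlternatingMap.toAlternatingMap_injective
  refine Module.Basis.ext_alternating (stdB (m + 1)) fun v hv => ?_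
  obtain ⟨lam, hlam⟩ : ∃ lam, ∀ j, v j ≠ lam := by
    by_contra hcon
    push Not at hcon
    have := Fintype.card_le_of_surjective v hcon
    simp at this
  choose u hu using fun j => Fin.exists_succAbove_eq (hlam j)
  have hu' : Function.Injective u := fun a b hab => hv (by rw [← hu a, ← hu b, hab])
  let σ : Equiv.Perm (Fin m) := Equiv.ofBijective u (Finite.injective_iff_bijective.1 hu')
  have hv' : (fun i => stdB (m + 1) (v i)) =
      (fun j => (ev (lam.succAbove j) : Eu (m + 1))) ∘ σ := by
    ext i : 1
    simp only [Function.comp, stdB_apply]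
    rw [← hu i]
    rfl
  rw [hv', AlternatingMap.map_perm, AlternatingMap.map_perm]
  congr 1
  have h1 := congrArg (fun V : Eu (m + 1) => V lam) h
  simp only [coef_apply] at h1
  exact mul_left_cancel₀ (pow_ne_zero _ (by norm_num)) h1

theorem star_coef (α : Eu (m + 1) [⋀^Fin m]→L[ℝ] ℝ) : star (coef α) = α :=
  form_ext (coef_star _)

theorem coef_smul (c : ℝ) (α : Eu (m + 1) [⋀^Fin m]→L[ℝ] ℝ) : coef (c • α) = c • coef α := by
  ext lam
  simp [coef_apply, mul_left_comm]

/-- This is multiplicativity of the determinant, so `A` need not be invertible. -/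
theorem coef_pullback (A : Eu (m + 1) →L[ℝ] Eu (m + 1)) (u : Eu (m + 1)) :
    coef ((star (A u)).compContinuousLinearMap A) = A.det • u := by
  have : (star (A u)).compContinuousLinearMap A = A.det • star u := by
    ext v
    rw [ContinuousAlternatingMap.compContinuousLinearMap_apply, ContinuousAlternatingMap.smul_apply,
      star_apply, star_apply, smul_eq_mul]
    have := Module.Basis.det_comp (stdB (m + 1)) (A : Eu (m + 1) →ₗ[ℝ] Eu (m + 1))
      (Matrix.vecCons u v)
    rw [show (Matrix.vecCons (A u) (A ∘ v)) =
      (A : Eu (m + 1) →ₗ[ℝ] Eu (m + 1)) ∘ (Matrix.vecCons u v) by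
        ext j : 1
        induction j using Fin.cases <;> simp]
    exact this
  rw [this, coef_smul, coef_star]

/-- The divergence of a vector density. -/
def dvg (V : Eu (m + 1) → Eu (m + 1)) (z : Eu (m + 1)) : ℝ :=
  ∑ lam, fderiv ℝ V z (ev lam) lam

/-- Forms of top degree are multiples of the determinant, so it is enough to evaluate on the
standard basis, where the exterior derivative is an alternating sum equal to the divergence. -/
theorem extDeriv_star {V : Eu (m + 1) → Eu (m + 1)} {z : Eu (m + 1)} (hV : DifferentiableAt ℝ V z) :
    extDeriv (fun w => star (V w)) z = dvg V z • detForm (m + 1) := by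
  apply ContinuousAlternatingMap.toAlternatingMap_injective
  refine AlternatingMap.ext fun v => ?_
  have hd : DifferentiableAt ℝ (fun w => star (V w)) z := star.differentiableAt.comp z hV
  have key : ((extDeriv (fun w => star (V w)) z).toAlternatingMap) =
      ((extDeriv (fun w => star (V w)) z).toAlternatingMap (stdB (m + 1))) • (stdB (m + 1)).det :=
    AlternatingMap.eq_smul_basis_det _ _
  have hval : (extDeriv (fun w => star (V w)) z).toAlternatingMap (stdB (m + 1)) = dvg V z := by
    change extDeriv (fun w => star (V w)) z (stdB (m + 1)) = _
    rw [extDeriv_apply hd, dvg]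
    refine Finset.sum_congr rfl fun lam _ => ?_
    have h1 : ∀ w, V w lam = (-1) ^ (lam : ℕ) * star (V w) (lam.removeNth (stdB (m + 1))) := by
      intro w
      conv_lhs => rw [← coef_star (V w)]
      rw [coef_apply]
      congr 2
      ext j : 1
      rw [Fin.removeNth, stdB_apply]
    have h2 : fderiv ℝ V z (ev lam) lam = fderiv ℝ (fun w => V w lam) z (ev lam) := by
      have := ((EuclideanSpace.proj lam : Eu (m + 1) →L[ℝ] ℝ).hasFDerivAt.comp z
        hV.hasFDerivAt).fderiv
      have h3 := congrArg (fun L : Eu (m + 1) →L[ℝ] ℝ => L (ev lam)) this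
      exact h3.symm
    rw [h2]
    simp_rw [h1]
    have h4 : DifferentiableAt ℝ (fun w => star (V w) (lam.removeNth (stdB (m + 1)))) z := by
      have : DifferentiableAt ℝ (fun w => (-1) ^ (lam : ℕ) * V w lam) z := by fun_prop
      refine this.congr_of_eventuallyEq (Eventually.of_forall fun w => ?_)
      simp only
      rw [h1 w, ← mul_assoc, ← mul_pow]
      simp
    rw [fderiv_const_mul h4, stdB_apply]
    simp
  rw [key, hval]
  rfl

/-- The divergence of a vector density does not depend on the coordinates. -/
theorem dvg_pullback {V : Eu (m + 1) → Eu (m + 1)} {ψ : Eu (m + 1) → Eu (m + 1)} {z : Eu (m + 1)}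
    (hV : DifferentiableAt ℝ V (ψ z)) (hψ : ContDiffAt ℝ ∞ ψ z) {W : Eu (m + 1) → Eu (m + 1)}
    (hW : DifferentiableAt ℝ W z)
    (h : ∀ᶠ w in 𝓝 z, W w = coef ((star (V (ψ w))).compContinuousLinearMap (fderiv ℝ ψ w))) :
    dvg W z = (fderiv ℝ ψ z).det * dvg V (ψ z) := by
  have h1 : (fun w => star (W w)) =ᶠ[𝓝 z]
      fun w => (star (V (ψ w))).compContinuousLinearMap (fderiv ℝ ψ w) := by
    filter_upwards [h] with w hw
    rw [hw, star_coef]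
  -- Naturality of the exterior derivative. It involves the second derivatives of `ψ`, and none of
  -- them remains in the result.
  have h2 : extDeriv (fun w => (star (V (ψ w))).compContinuousLinearMap (fderiv ℝ ψ w)) z =
      (extDeriv (fun w => star (V w)) (ψ z)).compContinuousLinearMap (fderiv ℝ ψ z) :=
    extDeriv_pullback (r := 2) (star.differentiableAt.comp _ hV)
      (hψ.of_le (natCast_le_infty 2)) (by simp)
  rw [← h1.extDeriv_eq, extDeriv_star hW, extDeriv_star hV] at h2
  have h3 := congrArg (fun β : Eu (m + 1) [⋀^Fin (m + 1)]→L[ℝ] ℝ => β (stdB (m + 1))) h2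
  simp only [ContinuousAlternatingMap.smul_apply, detForm_apply, Module.Basis.det_self,
    smul_eq_mul, mul_one, ContinuousAlternatingMap.compContinuousLinearMap_apply] at h3
  have h4 := Module.Basis.det_comp (stdB (m + 1))
    ((fderiv ℝ ψ z : Eu (m + 1) →L[ℝ] Eu (m + 1)) : Eu (m + 1) →ₗ[ℝ] Eu (m + 1)) (stdB (m + 1))
  rw [Module.Basis.det_self, mul_one] at h4
  rw [h3, mul_comm]
  congr 1

theorem contDiffAt_coef_pullback {G : Type*} [NormedAddCommGroup G] [NormedSpace ℝ G]
    {V : G → Eu (m + 1)} {A : G → Eu (m + 1) →L[ℝ] Eu (m + 1)} {u : G} (hV : ContDiffAt ℝ ∞ V u)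
    (hA : ContDiffAt ℝ ∞ A u) :
    ContDiffAt ℝ ∞ (fun w => coef ((star (V w)).compContinuousLinearMap (A w))) u := by
  rw [contDiffAt_euclidean]
  intro lam
  simp only [coef_apply, ContinuousAlternatingMap.compContinuousLinearMap_apply, star_apply,
    Module.Basis.det_apply, Matrix.det_apply']
  refine contDiffAt_const.mul (ContDiffAt.sum fun σ _ => contDiffAt_const.mul
    (contDiffAt_prod fun i _ => ?_))
  have hV' := contDiffAt_euclidean.1 hV
  have hA' : ∀ v i, ContDiffAt ℝ ∞ (fun w => (A w v) i) u := fun v =>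
    contDiffAt_euclidean.1 (hA.clm_apply contDiffAt_const)
  induction i using Fin.cases with
  | zero => exact hV' (σ 0)
  | succ j => exact hA' (ev (lam.succAbove j)) (σ j.succ)

end Forms

end HigherOrderPhase
end

noncomputable section

namespace HigherOrderPhase

open BundleCoords

variable {m N : ℕ} {M Φ : Type*}
  [TopologicalSpace M] [ChartedSpace (EuclideanSpace ℝ (Fin (m + 1))) M]
  [TopologicalSpace Φ] [ChartedSpace (EuclideanSpace ℝ (Fin (m + 1 + N))) Φ]
  {π : Φ → M}

/-! ### The bundle itself has smooth coordinates -/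

section FieldNice

/-- Base and fibre coordinates taken together. -/
def appendCoords (p : Eu (m + 1) × (Fin N → ℝ)) : Eu (m + 1 + N) :=
  WithLp.toLp 2 (Fin.append (fun μ => p.1 μ) p.2)

theorem contDiff_appendCoords :
    ContDiff ℝ ∞ (appendCoords : Eu (m + 1) × (Fin N → ℝ) → Eu (m + 1 + N)) := by
  rw [contDiff_euclidean]
  intro i
  induction i using Fin.addCases with
  | left μ =>
    simp only [appendCoords, Fin.append_left]
    fun_prop
  | right K =>
    simp only [appendCoords, Fin.append_right]
    fun_prop

theorem appendCoords_cc {e : FibredChart m N π} {y : Φ} (hy : y ∈ e.total.source) :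
    appendCoords ((fieldB m N π).cc e y) = e.total y := by
  ext i
  induction i using Fin.addCases with
  | left μ =>
    simp only [appendCoords, Fin.append_left, cc, fieldB]
    exact (e.coord_eq y hy μ).symm
  | right K =>
    simp only [appendCoords, Fin.append_right, cc, fieldB]

theorem cc_total_symm {e : FibredChart m N π} {p : Eu (m + 1) × (Fin N → ℝ)}
    (hp : appendCoords p ∈ e.total.target) :
    (fieldB m N π).cc e (e.total.symm (appendCoords p)) = p := by
  have h := appendCoords_cc (e.total.map_target hp)
  rw [e.total.right_inv hp] at h
  refine Prod.ext ?_ ?_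
  · ext μ
    have := congrArg (fun q : Eu (m + 1 + N) => q (Fin.castAdd N μ)) h
    simpa [appendCoords] using this
  · ext K
    have := congrArg (fun q : Eu (m + 1 + N) => q (Fin.natAdd (m + 1) K)) h
    simpa [appendCoords] using this

theorem fieldB_nice [IsManifold (𝓡 (m + 1 + N)) ∞ Φ]
    (hπ : ∀ y, ∃ e : FibredChart m N π, y ∈ e.total.source) : (fieldB m N π).Nice := by
  refine Nice.of_local_inverse hπ (fun e y hy => e.mapsTo y hy) ?_ ?_
  · intro e y hy y' hy' h
    refine e.total.injOn hy hy' ?_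
    rw [← appendCoords_cc hy, ← appendCoords_cc hy', h]
  · intro e y hy
    have hc := (contDiff_appendCoords (m := m) (N := N)).continuous
    have ht : ∀ᶠ p in 𝓝 ((fieldB m N π).cc e y), appendCoords p ∈ e.total.target := by
      refine hc.continuousAt.eventually (e.total.open_target.mem_nhds ?_)
      rw [appendCoords_cc hy]
      exact e.total.map_source hy
    refine ⟨fun p => e.total.symm (appendCoords p), ?_, ?_⟩
    · filter_upwards [ht] with p hp
      exact ⟨e.total.map_target hp, cc_total_symm hp⟩
    · intro e' he'
      have h1 : ContinuousAt (fun p => e.total.symm (appendCoords p)) ((fieldB m N π).cc e y) :=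
        ContinuousAt.comp (g := e.total.symm) (e.total.continuousAt_symm ht.self_of_nhds)
          hc.continuousAt
      have h2 : ∀ᶠ p in 𝓝 ((fieldB m N π).cc e y),
          e.total.symm (appendCoords p) ∈ e'.total.source :=
        h1.eventually (e'.total.open_source.mem_nhds he')
      refine ⟨h2, ?_⟩
      have h3 : ContDiffAt ℝ ∞ (fun p => e'.total (e.total.symm (appendCoords p)))
          ((fieldB m N π).cc e y) :=
        ContDiffAt.comp (g := fun w => e'.total (e.total.symm w)) _
          (contDiffAt_transition e.total_mem e'.total_mem ht.self_of_nhds he')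
          contDiff_appendCoords.contDiffAt
      have h4 := contDiffAt_euclidean.1 h3
      refine ContDiffAt.prodMk ?_ ?_
      · rw [contDiffAt_euclidean]
        intro μ
        refine (h4 (Fin.castAdd N μ)).congr_of_eventuallyEq ?_
        filter_upwards [h2] with p hp
        exact (e'.coord_eq _ hp μ).symm
      · rw [contDiffAt_pi]
        intro K
        exact h4 (Fin.natAdd (m + 1) K)

end FieldNice

/-! ### Vertical tangent spaces -/

section Vertical

namespace BundleCoords

variable {B : Type*} {ι : Type} [Fintype ι] {X : BundleCoords m N π B ι}

/-- The derivative of the change of fibre coordinates from `e` to `e'`. -/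
def vtrans (X : BundleCoords m N π B ι) (e e' : FibredChart m N π) (b : B) :
    (ι → ℝ) →L[ℝ] ι → ℝ :=
  haveI : Nonempty B := ⟨b⟩
  fderiv ℝ (fun a => X.coord e' (X.inv e (e.base (X.proj b), a))) (X.coord e b)

theorem Nice.hasFDerivAt_vtrans (hX : X.Nice) [Nonempty B] {b : B} {e e' : FibredChart m N π}
    (he : b ∈ X.dom e) (he' : b ∈ X.dom e') :
    HasFDerivAt (fun a => X.coord e' (X.inv e (e.base (X.proj b), a))) (vtrans X e e' b)
      (X.coord e b) := by
  refine DifferentiableAt.hasFDerivAt ?_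
  have h1 : ContDiffAt ℝ ∞ (fun w => X.coord e' (X.inv e w)) (e.base (X.proj b), X.coord e b) :=
    hX.contDiffAt_trans (cc_mem_range he) (by
      change X.inv e (X.cc e b) ∈ X.dom e'
      rwa [hX.inv_cc he])
  have h2 : ContDiffAt ℝ ∞ (fun a => X.coord e' (X.inv e (e.base (X.proj b), a))) (X.coord e b) :=
    ContDiffAt.comp (g := fun w => X.coord e' (X.inv e w)) (X.coord e b) h1
      (contDiffAt_const.prodMk contDiffAt_id)
  exact h2.differentiableAt (by simp)

theorem Nice.vtrans_self (hX : X.Nice) {b : B} {e : FibredChart m N π} (he : b ∈ X.dom e)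
    (w : ι → ℝ) : vtrans X e e b w = w := by
  have : Nonempty B := ⟨b⟩
  have h : (fun a => X.coord e (X.inv e (e.base (X.proj b), a))) =ᶠ[𝓝 (X.coord e b)] id := by
    have hc : ContinuousAt (fun a : ι → ℝ => (e.base (X.proj b), a)) (X.coord e b) := by fun_prop
    filter_upwards [hc.eventually (hX.eventually_range (cc_mem_range he))] with a ha
    exact congrArg Prod.snd (cc_inv ha)
  have h2 := (hX.hasFDerivAt_vtrans he he).congr_of_eventuallyEq h.symm
  rw [h2.unique (hasFDerivAt_id _)]
  rfl

/-- The curve stays in one fibre, so the base coordinates are constant and the chain rule involves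
the fibre transition only. -/
theorem Nice.velocity_trans (hX : X.Nice) {b : B} {v : {e // b ∈ X.dom e} → ι → ℝ}
    (hv : IsVelocity X b v) (e e' : {e // b ∈ X.dom e}) : v e' = vtrans X e.1 e'.1 b (v e) := by
  have : Nonempty B := ⟨b⟩
  obtain ⟨c, hc, h0, hp, hd⟩ := hv
  rw [← hd e, ← hd e']
  have h1 : DifferentiableAt ℝ (fun t => X.coord e.1 (c t)) 0 :=
    (hc.contDiffAt_coord (by rw [h0]; exact e.2)).differentiableAt (by simp)
  have h2 : (fun t => X.coord e'.1 (c t)) =ᶠ[𝓝 0]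
      fun t => X.coord e'.1 (X.inv e.1 (e.1.base (X.proj b), X.coord e.1 (c t))) := by
    filter_upwards [hp, (hc e.1 (by rw [h0]; exact e.2)).1] with t ht htd
    rw [← ht]
    change _ = X.coord e'.1 (X.inv e.1 (X.cc e.1 (c t)))
    rw [hX.inv_cc htd]
  rw [h2.deriv_eq]
  have h3 := hX.hasFDerivAt_vtrans e.2 e'.2
  have h4 : HasFDerivAt (fun a => X.coord e'.1 (X.inv e.1 (e.1.base (X.proj b), a)))
      (vtrans X e.1 e'.1 b) (X.coord e.1 (c 0)) := by rwa [h0]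
  exact (h4.comp_hasDerivAt 0 h1.hasDerivAt).deriv

theorem Nice.vert_trans (hX : X.Nice) {b : B} (v : VertTangent X b) (e e' : {e // b ∈ X.dom e}) :
    v.1 e' = vtrans X e.1 e'.1 b (v.1 e) := by
  obtain ⟨v, hv⟩ := v
  induction hv using Submodule.span_induction with
  | mem v hv => exact hX.velocity_trans hv e e'
  | zero => simp
  | add v w _ _ hv hw =>
    simp only [Pi.add_apply, map_add] at hv hw ⊢
    rw [hv, hw]
  | smul c v _ hv =>
    simp only [Pi.smul_apply, map_smul] at hv ⊢
    rw [hv]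

theorem Nice.vert_ext (hX : X.Nice) {b : B} {v w : VertTangent X b} (e : {e // b ∈ X.dom e})
    (h : v.1 e = w.1 e) : v = w := by
  apply Subtype.ext
  ext e' : 1
  rw [hX.vert_trans v e e', hX.vert_trans w e e', h]

/-- The straight line in the chart `e` has this velocity. Together with `Nice.vert_trans` it
identifies the vertical tangent space with its components in one chart. -/
theorem Nice.isVelocity_vtrans (hX : X.Nice) {b : B} {e : FibredChart m N π} (he : b ∈ X.dom e)
    (w : ι → ℝ) : IsVelocity X b fun e' => vtrans X e e'.1 b w := by
  have : Nonempty B := ⟨b⟩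
  let v : ℝ → Eu (m + 1) × (ι → ℝ) := fun t => (e.base (X.proj b), X.coord e b + t • w)
  have hv0 : v 0 = X.cc e b := by simp [v, cc]
  have hv : ContDiff ℝ ∞ v := by fun_prop
  have hr : v 0 ∈ X.range e := by
    rw [hv0]
    exact cc_mem_range he
  refine ⟨fun t => X.inv e (v t), hX.smoothAt_inv_comp e hr hv.contDiffAt, ?_, ?_, ?_⟩
  · change X.inv e (v 0) = b
    rw [hv0, hX.inv_cc he]
  · filter_upwards [hv.continuous.continuousAt.eventually (hX.eventually_range hr)] with t ht
    rw [hX.proj_inv ht]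
    exact e.base.left_inv (hX.proj_mem e b he)
  · intro e'
    have h1 := hX.hasFDerivAt_vtrans he e'.2
    have h2 : HasDerivAt (fun t : ℝ => X.coord e b + t • w) w 0 := by
      simpa using ((hasDerivAt_id (0 : ℝ)).smul_const w).const_add (X.coord e b)
    have h3 : HasFDerivAt (fun a => X.coord e'.1 (X.inv e (e.base (X.proj b), a)))
        (vtrans X e e'.1 b) (X.coord e b + (0 : ℝ) • w) := by simpa using h1
    exact (h3.comp_hasDerivAt 0 h2).deriv

end BundleCoords

variable {B : Type*} {ι : Type} [Fintype ι] {X : BundleCoords m N π B ι}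

/-- The vertical vector with given components in the chart `e`. -/
def vecOf (hX : X.Nice) {b : B} {e : FibredChart m N π} (he : b ∈ X.dom e) (w : ι → ℝ) :
    VertTangent X b :=
  ⟨fun e' => vtrans X e e'.1 b w, Submodule.subset_span (hX.isVelocity_vtrans he w)⟩

theorem vecOf_self (hX : X.Nice) {b : B} {e : FibredChart m N π} (he : b ∈ X.dom e) (w : ι → ℝ) :
    (vecOf hX he w).1 ⟨e, he⟩ = w :=
  hX.vtrans_self he w

-- `coordVec` is an arbitrary choice; existence comes from `vecOf`, so the choice has the required
-- components.
open Classical in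
theorem coordVec_apply (hX : X.Nice) {b : B} {e : FibredChart m N π} (he : b ∈ X.dom e) (i : ι) :
    (coordVec X e b i).1 ⟨e, he⟩ = Pi.single i 1 := by
  have h : ∃ v : VertTangent X b, ∃ h : b ∈ X.dom e, v.1 ⟨e, h⟩ = Pi.single i 1 :=
    ⟨vecOf hX he (Pi.single i 1), he, vecOf_self hX he _⟩
  exact (Classical.epsilon_spec h).2

theorem vert_eq_sum (hX : X.Nice) {b : B} {e : FibredChart m N π} (he : b ∈ X.dom e)
    (v : VertTangent X b) : v = ∑ i, v.1 ⟨e, he⟩ i • coordVec X e b i := by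
  classical
  refine hX.vert_ext ⟨e, he⟩ ?_
  ext j
  have h1 : (∑ i, v.1 ⟨e, he⟩ i • coordVec X e b i).1 ⟨e, he⟩ =
      ∑ i, v.1 ⟨e, he⟩ i • (coordVec X e b i).1 ⟨e, he⟩ := by
    simp [Finset.sum_apply]
  rw [h1, Finset.sum_apply]
  simp [coordVec_apply hX he, Pi.single_apply]

end Vertical

/-! ### The tangent spaces of the base -/

section BaseTangent

/-- The linear map which takes the coordinate vectors to `∂_μ`. -/
def tD (e : FibredChart m N π) (x : M) : Eu (m + 1) →L[ℝ] TangentSpace (𝓡 (m + 1)) x :=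
  mfderiv 𝓘(ℝ, Eu (m + 1)) (𝓡 (m + 1)) e.base.symm (e.base x)

/-- The inverse of `tD`. -/
def tDinv (e : FibredChart m N π) (x : M) : TangentSpace (𝓡 (m + 1)) x →L[ℝ] Eu (m + 1) :=
  mfderiv (𝓡 (m + 1)) 𝓘(ℝ, Eu (m + 1)) e.base x

variable [IsManifold (𝓡 (m + 1)) ∞ M]

theorem FibredChart.mdifferentiable_base (e : FibredChart m N π) :
    e.base.MDifferentiable (𝓡 (m + 1)) 𝓘(ℝ, Eu (m + 1)) :=
  ⟨(contMDiffOn_of_mem_maximalAtlas e.base_mem).mdifferentiableOn (by simp),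
    (contMDiffOn_symm_of_mem_maximalAtlas e.base_mem).mdifferentiableOn (by simp)⟩

theorem tD_tDinv (e : FibredChart m N π) {x : M} (hx : x ∈ e.base.source)
    (v : TangentSpace (𝓡 (m + 1)) x) : tD e x (tDinv e x v) = v := by
  have := e.mdifferentiable_base.symm_comp_deriv hx
  exact congrArg (fun L : TangentSpace (𝓡 (m + 1)) x →L[ℝ] TangentSpace (𝓡 (m + 1)) x => L v) this

theorem tDinv_tD (e : FibredChart m N π) {x : M} (hx : x ∈ e.base.source) (v : Eu (m + 1)) :
    tDinv e x (tD e x v) = v := by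
  have := e.mdifferentiable_base.comp_symm_deriv (e.base.map_source hx)
  rw [e.base.left_inv hx] at this
  exact congrArg (fun L : Eu (m + 1) →L[ℝ] Eu (m + 1) => L v) this

theorem tD_trans (e e' : FibredChart m N π) {x : M} (hx : x ∈ e.base.source)
    (hx' : x ∈ e'.base.source) (v : Eu (m + 1)) :
    tD e' x v = tD e x (fderiv ℝ (fun w => e.base (e'.base.symm w)) (e'.base x) v) := by
  have hz : e'.base.symm (e'.base x) = x := e'.base.left_inv hx'
  have hψ : DifferentiableAt ℝ (fun w => e.base (e'.base.symm w)) (e'.base x) :=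
    (contDiffAt_transition e'.base_mem e.base_mem (e'.base.map_source hx')
      (by rwa [hz])).differentiableAt (by simp)
  have hd : MDifferentiableAt 𝓘(ℝ, Eu (m + 1)) (𝓡 (m + 1)) e.base.symm
      (e.base (e'.base.symm (e'.base x))) := by
    rw [hz]
    exact e.mdifferentiable_base.mdifferentiableAt_symm (e.base.map_source hx)
  have hev : e'.base.symm =ᶠ[𝓝 (e'.base x)] e.base.symm ∘ fun w => e.base (e'.base.symm w) := by
    have hc := e'.base.continuousAt_symm (e'.base.map_source hx')
    filter_upwards [hc.eventually (e.base.open_source.mem_nhds (by rwa [hz]))] with w hw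
    exact (e.base.left_inv hw).symm
  have h1 := hev.mfderiv_eq (I := 𝓘(ℝ, Eu (m + 1))) (I' := 𝓡 (m + 1))
  have h2 := mfderiv_comp (e'.base x) hd hψ.mdifferentiableAt
  have h3 : ∀ v : Eu (m + 1), mfderiv 𝓘(ℝ, Eu (m + 1)) (𝓡 (m + 1)) e'.base.symm (e'.base x) v =
      mfderiv 𝓘(ℝ, Eu (m + 1)) (𝓡 (m + 1)) e.base.symm (e.base (e'.base.symm (e'.base x)))
        (fderiv ℝ (fun w => e.base (e'.base.symm w)) (e'.base x) v) := by
    intro v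
    rw [← mfderiv_eq_fderiv]
    exact congrArg (fun L : Eu (m + 1) →L[ℝ] Eu (m + 1) => L v) (h1.trans h2)
  refine (h3 v).trans ?_
  -- The point enters the type of the derivative, so the equality of points is generalised before it
  -- is used.
  have h4 : ∀ y, y = x → ∀ u : Eu (m + 1),
      (mfderiv 𝓘(ℝ, Eu (m + 1)) (𝓡 (m + 1)) e.base.symm (e.base y) u : Eu (m + 1)) =
      mfderiv 𝓘(ℝ, Eu (m + 1)) (𝓡 (m + 1)) e.base.symm (e.base x) u := by
    rintro y rfl u
    rfl
  exact h4 _ hz _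

end BaseTangent

end HigherOrderPhase
end

noncomputable section

namespace HigherOrderPhase

open BundleCoords

variable {m N : ℕ} {M Φ : Type*}
  [TopologicalSpace M] [ChartedSpace (EuclideanSpace ℝ (Fin (m + 1))) M]
  [TopologicalSpace Φ] [ChartedSpace (EuclideanSpace ℝ (Fin (m + 1 + N))) Φ]
  {π : Φ → M}

/-! ### The phase bundle of a bundle has smooth coordinates -/

section CovNice

/-- The coordinate expression of a covector of degree `n - 1`. -/
def pull (e : FibredChart m N π) (x : M) (α : (TangentSpace (𝓡 (m + 1)) x) [⋀^Fin m]→L[ℝ] ℝ) :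
    Eu (m + 1) [⋀^Fin m]→L[ℝ] ℝ :=
  α.compContinuousLinearMap (tD e x)

/-- The covector with a given coordinate expression. -/
def push (e : FibredChart m N π) (x : M) (α : Eu (m + 1) [⋀^Fin m]→L[ℝ] ℝ) :
    (TangentSpace (𝓡 (m + 1)) x) [⋀^Fin m]→L[ℝ] ℝ :=
  α.compContinuousLinearMap (tDinv e x)

variable {B : Type*} {ι : Type} [Fintype ι] {X : BundleCoords m N π B ι}

/-- The vector density `p^λ_i w^i`. -/
def contr (P : ι × Fin (m + 1) → ℝ) (w : ι → ℝ) : Eu (m + 1) :=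
  WithLp.toLp 2 fun lam => ∑ i, P (i, lam) * w i

theorem contr_apply (P : ι × Fin (m + 1) → ℝ) (w : ι → ℝ) (lam : Fin (m + 1)) :
    contr P w lam = ∑ i, P (i, lam) * w i := rfl

open Classical in
theorem contr_single (P : ι × Fin (m + 1) → ℝ) (i : ι) (lam : Fin (m + 1)) :
    contr P (Pi.single i 1) lam = P (i, lam) := by
  simp [contr_apply, Pi.single_apply]

theorem contDiff_contr : ContDiff ℝ ∞ fun q : (ι × Fin (m + 1) → ℝ) × (ι → ℝ) => contr q.1 q.2 := by
  rw [contDiff_euclidean]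
  intro lam
  simp only [contr_apply]
  fun_prop

/-- The momenta of a covector. -/
def momC (e : FibredChart m N π) (p : Cov X) (a : ι × Fin (m + 1)) : ℝ :=
  (covB X).coord e p (Sum.inr a)

theorem momC_eq (e : FibredChart m N π) (p : Cov X) (i : ι) (lam : Fin (m + 1)) :
    momC e p (i, lam) = coef (pull e (X.proj p.1) (p.2 (coordVec X e p.1 i))) lam := rfl

/-- The contraction of a momentum with a vertical vector. -/
theorem coef_pull (hX : X.Nice) {e : FibredChart m N π} {p : Cov X} (h : p.1 ∈ X.dom e)
    (v : VertTangent X p.1) :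
    coef (pull e (X.proj p.1) (p.2 v)) = contr (momC e p) (v.1 ⟨e, h⟩) := by
  ext lam
  conv_lhs => rw [vert_eq_sum hX h v]
  rw [contr_apply, map_sum, coef_apply]
  simp only [pull, ContinuousAlternatingMap.compContinuousLinearMap_apply,
    ContinuousAlternatingMap.sum_apply, map_smul, ContinuousAlternatingMap.smul_apply, smul_eq_mul,
    Finset.mul_sum]
  refine Finset.sum_congr rfl fun i _ => ?_
  rw [momC_eq, coef_apply]
  simp only [pull, ContinuousAlternatingMap.compContinuousLinearMap_apply]
  ring

/-- The covector with given momenta. -/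
def covOf {e : FibredChart m N π} {b : B} (h : b ∈ X.dom e) (P : ι × Fin (m + 1) → ℝ) : Cov X :=
  ⟨b,
    { toFun := fun v => push e (X.proj b) (star (contr P (v.1 ⟨e, h⟩)))
      map_add' := fun v w => by
        have : contr P ((v + w).1 ⟨e, h⟩) = contr P (v.1 ⟨e, h⟩) + contr P (w.1 ⟨e, h⟩) := by
          ext lam
          simp [contr_apply, mul_add, Finset.sum_add_distrib]
        rw [this, map_add]
        rfl
      map_smul' := fun c v => by
        have : contr P ((c • v).1 ⟨e, h⟩) = c • contr P (v.1 ⟨e, h⟩) := by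
          ext lam
          simp [contr_apply, mul_left_comm, Finset.mul_sum]
        rw [this, map_smul]
        rfl }⟩

variable [IsManifold (𝓡 (m + 1)) ∞ M]

theorem pull_push (e : FibredChart m N π) {x : M} (hx : x ∈ e.base.source)
    (α : Eu (m + 1) [⋀^Fin m]→L[ℝ] ℝ) : pull e x (push e x α) = α := by
  ext v
  simp only [pull, push, ContinuousAlternatingMap.compContinuousLinearMap_apply]
  congr 1
  ext j : 1
  exact tDinv_tD e hx (v j)

theorem pull_injective (e : FibredChart m N π) {x : M} (hx : x ∈ e.base.source) :
    Function.Injective (pull e x) := by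
  intro α β h
  ext v
  have := congrArg (fun γ : Eu (m + 1) [⋀^Fin m]→L[ℝ] ℝ => γ fun j => tDinv e x (v j)) h
  simp only [pull, ContinuousAlternatingMap.compContinuousLinearMap_apply] at this
  have h2 : (fun j => tD e x (tDinv e x (v j))) = v := funext fun j => tD_tDinv e hx (v j)
  have h3 : ((tD e x : Eu (m + 1) → TangentSpace (𝓡 (m + 1)) x) ∘ fun j => tDinv e x (v j)) = v :=
    h2
  rwa [h3] at this

/-- The change of coordinates of an `(n - 1)`-covector. -/
theorem pull_trans (e e' : FibredChart m N π) {x : M} (hx : x ∈ e.base.source)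
    (hx' : x ∈ e'.base.source) (α : (TangentSpace (𝓡 (m + 1)) x) [⋀^Fin m]→L[ℝ] ℝ) :
    pull e' x α = (pull e x α).compContinuousLinearMap
      (fderiv ℝ (fun w => e.base (e'.base.symm w)) (e'.base x)) := by
  ext v
  simp only [pull, ContinuousAlternatingMap.compContinuousLinearMap_apply]
  congr 1
  ext j : 1
  exact tD_trans e e' hx hx' (v j)

/-- The change of coordinates of the contraction of a momentum with a vertical vector. -/
theorem contr_trans (hX : X.Nice) {e e' : FibredChart m N π} {p : Cov X} (h : p.1 ∈ X.dom e)
    (h' : p.1 ∈ X.dom e') (v : VertTangent X p.1) :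
    contr (momC e' p) (v.1 ⟨e', h'⟩) =
      coef ((star (contr (momC e p) (v.1 ⟨e, h⟩))).compContinuousLinearMap
        (fderiv ℝ (fun w => e.base (e'.base.symm w)) (e'.base (X.proj p.1)))) := by
  rw [← coef_pull hX h', ← coef_pull hX h, star_coef,
    pull_trans e e' (hX.proj_mem e _ h) (hX.proj_mem e' _ h')]

theorem momC_covOf (hX : X.Nice) {e : FibredChart m N π} {b : B} (h : b ∈ X.dom e)
    (P : ι × Fin (m + 1) → ℝ) : momC e (covOf h P) = P := by
  classical
  ext ⟨i, lam⟩
  rw [momC_eq]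
  change coef (pull e (X.proj b) (push e (X.proj b)
    (star (contr P ((coordVec X e b i).1 ⟨e, h⟩))))) lam = _
  rw [pull_push e (hX.proj_mem e b h), coef_star, coordVec_apply hX h]
  exact contr_single P i lam

theorem covB_injOn (hX : X.Nice) (e : FibredChart m N π) :
    InjOn ((covB X).cc e) ((covB X).dom e) := by
  rintro ⟨b, p⟩ hb ⟨b', p'⟩ hb' h
  have hb1 : b ∈ X.dom e := hb
  have h1 : b = b' := by
    have h0 := congrArg Prod.fst h
    refine hX.injOn e hb hb' (Prod.ext h0 ?_)
    ext i
    exact congrFun (congrArg Prod.snd h) (Sum.inl i)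
  subst h1
  congr 1
  ext1 v
  refine pull_injective e (hX.proj_mem e b hb) (form_ext ?_)
  have h2 : momC (X := X) e ⟨b, p⟩ = momC e ⟨b, p'⟩ := by
    ext a
    exact congrFun (congrArg Prod.snd h) (Sum.inr a)
  refine (coef_pull hX (p := ⟨b, p⟩) hb1 v).trans ?_
  rw [h2]
  exact (coef_pull hX (p := ⟨b, p'⟩) hb1 v).symm

open Classical in
/-- The covector with given coordinates. -/
def covInv [Nonempty B] (e : FibredChart m N π) (p₀ : Cov X)
    (w : Eu (m + 1) × (ι ⊕ ι × Fin (m + 1) → ℝ)) : Cov X :=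
  if h : (w.1, w.2 ∘ Sum.inl) ∈ X.range e then covOf (inv_mem h) (w.2 ∘ Sum.inr) else p₀

/-- The fibre derivative of a transition is smooth jointly in its parameters, in particular along
the moving point `inv e w`. -/
theorem contDiffAt_vtrans [Nonempty B] (hX : X.Nice) {e e' : FibredChart m N π}
    {z : Eu (m + 1) × (ι → ℝ)} (hz : z ∈ X.range e) (h' : X.inv e z ∈ X.dom e') :
    ContDiffAt ℝ ∞ (fun w => vtrans X e' e (X.inv e w)) z := by
  have hs := hX.smooth e z hz
  have h1 := hs.contDiffAt_cc h'
  have h2 : ContDiffAt ℝ ∞ (fun w => X.coord e (X.inv e' w)) (X.cc e' (X.inv e z)) :=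
    hX.contDiffAt_trans (cc_mem_range h') (by
      rw [hX.inv_cc h']
      exact inv_mem hz)
  have h3 : ContDiffAt ℝ ∞ (Function.uncurry fun (w : Eu (m + 1) × (ι → ℝ)) (a : ι → ℝ) =>
      X.coord e (X.inv e' (e'.base (X.proj (X.inv e w)), a))) (z, X.coord e' (X.inv e z)) := by
    have h4 : ContDiffAt ℝ ∞ (fun q : (Eu (m + 1) × (ι → ℝ)) × (ι → ℝ) =>
        (e'.base (X.proj (X.inv e q.1)), q.2)) (z, X.coord e' (X.inv e z)) :=
      ((contDiffAt_fst.comp z h1).comp (z, X.coord e' (X.inv e z)) contDiffAt_fst).prodMk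
        contDiffAt_snd
    exact ContDiffAt.comp (g := fun w => X.coord e (X.inv e' w)) _ h2 h4
  exact ContDiffAt.fderiv (f := fun (w : Eu (m + 1) × (ι → ℝ)) (a : ι → ℝ) =>
      X.coord e (X.inv e' (e'.base (X.proj (X.inv e w)), a)))
    (g := fun w => X.coord e' (X.inv e w)) h3 (contDiffAt_snd.comp z h1) (by simp)

/-- The new momenta arise from the old ones by contraction with a transformed coordinate vector
followed by pullback along the base transition; both depend smoothly on the coordinates. -/
theorem covB_nice (hX : X.Nice) : (covB X).Nice := by
  classical
  refine Nice.of_local_inverse (fun p => hX.cover p.1) (fun e p hp => hX.proj_mem e p.1 hp)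
    (covB_injOn hX) ?_
  intro e p hp
  have : Nonempty B := ⟨p.1⟩
  have hr0 : (((covB X).cc e p).1, ((covB X).cc e p).2 ∘ Sum.inl) ∈ X.range e := cc_mem_range hp
  have hc : ContDiff ℝ ∞ fun w : Eu (m + 1) × (ι ⊕ ι × Fin (m + 1) → ℝ) =>
      (w.1, w.2 ∘ Sum.inl) := by
    refine contDiff_fst.prodMk ?_
    rw [contDiff_pi]
    intro i
    exact (contDiff_apply ℝ ℝ (Sum.inl i)).comp contDiff_snd
  have hr : ∀ᶠ w in 𝓝 ((covB X).cc e p), (w.1, w.2 ∘ Sum.inl) ∈ X.range e :=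
    hc.continuous.continuousAt.eventually (hX.eventually_range hr0)
  have hval : ∀ w : Eu (m + 1) × (ι ⊕ ι × Fin (m + 1) → ℝ),
      ∀ h : (w.1, w.2 ∘ Sum.inl) ∈ X.range e,
      covInv e p w = covOf (inv_mem h) (w.2 ∘ Sum.inr) := fun w h => dif_pos h
  refine ⟨covInv e p, ?_, ?_⟩
  · filter_upwards [hr] with w hw
    rw [hval w hw]
    refine ⟨inv_mem hw, ?_⟩
    have h1 := cc_inv hw
    have h0 := congrArg Prod.fst h1
    refine Prod.ext h0 ?_
    ext a
    rcases a with i | a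
    · exact congrFun (congrArg Prod.snd h1) i
    · exact congrFun (momC_covOf hX (inv_mem hw) (w.2 ∘ Sum.inr)) a
  · intro e' he'
    have hp0 : X.inv e (((covB X).cc e p).1, ((covB X).cc e p).2 ∘ Sum.inl) ∈ X.dom e' := by
      rw [hval _ hr0] at he'
      exact he'
    have hs : X.SmoothAt (fun w : Eu (m + 1) × (ι ⊕ ι × Fin (m + 1) → ℝ) =>
        X.inv e (w.1, w.2 ∘ Sum.inl)) ((covB X).cc e p) :=
      hX.smoothAt_inv_comp e hr0 hc.contDiffAt
    obtain ⟨hd, hsm⟩ := hs e' hp0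
    have hd' : ∀ᶠ w in 𝓝 ((covB X).cc e p), covInv e p w ∈ (covB X).dom e' := by
      filter_upwards [hr, hd] with w hw hwd
      rw [hval w hw]
      exact hwd
    refine ⟨hd', ?_⟩
    have h1 : ContDiffAt ℝ ∞ (fun w : Eu (m + 1) × (ι ⊕ ι × Fin (m + 1) → ℝ) =>
        vtrans X e' e (X.inv e (w.1, w.2 ∘ Sum.inl))) ((covB X).cc e p) :=
      ContDiffAt.comp (g := fun w => vtrans X e' e (X.inv e w)) _
        (contDiffAt_vtrans hX hr0 hp0) hc.contDiffAt
    have hmem : ((covB X).cc e p).1 ∈ e.base.target := hX.mem_target hr0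
    have hmem' : e.base.symm ((covB X).cc e p).1 ∈ e'.base.source := by
      have := hX.proj_mem e' _ hp0
      rwa [hX.proj_inv hr0] at this
    have h2 : ContDiffAt ℝ ∞ (fun w => e'.base (e.base.symm w)) ((covB X).cc e p).1 :=
      e.contDiffAt_base e' hmem hmem'
    have h3 : ContDiffAt ℝ ∞ (fun w => e.base (e'.base.symm w))
        (e'.base (e.base.symm ((covB X).cc e p).1)) :=
      e'.contDiffAt_base e (e'.base.map_source hmem') (by
        rw [e'.base.left_inv hmem']
        exact e.base.map_target hmem)
    have h4 : ContDiffAt ℝ ∞ (fun w : Eu (m + 1) × (ι ⊕ ι × Fin (m + 1) → ℝ) =>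
        fderiv ℝ (fun w => e.base (e'.base.symm w)) (e'.base (e.base.symm w.1)))
        ((covB X).cc e p) :=
      ContDiffAt.comp (g := fun w => fderiv ℝ (fun w => e.base (e'.base.symm w)) w) _
        (h3.fderiv_right (m := ∞) (by simp))
        (ContDiffAt.comp (g := fun w => e'.base (e.base.symm w)) _ h2 contDiffAt_fst)
    -- The right-hand side of `contr_trans` for the `i`-th coordinate vector of `e'`; further below
    -- it is identified with the momentum in the chart `e'`.
    have h5 : ∀ i lam, ContDiffAt ℝ ∞ (fun w : Eu (m + 1) × (ι ⊕ ι × Fin (m + 1) → ℝ) =>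
        coef ((star (contr (w.2 ∘ Sum.inr) (vtrans X e' e (X.inv e (w.1, w.2 ∘ Sum.inl))
          (Pi.single i 1)))).compContinuousLinearMap
          (fderiv ℝ (fun w => e.base (e'.base.symm w)) (e'.base (e.base.symm w.1)))) lam)
        ((covB X).cc e p) := by
      intro i lam
      refine contDiffAt_euclidean.1 (contDiffAt_coef_pullback ?_ h4) lam
      refine ContDiffAt.comp (g := fun q : (ι × Fin (m + 1) → ℝ) × (ι → ℝ) => contr q.1 q.2) _
        contDiff_contr.contDiffAt (ContDiffAt.prodMk
          (f := fun w : Eu (m + 1) × (ι ⊕ ι × Fin (m + 1) → ℝ) => w.2 ∘ Sum.inr) ?_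
              (h1.clm_apply contDiffAt_const))
      rw [contDiffAt_pi]
      intro a
      exact (contDiff_apply ℝ ℝ (Sum.inr a)).contDiffAt.comp _ contDiffAt_snd
    refine ContDiffAt.prodMk ?_ ?_
    · refine (contDiffAt_fst.comp _ hsm).congr_of_eventuallyEq ?_
      filter_upwards [hr] with w hw
      rw [hval w hw]
      rfl
    · rw [contDiffAt_pi]
      rintro (i | ⟨i, lam⟩)
      · refine (contDiffAt_pi.1 (contDiffAt_snd.comp _ hsm) i).congr_of_eventuallyEq ?_
        filter_upwards [hr] with w hw
        rw [hval w hw]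
        rfl
      · refine (h5 i lam).congr_of_eventuallyEq ?_
        filter_upwards [hr, hd] with w hw hwd
        rw [hval w hw]
        have hwe : (covOf (inv_mem hw) (w.2 ∘ Sum.inr)).1 ∈ X.dom e := inv_mem hw
        have hwd' : (covOf (inv_mem hw) (w.2 ∘ Sum.inr)).1 ∈ X.dom e' := hwd
        have hk := contr_trans hX (p := covOf (inv_mem hw) (w.2 ∘ Sum.inr)) hwe hwd'
          (coordVec X e' _ i)
        rw [momC_covOf hX] at hk
        have hk2 := congrArg (fun V : Eu (m + 1) => V lam) hk
        rw [hX.vert_trans (coordVec X e' (covOf (inv_mem hw) (w.2 ∘ Sum.inr)).1 i) ⟨e', hwd'⟩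
          ⟨e, hwe⟩, coordVec_apply hX hwd'] at hk2
        have hk3 : X.proj (covOf (inv_mem hw) (w.2 ∘ Sum.inr)).1 = e.base.symm w.1 :=
          hX.proj_inv hw
        rw [hk3] at hk2
        have hk4 := contr_single (momC e' (covOf (inv_mem hw) (w.2 ∘ Sum.inr))) i lam
        exact hk4.symm.trans hk2

theorem covB_range (hX : X.Nice) (e : FibredChart m N π)
    (w : Eu (m + 1) × (ι ⊕ ι × Fin (m + 1) → ℝ)) :
    w ∈ (covB X).range e ↔ (w.1, w.2 ∘ Sum.inl) ∈ X.range e := by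
  constructor
  · rintro ⟨p, hp, rfl⟩
    exact cc_mem_range (b := p.1) hp
  · rintro ⟨b, hb, h⟩
    have h0 := congrArg Prod.fst h
    refine ⟨covOf hb (w.2 ∘ Sum.inr), hb, Prod.ext h0 ?_⟩
    ext a
    rcases a with i | a
    · exact congrFun (congrArg Prod.snd h) i
    · exact congrFun (momC_covOf hX hb (w.2 ∘ Sum.inr)) a

end CovNice

end HigherOrderPhase
end

noncomputable section

namespace HigherOrderPhase

open BundleCoords

/-! ### Variations of jets -/

section DerivParam

variable {E F : Type} [NormedAddCommGroup E] [NormedSpace ℝ E] [NormedAddCommGroup F]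
  [NormedSpace ℝ F]

/-- Both sides are the mixed second derivative of the uncurried function, in the directions `(1, 0)`
and `(0, v)`. -/
theorem deriv_fderiv_comm {G : ℝ → E → F} {t : ℝ} {z : E}
    (hG : ContDiffAt ℝ 2 (Function.uncurry G) (t, z)) :
    deriv (fun t => fderiv ℝ (G t) z) t = fderiv ℝ (fun w => deriv (fun t => G t w) t) z := by
  have hev : ∀ᶠ p in 𝓝 (t, z), ContDiffAt ℝ 2 (Function.uncurry G) p := hG.eventually (by simp)
  have hd : ∀ᶠ p in 𝓝 (t, z), DifferentiableAt ℝ (Function.uncurry G) p :=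
    hev.mono fun p hp => hp.differentiableAt (by simp)
  have hD : DifferentiableAt ℝ (fderiv ℝ (Function.uncurry G)) (t, z) :=
    (hG.fderiv_right (m := 1) (by norm_num)).differentiableAt (by simp)
  have h1 : (fun s => fderiv ℝ (G s) z) =ᶠ[𝓝 t]
      fun s => (fderiv ℝ (Function.uncurry G) (s, z)).comp (ContinuousLinearMap.inr ℝ ℝ E) := by
    have hc : ContinuousAt (fun s : ℝ => (s, z)) t := by fun_prop
    filter_upwards [hc.eventually hd] with s hs
    have h2 : HasFDerivAt (fun w : E => (s, w)) (ContinuousLinearMap.inr ℝ ℝ E) z :=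
      hasFDerivAt_prodMk_right s z
    exact (HasFDerivAt.comp (g := Function.uncurry G) z hs.hasFDerivAt h2).fderiv
  have h3 : (fun w => deriv (fun s => G s w) t) =ᶠ[𝓝 z]
      fun w => fderiv ℝ (Function.uncurry G) (t, w) (1, 0) := by
    have hc : ContinuousAt (fun w : E => (t, w)) z := by fun_prop
    filter_upwards [hc.eventually hd] with w hw
    have h2 : HasDerivAt (fun s : ℝ => (s, w)) (1, 0) t :=
      (hasDerivAt_id t).prodMk (hasDerivAt_const t w)
    exact (HasFDerivAt.comp_hasDerivAt (l := Function.uncurry G) t hw.hasFDerivAt h2).deriv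
  rw [h1.deriv_eq, h3.fderiv_eq]
  have h4 : HasDerivAt (fun s => fderiv ℝ (Function.uncurry G) (s, z))
      (fderiv ℝ (fderiv ℝ (Function.uncurry G)) (t, z) (1, 0)) t :=
    HasFDerivAt.comp_hasDerivAt (l := fderiv ℝ (Function.uncurry G)) t hD.hasFDerivAt
      ((hasDerivAt_id t).prodMk (hasDerivAt_const t z))
  have h5 : HasFDerivAt (fun w => fderiv ℝ (Function.uncurry G) (t, w))
      ((fderiv ℝ (fderiv ℝ (Function.uncurry G)) (t, z)).comp (ContinuousLinearMap.inr ℝ ℝ E)) z :=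
    HasFDerivAt.comp (g := fderiv ℝ (Function.uncurry G)) z hD.hasFDerivAt
      (hasFDerivAt_prodMk_right t z)
  have hs : IsSymmSndFDerivAt ℝ (Function.uncurry G) (t, z) :=
    hG.isSymmSndFDerivAt (by simp)
  ext v
  rw [(h4.clm_comp (hasDerivAt_const t (ContinuousLinearMap.inr ℝ ℝ E))).deriv,
    (h5.clm_apply (hasFDerivAt_const ((1 : ℝ), (0 : E)) z)).fderiv]
  simpa using hs.eq (1, 0) (0, v)

theorem differentiableAt_multilinear_apply {l : ℕ}
    {q : ℝ → ContinuousMultilinearMap ℝ (fun _ : Fin l => E) F} {t : ℝ}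
    (hq : DifferentiableAt ℝ q t) (v : Fin l → E) : DifferentiableAt ℝ (fun s => q s v) t :=
  DifferentiableAt.comp (g := fun q : ContinuousMultilinearMap ℝ (fun _ : Fin l => E) F => q v) t
    (ContinuousMultilinearMap.apply ℝ (fun _ : Fin l => E) F v).differentiableAt hq

/-- The target space is quantified inside the induction because the inductive step replaces the
family by its first derivative, with values in linear maps. -/
theorem deriv_iteratedFDeriv_comm (l : ℕ) : ∀ {F : Type} [NormedAddCommGroup F] [NormedSpace ℝ F]
    {G : ℝ → E → F} {t : ℝ} {z : E}, ContDiffAt ℝ ∞ (Function.uncurry G) (t, z) →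
    ∀ v : Fin l → E, deriv (fun s => iteratedFDeriv ℝ l (G s) z v) t =
      iteratedFDeriv ℝ l (fun w => deriv (fun s => G s w) t) z v := by
  induction l with
  | zero =>
    intro F _ _ G t z _ v
    simp
  | succ l ih =>
    intro F _ _ G t z hG v
    have hG' : ContDiffAt ℝ ∞ (Function.uncurry fun s w => fderiv ℝ (G s) w) (t, z) := by
      refine ContDiffAt.fderiv (f := fun (p : ℝ × E) w => G p.1 w) (g := fun p : ℝ × E => p.2)
        (n := ∞) ?_ contDiffAt_snd (by simp)
      exact ContDiffAt.comp (g := Function.uncurry G) ((t, z), z) hG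
        ((contDiffAt_fst.comp _ contDiffAt_fst).prodMk contDiffAt_snd)
    have h1 : ContDiffAt ℝ ∞ (fun s => iteratedFDeriv ℝ l (fderiv ℝ (G s)) z) t :=
      (contDiffAt_iteratedFDeriv_param hG' l).comp t (contDiffAt_id.prodMk contDiffAt_const)
    have h2 : DifferentiableAt ℝ (fun s => iteratedFDeriv ℝ l (fderiv ℝ (G s)) z (Fin.init v)) t :=
      differentiableAt_multilinear_apply (h1.differentiableAt (by simp)) _
    have h3 := ih hG' (Fin.init v)
    have h4 : (fun w => deriv (fun s => fderiv ℝ (G s) w) t) =ᶠ[𝓝 z]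
        fderiv ℝ (fun w => deriv (fun s => G s w) t) := by
      have hev : ∀ᶠ p in 𝓝 (t, z), ContDiffAt ℝ 2 (Function.uncurry G) p :=
        (hG.of_le (natCast_le_infty 2)).eventually (by simp)
      have hc : ContinuousAt (fun w : E => (t, w)) z := by fun_prop
      filter_upwards [hc.eventually hev] with w hw
      exact deriv_fderiv_comm hw
    simp_rw [iteratedFDeriv_succ_apply_right]
    have h5 : HasDerivAt (fun s => iteratedFDeriv ℝ l (fderiv ℝ (G s)) z (Fin.init v)
        (v (Fin.last l))) _ t := h2.hasDerivAt.clm_apply (hasDerivAt_const t (v (Fin.last l)))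
    refine h5.deriv.trans ?_
    rw [map_zero, add_zero, ← (EventuallyEq.iteratedFDeriv ℝ h4 l).eq_of_nhds]
    exact congrArg (fun L : E →L[ℝ] F => L (v (Fin.last l))) h3

theorem deriv_jc {n k : ℕ} {ι : Type} [Fintype ι] {G : ℝ → Eu n → ι → ℝ} {t : ℝ} {z : Eu n}
    (hG : ContDiffAt ℝ ∞ (Function.uncurry G) (t, z)) :
    HasDerivAt (fun s => jc k (G s) z) (jc k (fun w => deriv (fun s => G s w) t) z) t := by
  refine hasDerivAt_pi.2 fun a => ?_
  have h3 : ContDiffAt ℝ ∞ (fun s => iteratedFDeriv ℝ (a.2.1 : ℕ) (G s) z) t :=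
    (contDiffAt_iteratedFDeriv_param hG a.2.1).comp t (contDiffAt_id.prodMk contDiffAt_const)
  have h4 := (differentiableAt_multilinear_apply (h3.differentiableAt (by simp))
    fun j => ev (a.2.2.1 j)).hasDerivAt
  rw [deriv_iteratedFDeriv_comm a.2.1 hG] at h4
  exact hasDerivAt_pi.1 h4 a.1

end DerivParam

end HigherOrderPhase
end

noncomputable section

namespace HigherOrderPhase

open BundleCoords

variable {m N : ℕ} {M Φ : Type*}
  [TopologicalSpace M] [ChartedSpace (EuclideanSpace ℝ (Fin (m + 1))) M]
  [TopologicalSpace Φ] [ChartedSpace (EuclideanSpace ℝ (Fin (m + 1 + N))) Φ]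
  {π : Φ → M}

/-! ### Variations of sections and of their jets -/

section Variation

variable {B : Type*} {ι : Type} [Fintype ι] {X : BundleCoords m N π B ι}

/-- The change of coordinates of a vertical vector field along a section. -/
def varTrans (X : BundleCoords m N π B ι) (e e' : FibredChart m N π) (s : M → B)
    (η : Eu (m + 1) → ι → ℝ) (w : Eu (m + 1)) : ι → ℝ :=
  vtrans X e e' (s (e'.base.symm w)) (η (e.base (e'.base.symm w)))

variable [IsManifold (𝓡 (m + 1)) ∞ M]

theorem contDiffAt_varTrans (hX : X.Nice) {s : M → B} {x : M} (hs : X.IsSection s x)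
    {e e' : FibredChart m N π} (he : s x ∈ X.dom e) (he' : s x ∈ X.dom e')
    {η : Eu (m + 1) → ι → ℝ} (hη : ContDiffAt ℝ ∞ η (e.base x)) :
    ContDiffAt ℝ ∞ (varTrans X e e' s η) (e'.base x) := by
  have : Nonempty B := ⟨s x⟩
  have hx := hX.base_mem hs he
  have hx' := hX.base_mem hs he'
  have hcc := hX.cc_section hs he'
  have hz : e'.base.symm (e'.base x) = x := e'.base.left_inv hx'
  have h0 : X.cc e' (s x) = (e'.base x, X.rep e' s (e'.base x)) := by
    have := hcc.self_of_nhds.2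
    rwa [hz] at this
  have hr : (e'.base x, X.rep e' s (e'.base x)) ∈ X.range e' := h0 ▸ cc_mem_range he'
  have h1 : ContDiffAt ℝ ∞ (fun w => vtrans X e e' (X.inv e' w))
      (e'.base x, X.rep e' s (e'.base x)) :=
    contDiffAt_vtrans hX hr (by rwa [← h0, hX.inv_cc he'])
  have h2 : ContDiffAt ℝ ∞ (fun w => vtrans X e e' (X.inv e' (w, X.rep e' s w))) (e'.base x) :=
    ContDiffAt.comp (g := fun w => vtrans X e e' (X.inv e' w)) (e'.base x) h1
      (contDiffAt_id.prodMk (hX.contDiffAt_rep hs he').self_of_nhds)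
  have h3 : ContDiffAt ℝ ∞ (fun w => η (e.base (e'.base.symm w))) (e'.base x) := by
    refine ContDiffAt.comp (g := η) (e'.base x) (by rwa [hz])
      (e'.contDiffAt_base e (e'.base.map_source hx') (by rwa [hz]))
  refine (h2.clm_apply h3).congr_of_eventuallyEq ?_
  filter_upwards [hcc] with w hw
  rw [← hw.2, hX.inv_cc hw.1]
  rfl

/-- The variation of a jet is the jet of the variation. -/
theorem vtrans_jc (hX : X.Nice) {k : ℕ} {s : M → B} {x : M} (hs : X.IsSection s x)
    {e e' : FibredChart m N π} (he : s x ∈ X.dom e) (he' : s x ∈ X.dom e')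
    {η : Eu (m + 1) → ι → ℝ} (hη : ∀ᶠ w in 𝓝 (e.base x), ContDiffAt ℝ ∞ η w) :
    vtrans (jetB X k) e e' (Jet.mk k s hs) (jc k η (e.base x)) =
      jc k (varTrans X e e' s η) (e'.base x) := by
  have : Nonempty B := ⟨s x⟩
  have : Nonempty (Jet X k) := ⟨Jet.mk k s hs⟩
  have hx := hX.base_mem hs he
  have hx' := hX.base_mem hs he'
  have hz : e.base.symm (e.base x) = x := e.base.left_inv hx
  have hz' : e'.base.symm (e'.base x) = x := e'.base.left_inv hx'
  have hf := hX.contDiffAt_rep hs he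
  have hrep : (e.base x, X.rep e s (e.base x)) = X.cc e (s x) := by
    have := (hX.cc_section hs he).self_of_nhds.2
    rw [hz] at this
    exact this.symm
  have hr0 : (e.base x, X.rep e s (e.base x)) ∈ X.range e := hrep ▸ cc_mem_range he
  -- The deformation `f + t η` of the section in the chart `e`, as seen in the chart `e'`.
  let G : ℝ → Eu (m + 1) → ι → ℝ := fun t w => X.coord e' (X.inv e
    (e.base (e'.base.symm w), X.rep e s (e.base (e'.base.symm w)) +
      t • η (e.base (e'.base.symm w))))
  have hψ : ContDiffAt ℝ ∞ (fun w => e.base (e'.base.symm w)) (e'.base x) :=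
    e'.contDiffAt_base e (e'.base.map_source hx') (by rwa [hz'])
  have hG : ContDiffAt ℝ ∞ (Function.uncurry G) (0, e'.base x) := by
    have h1 : ContDiffAt ℝ ∞ (fun p : ℝ × Eu (m + 1) => (e.base (e'.base.symm p.2),
        X.rep e s (e.base (e'.base.symm p.2)) + p.1 • η (e.base (e'.base.symm p.2))))
        (0, e'.base x) := by
      have h2 : ContDiffAt ℝ ∞ (fun p : ℝ × Eu (m + 1) => e.base (e'.base.symm p.2))
          (0, e'.base x) := 
        ContDiffAt.comp (g := fun w => e.base (e'.base.symm w)) (0, e'.base x) hψ contDiffAt_snd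
      refine h2.prodMk (ContDiffAt.add ?_ (contDiffAt_fst.smul ?_))
      · exact ContDiffAt.comp (g := X.rep e s) (0, e'.base x) (by
          rw [hz']
          exact hf.self_of_nhds) h2
      · exact ContDiffAt.comp (g := η) (0, e'.base x) (by
          rw [hz']
          exact hη.self_of_nhds) h2
    refine ContDiffAt.comp (g := fun w => X.coord e' (X.inv e w)) (0, e'.base x) ?_ h1
    simp only [hz', zero_smul, add_zero]
    exact hX.contDiffAt_trans hr0 (by rwa [hrep, hX.inv_cc he])
  have hd : (fun w => deriv (fun t => G t w) 0) =ᶠ[𝓝 (e'.base x)] varTrans X e e' s η := by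
    have h1 : ∀ᶠ y in 𝓝 x, y ∈ e.base.source ∧ X.proj (s y) = y ∧ s y ∈ X.dom e ∧
        s y ∈ X.dom e' := by
      filter_upwards [e.base.open_source.mem_nhds hx, hs.1, IsSection.eventually_dom hs he,
        IsSection.eventually_dom hs he'] with y h1 h2 h3 h4
      exact ⟨h1, h2, h3, h4⟩
    filter_upwards [e'.eventually_base_symm (e'.base.map_source hx')
      (p := fun y => y ∈ e.base.source ∧ X.proj (s y) = y ∧ s y ∈ X.dom e ∧
        s y ∈ X.dom e') (by rwa [hz'])] with w hw
    obtain ⟨hw1, hw2, hw3, hw4⟩ := hw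
    have h2 := hX.hasFDerivAt_vtrans hw3 hw4
    rw [hw2] at h2
    have h3 : HasDerivAt (fun t : ℝ => X.coord e (s (e'.base.symm w)) +
        t • η (e.base (e'.base.symm w))) (η (e.base (e'.base.symm w))) 0 := by
      simpa using ((hasDerivAt_id (0 : ℝ)).smul_const
        (η (e.base (e'.base.symm w)))).const_add (X.coord e (s (e'.base.symm w)))
    have h4 : HasFDerivAt (fun a => X.coord e' (X.inv e (e.base (e'.base.symm w), a)))
        (vtrans X e e' (s (e'.base.symm w)))
        (X.coord e (s (e'.base.symm w)) + (0 : ℝ) • η (e.base (e'.base.symm w))) := by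
      simpa using h2
    have h5 := (h4.comp_hasDerivAt 0 h3).deriv
    have h6 : X.rep e s (e.base (e'.base.symm w)) = X.coord e (s (e'.base.symm w)) := by
      simp only [rep]
      rw [e.base.left_inv hw1]
    simp only [G, h6]
    exact h5
  have hQ := jetB_nice hX k
  have hc0 : (jetB X k).coord e (Jet.mk k s hs) = jc k (X.rep e s) (e.base x) := jetB_coord_mk hs he
  have h1 := hQ.hasFDerivAt_vtrans (b := Jet.mk k s hs) he he'
  have h2 : HasDerivAt (fun t : ℝ => jc k (X.rep e s) (e.base x) + t • jc k η (e.base x))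
      (jc k η (e.base x)) 0 := by
    simpa using ((hasDerivAt_id (0 : ℝ)).smul_const
      (jc k η (e.base x))).const_add (jc k (X.rep e s) (e.base x))
  have h3 : HasFDerivAt (fun a => (jetB X k).coord e' ((jetB X k).inv e (e.base x, a)))
      (vtrans (jetB X k) e e' (Jet.mk k s hs))
      (jc k (X.rep e s) (e.base x) + (0 : ℝ) • jc k η (e.base x)) := by
    rw [zero_smul, add_zero, ← hc0]
    exact h1
  have h4 := h3.comp_hasDerivAt 0 h2
  have hc : ContDiff ℝ ∞ fun t : ℝ =>
      (e.base x, X.rep e s (e.base x) + t • η (e.base x)) := by fun_prop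
  have hr : (fun t : ℝ => (e.base x, X.rep e s (e.base x) + t • η (e.base x))) 0 ∈ X.range e := by
    simpa using hr0
  have h5 : ∀ᶠ t : ℝ in 𝓝 0, (e.base x, X.rep e s (e.base x) + t • η (e.base x)) ∈ X.range e :=
    hc.continuous.continuousAt.eventually (hX.eventually_range hr)
  have h6 : ∀ᶠ t : ℝ in 𝓝 0, X.inv e (e.base x, X.rep e s (e.base x) + t • η (e.base x)) ∈
      X.dom e' :=
    (hX.smoothAt_inv_comp (v := fun t : ℝ => (e.base x, X.rep e s (e.base x) + t • η (e.base x)))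
      e hr hc.contDiffAt e' (by
      simp only [zero_smul, add_zero, hrep]
      rwa [hX.inv_cc he])).1
  have h7 : (fun t : ℝ => jc k (G t) (e'.base x)) =ᶠ[𝓝 0]
      (fun a => (jetB X k).coord e' ((jetB X k).inv e (e.base x, a))) ∘
        fun t : ℝ => jc k (X.rep e s) (e.base x) + t • jc k η (e.base x) := by
    filter_upwards [h5, h6] with t ht ht'
    have hft : ∀ᶠ w in 𝓝 (e.base x), ContDiffAt ℝ ∞ (X.rep e s + t • η) w := by
      filter_upwards [hf, hη] with w hw hw'
      exact hw.add (contDiffAt_const.smul hw')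
    obtain ⟨q1, q2, q3⟩ := hX.section_of_function e (f := X.rep e s + t • η) ht hft
    rw [hz] at q1
    have hdm : X.inv e (e.base x, (X.rep e s + t • η) (e.base x)) ∈ X.dom e := inv_mem ht
    have hj1 := jetB_coord_mk (k := k) q1 hdm
    rw [jc_congr q3, jc_add hf.self_of_nhds
      (show ContDiffAt ℝ ∞ (t • η) (e.base x) from contDiffAt_const.smul hη.self_of_nhds),
      jc_smul t hη.self_of_nhds] at hj1
    have hj2 := jetB_coord_mk (k := k) q1 (e := e') ht'
    have hj3 : (jetB X k).inv e (e.base x, jc k (X.rep e s) (e.base x) + t • jc k η (e.base x)) =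
        Jet.mk k _ q1 := by
      rw [← hj1]
      exact hQ.inv_cc (b := Jet.mk k _ q1) (e := e) hdm
    simp only [Function.comp_apply]
    rw [hj3, hj2]
    rfl
  -- The same curve of jet coordinates is differentiated twice: by the chain rule through the jet
  -- chart, and by commuting `d/dt` with the derivatives that make up the jet.
  have h8 := (deriv_jc (k := k) hG).congr_of_eventuallyEq h7.symm
  rw [jc_congr hd] at h8
  exact h4.unique h8

theorem eventually_contDiffAt_varTrans (hX : X.Nice) {s : M → B} {x : M} (hs : X.IsSection s x)
    {e e' : FibredChart m N π} (he : s x ∈ X.dom e) (he' : s x ∈ X.dom e')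
    {η : Eu (m + 1) → ι → ℝ} (hη : ∀ᶠ w in 𝓝 (e.base x), ContDiffAt ℝ ∞ η w) :
    ∀ᶠ w in 𝓝 (e'.base x), ContDiffAt ℝ ∞ (varTrans X e e' s η) w := by
  have hx := hX.base_mem hs he
  have hx' := hX.base_mem hs he'
  have hz' : e'.base.symm (e'.base x) = x := e'.base.left_inv hx'
  have h1 : ∀ᶠ y in 𝓝 x, ContDiffAt ℝ ∞ (varTrans X e e' s η) (e'.base y) := by
    filter_upwards [hX.eventually_isSection hs, IsSection.eventually_dom hs he,
      IsSection.eventually_dom hs he', e.eventually_base hx hη] with y h1 h2 h3 h4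
    exact contDiffAt_varTrans hX h1 h2 h3 h4
  filter_upwards [e'.eventually_base_symm (e'.base.map_source hx')
    (p := fun y => ContDiffAt ℝ ∞ (varTrans X e e' s η) (e'.base y)) (by rwa [hz']),
    e'.base.open_target.mem_nhds (e'.base.map_source hx')] with w hw hwt
  rwa [e'.base.right_inv hwt] at hw

end Variation

end HigherOrderPhase
end

noncomputable section

namespace HigherOrderPhase

open BundleCoords

variable {m N : ℕ} {M Φ : Type*}
  [TopologicalSpace M] [ChartedSpace (EuclideanSpace ℝ (Fin (m + 1))) M]
  [TopologicalSpace Φ] [ChartedSpace (EuclideanSpace ℝ (Fin (m + 1 + N))) Φ]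
  {π : Φ → M}

/-! ### Sections of the jet bundles and of the phase bundles -/

section Lifts

variable {B : Type*} {ι : Type} [Fintype ι] {X : BundleCoords m N π B ι}

open Classical in
/-- The jets of a section, as a section of the jet bundle. -/
def jetExt (k : ℕ) {s : M → B} {x : M} (hs : X.IsSection s x) (y : M) : Jet X k :=
  -- The default value only makes the map total; near `x` it does not occur.
  if h : X.IsSection s y then Jet.mk k s h else Jet.mk k s hs

theorem jetExt_eq {k : ℕ} {s : M → B} {x y : M} (hs : X.IsSection s x) (h : X.IsSection s y) :
    jetExt k hs y = Jet.mk k s h := dif_pos h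

/-- A section of the phase bundle over a given section, with given momenta. -/
def liftSection (X : BundleCoords m N π B ι) (e : FibredChart m N π) (q : M → B) [Nonempty (Cov X)]
    (f : Eu (m + 1) → ι × Fin (m + 1) → ℝ) (y : M) : Cov X :=
  (covB X).inv e (e.base y, Sum.elim (X.rep e q (e.base y)) (f (e.base y)))

variable [IsManifold (𝓡 (m + 1)) ∞ M]

theorem jetExt_isSection (hX : X.Nice) {k : ℕ} {s : M → B} {x : M} (hs : X.IsSection s x) :
    (jetB X k).IsSection (jetExt k hs) x := by
  obtain ⟨e, he⟩ := hX.cover (s x)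
  have hx := hX.base_mem hs he
  have hz : e.base.symm (e.base x) = x := e.base.left_inv hx
  have hev : ∀ᶠ y in 𝓝 x, y ∈ e.base.source ∧ s y ∈ X.dom e ∧ X.IsSection s y := by
    filter_upwards [e.base.open_source.mem_nhds hx, IsSection.eventually_dom hs he,
      hX.eventually_isSection hs] with y h1 h2 h3
    exact ⟨h1, h2, h3⟩
  refine (jetB_nice hX k).isSection_of_chart e ?_ ?_ ?_
  · filter_upwards [hev] with y hy
    rw [jetExt_eq hs hy.2.2]
    rfl
  · filter_upwards [hev] with y hy
    rw [jetExt_eq hs hy.2.2]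
    exact hy.2.1
  · have h1 : (jetB X k).rep e (jetExt k hs) =ᶠ[𝓝 (e.base x)] jc k (X.rep e s) := by
      filter_upwards [e.eventually_base_symm (e.base.map_source hx) (p := fun y =>
        y ∈ e.base.source ∧ s y ∈ X.dom e ∧ X.IsSection s y) (by rwa [hz]),
        e.base.open_target.mem_nhds (e.base.map_source hx)] with w hw hwt
      simp only [rep]
      rw [jetExt_eq hs hw.2.2, jetB_coord_mk hw.2.2 hw.2.1, e.base.right_inv hwt]
    filter_upwards [h1.eventually_nhds, hX.contDiffAt_rep hs he] with w hw hw'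
    exact (contDiffAt_jc hw').congr_of_eventuallyEq hw

theorem liftSection_spec (hX : X.Nice) [Nonempty (Cov X)] {q : M → B} {x : M}
    (hq : X.IsSection q x) {e : FibredChart m N π} (he : q x ∈ X.dom e)
    {f : Eu (m + 1) → ι × Fin (m + 1) → ℝ} (hf : ∀ᶠ w in 𝓝 (e.base x), ContDiffAt ℝ ∞ f w) :
    (covB X).IsSection (liftSection X e q f) x ∧ (∀ᶠ y in 𝓝 x, (liftSection X e q f y).1 = q y) ∧
      (covB X).rep e (liftSection X e q f) =ᶠ[𝓝 (e.base x)]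
        fun w => Sum.elim (X.rep e q w) (f w) := by
  have hx := hX.base_mem hq he
  have hz : e.base.symm (e.base x) = x := e.base.left_inv hx
  have hcc := hX.cc_section hq he
  have hr : (e.base x, X.rep e q (e.base x)) ∈ X.range e := by
    rw [← hcc.self_of_nhds.2, hz]
    exact cc_mem_range he
  have hP := covB_nice hX
  have hg : ∀ᶠ w in 𝓝 (e.base x), ContDiffAt ℝ ∞ (fun w => Sum.elim (X.rep e q w) (f w)) w := by
    filter_upwards [hf, hX.contDiffAt_rep hq he] with w h1 h2
    rw [contDiffAt_pi]
    rintro (i | a)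
    · exact contDiffAt_pi.1 h2 i
    · exact contDiffAt_pi.1 h1 a
  obtain ⟨h1, h2, h3⟩ := hP.section_of_function e (f := fun w => Sum.elim (X.rep e q w) (f w))
    (z := e.base x) ((covB_range hX e _).2 hr) hg
  rw [hz] at h1 h2
  refine ⟨h1, ?_, h3⟩
  have h4 := e.eventually_base hx hcc
  filter_upwards [h2, h4, e.base.open_source.mem_nhds hx] with y hy hy4 hys
  rw [e.base.left_inv hys] at hy4
  have hm : (liftSection X e q f y).1 ∈ X.dom e :=
    inv_mem (X := covB X) hy
  refine hX.injOn e hm hy4.1 ?_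
  rw [hy4.2]
  have h5 : (covB X).cc e (liftSection X e q f y) = _ := cc_inv hy
  have h6 := congrArg Prod.fst h5
  refine Prod.ext h6 ?_
  ext i
  exact congrFun (congrArg Prod.snd h5) (Sum.inl i)

end Lifts

/-! ### The pairing of momenta with variations as a divergence -/

section Divergence

variable {B : Type*} {ι : Type} [Fintype ι] {X : BundleCoords m N π B ι}

/-- The vector density `p^λ_i δφ^i`, in coordinates, for a section of the phase bundle of a jet
bundle
and a variation of the field. -/
def current {k : ℕ} (e : FibredChart m N π) (p : M → Cov (jetB X k)) (η : Eu (m + 1) → ι → ℝ)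
    (w : Eu (m + 1)) : Eu (m + 1) :=
  contr (momC e (p (e.base.symm w))) (jc k η w)

/-- Leibniz rule. It turns the algebraic `pair` into a divergence, whose behaviour under coordinate
changes is known. -/
theorem dvg_contr {κ : Type} [Fintype κ] {P : Eu (m + 1) → κ × Fin (m + 1) → ℝ}
    {h : Eu (m + 1) → κ → ℝ} {z : Eu (m + 1)} (hP : DifferentiableAt ℝ P z)
    (hh : DifferentiableAt ℝ h z) :
    dvg (fun w => contr (P w) (h w)) z = pair (jc 1 P z) (jc 1 h z) := by
  have hc : DifferentiableAt ℝ (fun w => contr (P w) (h w)) z :=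
    DifferentiableAt.comp (g := fun q : (κ × Fin (m + 1) → ℝ) × (κ → ℝ) => contr q.1 q.2) z
      (contDiff_contr.differentiable (by simp) _) (hP.prodMk hh)
  have h1 : ∀ lam, fderiv ℝ (fun w => contr (P w) (h w)) z (ev lam) lam =
      ∑ i, (fderiv ℝ P z (ev lam) (i, lam) * h z i + P z (i, lam) * fderiv ℝ h z (ev lam) i) := by
    intro lam
    have h2 := (EuclideanSpace.proj lam : Eu (m + 1) →L[ℝ] ℝ).hasFDerivAt.comp z hc.hasFDerivAt
    have h3 : HasFDerivAt (fun w => ∑ i, P w (i, lam) * h w i)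
        (∑ i, (P z (i, lam) • (ContinuousLinearMap.proj i).comp (fderiv ℝ h z) +
          h z i • (ContinuousLinearMap.proj (i, lam)).comp (fderiv ℝ P z))) z := by
      refine HasFDerivAt.fun_sum fun i _ => HasFDerivAt.mul ?_ ?_
      · exact (hasFDerivAt_pi'.1 hP.hasFDerivAt) (i, lam)
      · exact (hasFDerivAt_pi'.1 hh.hasFDerivAt) i
    have h4 := congrArg (fun L : Eu (m + 1) →L[ℝ] ℝ => L (ev lam)) (h2.unique h3)
    refine h4.trans ?_
    simp only [_root_.sum_apply, _root_.add_apply, _root_.smul_apply,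
        ContinuousLinearMap.comp_apply, ContinuousLinearMap.proj_apply,
      smul_eq_mul]
    exact Finset.sum_congr rfl fun i _ => by ring
  simp only [dvg, pair, h1, jc_ix0, jc_ix1]
  exact Finset.sum_comm

variable [IsManifold (𝓡 (m + 1)) ∞ M]

theorem contDiffAt_momC (hX : X.Nice) {p : M → Cov X} {x : M} (hp : (covB X).IsSection p x)
    {e : FibredChart m N π} (he : (p x).1 ∈ X.dom e) :
    ∀ᶠ w in 𝓝 (e.base x), ContDiffAt ℝ ∞ (fun w => momC e (p (e.base.symm w))) w := by
  filter_upwards [(covB_nice hX).contDiffAt_rep hp (e := e) he] with w hw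
  rw [contDiffAt_pi]
  intro a
  exact contDiffAt_pi.1 hw (Sum.inr a)

theorem contDiffAt_current {k : ℕ} (hX : X.Nice) {p : M → Cov (jetB X k)} {x : M}
    (hp : (covB (jetB X k)).IsSection p x) {e : FibredChart m N π}
    (he : (p x).1 ∈ (jetB X k).dom e) {η : Eu (m + 1) → ι → ℝ}
    (hη : ∀ᶠ w in 𝓝 (e.base x), ContDiffAt ℝ ∞ η w) :
    ∀ᶠ w in 𝓝 (e.base x), ContDiffAt ℝ ∞ (current e p η) w := by
  filter_upwards [contDiffAt_momC (jetB_nice hX k) hp he, hη] with w h1 h2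
  exact ContDiffAt.comp (g := fun q : ((ι × JetIdx (m + 1) k) × Fin (m + 1) → ℝ) ×
    (ι × JetIdx (m + 1) k → ℝ) => contr q.1 q.2) w contDiff_contr.contDiffAt
    (h1.prodMk (contDiffAt_jc h2))

theorem momPart_coord_mk (hX : X.Nice) {p : M → Cov X} {x : M} (hp : (covB X).IsSection p x)
    {e : FibredChart m N π} (he : (p x).1 ∈ X.dom e) :
    momPart ((jetB (covB X) 1).coord e (Jet.mk 1 p hp)) =
      jc 1 (fun w => momC e (p (e.base.symm w))) (e.base x) := by
  have hr := ((covB_nice hX).contDiffAt_rep hp (e := e) he).self_of_nhds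
  have hm := (contDiffAt_momC hX hp he).self_of_nhds
  rw [jetB_coord_mk hp (e := e) he]
  ext ⟨a, j⟩
  obtain rfl | ⟨lam, rfl⟩ := jetIdx_one_cases j
  · simp only [momPart, jc_ix0]
    rfl
  · simp only [momPart, jc_ix1]
    have h1 := hasFDerivAt_pi'.1 (hr.differentiableAt (by simp)).hasFDerivAt (Sum.inr a)
    have h2 := hasFDerivAt_pi'.1 (hm.differentiableAt (by simp)).hasFDerivAt a
    exact congrArg (fun L : Eu (m + 1) →L[ℝ] ℝ => L (ev lam)) (h1.unique h2)

theorem confPart_coord_mk (hX : X.Nice) {p : M → Cov X} {x : M} (hp : (covB X).IsSection p x)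
    {e : FibredChart m N π} (he : (p x).1 ∈ X.dom e) :
    confPart ((jetB (covB X) 1).coord e (Jet.mk 1 p hp)) =
      jc 1 (X.rep e fun y => (p y).1) (e.base x) := by
  have hr := ((covB_nice hX).contDiffAt_rep hp (e := e) he).self_of_nhds
  have hm : ContDiffAt ℝ ∞ (X.rep e fun y => (p y).1) (e.base x) := by
    rw [contDiffAt_pi]
    intro i
    exact contDiffAt_pi.1 hr (Sum.inl i)
  rw [jetB_coord_mk hp (e := e) he]
  ext ⟨a, j⟩
  obtain rfl | ⟨lam, rfl⟩ := jetIdx_one_cases j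
  · simp only [confPart, jc_ix0]
    rfl
  · simp only [confPart, jc_ix1]
    have h1 := hasFDerivAt_pi'.1 (hr.differentiableAt (by simp)).hasFDerivAt (Sum.inl a)
    have h2 := hasFDerivAt_pi'.1 (hm.differentiableAt (by simp)).hasFDerivAt a
    exact congrArg (fun L : Eu (m + 1) →L[ℝ] ℝ => L (ev lam)) (h1.unique h2)

theorem dvg_current {k : ℕ} (hX : X.Nice) {p : M → Cov (jetB X k)} {x : M}
    (hp : (covB (jetB X k)).IsSection p x) {e : FibredChart m N π}
    (he : (p x).1 ∈ (jetB X k).dom e) {η : Eu (m + 1) → ι → ℝ}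
    (hη : ContDiffAt ℝ ∞ η (e.base x)) :
    dvg (current e p η) (e.base x) =
      pair (momPart ((jetB (covB (jetB X k)) 1).coord e (Jet.mk 1 p hp)))
        (jc 1 (jc k η) (e.base x)) := by
  rw [momPart_coord_mk (jetB_nice hX k) hp he]
  exact dvg_contr ((contDiffAt_momC (jetB_nice hX k) hp he).self_of_nhds.differentiableAt (by simp))
    ((contDiffAt_jc hη).differentiableAt (by simp))

/-- The change of coordinates of the current. -/
theorem current_trans {k : ℕ} (hX : X.Nice) {s : M → B} {x : M} (hs : X.IsSection s x)
    {p : M → Cov (jetB X k)} (hps : ∀ᶠ y in 𝓝 x, ∃ h : X.IsSection s y, (p y).1 = Jet.mk k s h)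
    (hp : (covB (jetB X k)).IsSection p x)
    {e e' : FibredChart m N π} (he : s x ∈ X.dom e) (he' : s x ∈ X.dom e')
    {η : Eu (m + 1) → ι → ℝ} (hη : ∀ᶠ w in 𝓝 (e.base x), ContDiffAt ℝ ∞ η w) :
    ∀ᶠ w in 𝓝 (e'.base x), current e' p (varTrans X e e' s η) w =
      coef ((star (current e p η (e.base (e'.base.symm w)))).compContinuousLinearMap
        (fderiv ℝ (fun w => e.base (e'.base.symm w)) w)) := by
  have hQ := jetB_nice hX k
  have hx := hX.base_mem hs he
  have hx' := hX.base_mem hs he'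
  have hz' : e'.base.symm (e'.base x) = x := e'.base.left_inv hx'
  have hev : ∀ᶠ y in 𝓝 x, current e' p (varTrans X e e' s η) (e'.base y) =
      coef ((star (current e p η (e.base y))).compContinuousLinearMap
        (fderiv ℝ (fun w => e.base (e'.base.symm w)) (e'.base y))) := by
    filter_upwards [hps, IsSection.eventually_dom hs he, IsSection.eventually_dom hs he',
      e.base.open_source.mem_nhds hx, e'.base.open_source.mem_nhds hx', hp.1,
      e.eventually_base hx hη.eventually_nhds] with y ⟨hy, hyp⟩ hd hd' hb hb' hpr hηy
    have h1 : (p y).1 ∈ (jetB X k).dom e := by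
      rw [hyp]
      exact hd
    have h1' : (p y).1 ∈ (jetB X k).dom e' := by
      rw [hyp]
      exact hd'
    -- Apply the pointwise rule to the vertical vector with components `j^k η` in `e`; in `e'` its
    -- components are the jet of the transformed variation.
    have h2 := contr_trans hQ (p := p y) h1 h1' (vecOf hQ h1 (jc k η (e.base y)))
    rw [vecOf_self hQ h1] at h2
    have h3 : (vecOf hQ h1 (jc k η (e.base y))).1 ⟨e', h1'⟩ =
        jc k (varTrans X e e' s η) (e'.base y) := by
      rw [← vtrans_jc hX hy hd hd' hηy]
      simp only [vecOf, hyp]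
    have h4 : (jetB X k).proj (p y).1 = y := hpr
    rw [h3, h4] at h2
    simp only [current]
    rw [e.base.left_inv hb, e'.base.left_inv hb']
    exact h2
  filter_upwards [e'.eventually_base_symm (e'.base.map_source hx') (p := fun y =>
    current e' p (varTrans X e e' s η) (e'.base y) =
      coef ((star (current e p η (e.base y))).compContinuousLinearMap
        (fderiv ℝ (fun w => e.base (e'.base.symm w)) (e'.base y)))) (by rwa [hz']),
    e'.base.open_target.mem_nhds (e'.base.map_source hx')] with w hw hwt
  rwa [e'.base.right_inv hwt] at hw

/-- The pairing of the momenta with the variations is invariant, up to a density factor. -/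
theorem pair_trans {k : ℕ} (hX : X.Nice) {s : M → B} {x : M} (hs : X.IsSection s x)
    {p : M → Cov (jetB X k)} (hps : ∀ᶠ y in 𝓝 x, ∃ h : X.IsSection s y, (p y).1 = Jet.mk k s h)
    (hp : (covB (jetB X k)).IsSection p x)
    {e e' : FibredChart m N π} (he : s x ∈ X.dom e) (he' : s x ∈ X.dom e')
    {η : Eu (m + 1) → ι → ℝ} (hη : ∀ᶠ w in 𝓝 (e.base x), ContDiffAt ℝ ∞ η w) :
    pair (momPart ((jetB (covB (jetB X k)) 1).coord e' (Jet.mk 1 p hp)))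
        (jc 1 (jc k (varTrans X e e' s η)) (e'.base x)) =
      (fderiv ℝ (fun w => e.base (e'.base.symm w)) (e'.base x)).det *
        pair (momPart ((jetB (covB (jetB X k)) 1).coord e (Jet.mk 1 p hp)))
          (jc 1 (jc k η) (e.base x)) := by
  obtain ⟨hy, hyp⟩ := hps.self_of_nhds
  have hpe : (p x).1 ∈ (jetB X k).dom e := by
    rw [hyp]
    exact he
  have hpe' : (p x).1 ∈ (jetB X k).dom e' := by
    rw [hyp]
    exact he'
  have hx := hX.base_mem hs he
  have hx' := hX.base_mem hs he'
  have hz' : e'.base.symm (e'.base x) = x := e'.base.left_inv hx'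
  have hη' := eventually_contDiffAt_varTrans hX hs he he' hη
  rw [← dvg_current hX hp hpe hη.self_of_nhds, ← dvg_current hX hp hpe' hη'.self_of_nhds]
  -- The jet of the momentum section determines the divergence of the current, and the two currents
  -- correspond as `(n - 1)`-forms near the point, as the exterior derivative requires.
  have h1 := dvg_pullback (V := current e p η) (ψ := fun w => e.base (e'.base.symm w))
    (z := e'.base x) (W := current e' p (varTrans X e e' s η))
    (by
      rw [hz']
      exact (contDiffAt_current hX hp hpe hη).self_of_nhds.differentiableAt (by simp))
    (e'.contDiffAt_base e (e'.base.map_source hx') (by rwa [hz']))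
    ((contDiffAt_current hX hp hpe' hη').self_of_nhds.differentiableAt (by simp))
    (current_trans hX hs hps hp he he' hη)
  rwa [hz'] at h1

theorem FibredChart.det_ne_zero (e e' : FibredChart m N π) {x : M} (hx : x ∈ e.base.source)
    (hx' : x ∈ e'.base.source) :
    (fderiv ℝ (fun w => e.base (e'.base.symm w)) (e'.base x)).det ≠ 0 := by
  have hz : e.base.symm (e.base x) = x := e.base.left_inv hx
  have hz' : e'.base.symm (e'.base x) = x := e'.base.left_inv hx'
  have h1 := ((e'.contDiffAt_base e (e'.base.map_source hx')
    (by rwa [hz'])).differentiableAt (by simp)).hasFDerivAt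
  have h2 : HasFDerivAt (fun w => e'.base (e.base.symm w))
      (fderiv ℝ (fun w => e'.base (e.base.symm w)) (e.base x))
      (e.base (e'.base.symm (e'.base x))) := by
    rw [hz']
    exact ((e.contDiffAt_base e' (e.base.map_source hx)
      (by rwa [hz])).differentiableAt (by simp)).hasFDerivAt
  have h3 := h2.comp (e'.base x) h1
  have h4 : ((fun w => e'.base (e.base.symm w)) ∘ fun w => e.base (e'.base.symm w))
    =ᶠ[𝓝 (e'.base x)]
      id := by
    filter_upwards [e'.eventually_base_symm (e'.base.map_source hx')
      (p := fun y => y ∈ e.base.source) (by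
        rw [hz']
        exact e.base.open_source.mem_nhds hx),
      e'.base.open_target.mem_nhds (e'.base.map_source hx')] with w hw hwt
    simp only [Function.comp_apply, id]
    rw [e.base.left_inv hw, e'.base.right_inv hwt]
  have h5 := (h3.congr_of_eventuallyEq h4.symm).unique (hasFDerivAt_id _)
  intro h0
  have h6 := congrArg ContinuousLinearMap.det h5
  have h7 := LinearMap.det_comp
    ((fderiv ℝ (fun w => e'.base (e.base.symm w)) (e.base x) : Eu (m + 1) →L[ℝ] Eu (m + 1)) :
      Eu (m + 1) →ₗ[ℝ] Eu (m + 1))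
    ((fderiv ℝ (fun w => e.base (e'.base.symm w)) (e'.base x) : Eu (m + 1) →L[ℝ] Eu (m + 1)) :
      Eu (m + 1) →ₗ[ℝ] Eu (m + 1))
  have h8 : ContinuousLinearMap.det (ContinuousLinearMap.id ℝ (Eu (m + 1))) = 1 := LinearMap.det_id
  rw [h8] at h6
  have h9 : (1 : ℝ) = _ := h6.symm.trans h7
  change 1 = _ * (fderiv ℝ (fun w => e.base (e'.base.symm w)) (e'.base x)).det at h9
  rw [h0, mul_zero] at h9
  exact one_ne_zero h9

end Divergence

end HigherOrderPhase
end

noncomputable section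

namespace HigherOrderPhase

/-! ### Symmetric momenta, characterised by their action on variations -/

section SymmetryTest

variable {m N k : ℕ}

/-- Orbit counting: distribute all `l!` permutations over the words they produce from `κ`. Exactly
the rearrangements of `κ` occur, each equally often. -/
theorem card_mul_permCount {l n : ℕ} (κ : Fin l → Fin n) :
    Nat.card {μ : Fin l → Fin n // sorted μ = sorted κ} * permCount (sorted κ).1 κ =
      Nat.factorial l := by
  classical
  have h1 : ∑ μ : Fin l → Fin n, permCount μ κ = Nat.factorial l := by
    have h2 : ∀ μ : Fin l → Fin n, permCount μ κ =
        (Finset.univ.filter fun σ : Equiv.Perm (Fin l) => κ ∘ σ.symm = μ).card := by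
      intro μ
      rw [permCount, Fintype.card_subtype]
      congr 1
      ext σ
      simp only [Finset.mem_filter, Finset.mem_univ, true_and]
      constructor
      · rintro rfl
        ext j
        simp
      · rintro rfl
        ext j
        simp
    simp_rw [h2]
    rw [← Finset.card_eq_sum_card_fiberwise (fun _ _ => Finset.mem_univ _), Finset.card_univ,
      Fintype.card_perm, Fintype.card_fin]
  have h3 : ∀ μ : Fin l → Fin n, permCount μ κ =
      if sorted μ = sorted κ then permCount (sorted κ).1 κ else 0 := by
    intro μ
    split_ifs with h
    · obtain ⟨τ, hτ⟩ := exists_perm_of_sorted_eq (h.trans (sorted_val (sorted κ)).symm)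
      simp only [permCount]
      refine Fintype.card_congr ⟨fun σ => ⟨τ * σ.1, ?_⟩, fun σ => ⟨τ⁻¹ * σ.1, ?_⟩, ?_, ?_⟩
      · rw [Equiv.Perm.coe_mul, ← Function.comp_assoc, hτ, σ.2]
      · rw [Equiv.Perm.coe_mul, ← Function.comp_assoc, ← hτ, Function.comp_assoc _ τ,
          ← Equiv.Perm.coe_mul, mul_inv_cancel, Equiv.Perm.coe_one, Function.comp_id, σ.2]
      · intro σ
        simp
      · intro σ
        simp
    · exact permCount_eq_zero h
  rw [← h1]
  rw [Finset.sum_congr rfl fun μ _ => h3 μ, ← Finset.sum_filter, Finset.sum_const, smul_eq_mul,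
    Nat.card_eq_fintype_card,
    Fintype.card_subtype]

/-- Monomial variations read off single tensor components. The factor `l!` absorbs both the
multiplicity in `tens` and the derivatives of the monomial. -/
theorem contr_jc_vmono (P : MomIdx m N k → ℝ) (K : Fin N) (l : Fin (k + 1))
    (κ : Fin l → Fin (m + 1)) (z : Eu (m + 1)) (lam : Fin (m + 1)) :
    contr P (jc k (vmono z κ K) z) lam =
      Nat.factorial l * tens P K l (Fin.snoc κ lam : Fin (l + 1) → Fin (m + 1)) := by
  classical
  rw [contr_apply, Finset.sum_eq_single (K, ⟨l, sorted κ⟩)]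
  · rw [jc_vmono, dif_pos rfl, if_pos rfl, mul_one, tens]
    simp only [Fin.init_snoc, Fin.snoc_last, Fin.cast_refl, Function.comp_id]
    rw [← card_mul_permCount κ]
    have h := (card_sorted_pos (sorted κ)).ne'
    push_cast
    field_simp
  · rintro ⟨K', l', μ⟩ _ hne
    rw [jc_vmono]
    split_ifs with h hK
    · obtain rfl : l' = l := Fin.ext h
      simp only at hK
      subst hK
      have hs : sorted μ.1 ≠ sorted κ := by
        rw [sorted_val]
        rintro rfl
        exact hne rfl
      simp [permCount_eq_zero hs]
    · simp
    · simp
  · intro h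
    exact absurd (Finset.mem_univ _) h

theorem contr_jc_vmono_of_lt (P : MomIdx m N k → ℝ) (K : Fin N) {l : ℕ} (hl : k < l)
    (κ : Fin l → Fin (m + 1)) (z : Eu (m + 1)) (lam : Fin (m + 1)) :
    contr P (jc k (vmono z κ K) z) lam = 0 := by
  rw [contr_apply]
  refine Finset.sum_eq_zero fun b _ => ?_
  rw [jc_vmono, dif_neg, mul_zero]
  have := b.2.1.2
  omega

theorem coord_smul_vmono {n l : ℕ} {ι : Type} [Fintype ι] (z : Eu n) (κ : Fin l → Fin n) (a : Fin n)
    (K : ι) : (fun w : Eu n => (w a - z a) • vmono z κ K w) =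
      vmono z (Fin.snoc κ a : Fin (l + 1) → Fin n) K := by
  ext w : 1
  simp only [vmono, mono, Fin.prod_univ_castSucc, Fin.snoc_castSucc, Fin.snoc_last, smul_smul]
  rw [mul_comm]

theorem contr_add (P : MomIdx m N k → ℝ) (u v : Fin N × JetIdx (m + 1) k → ℝ) :
    contr P (u + v) = contr P u + contr P v := by
  ext lam
  simp [contr_apply, mul_add, Finset.sum_add_distrib]

theorem contr_smul (P : MomIdx m N k → ℝ) (c : ℝ) (u : Fin N × JetIdx (m + 1) k → ℝ) :
    contr P (c • u) = c • contr P u := by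
  ext lam
  simp [contr_apply, mul_left_comm, Finset.mul_sum]

theorem contr_sum {α : Type*} (s : Finset α) (P : MomIdx m N k → ℝ)
    (u : α → Fin N × JetIdx (m + 1) k → ℝ) : contr P (∑ a ∈ s, u a) = ∑ a ∈ s, contr P (u a) := by
  classical
  induction s using Finset.induction_on with
  | empty =>
    ext lam
    simp [contr_apply]
  | insert a s ha ih => rw [Finset.sum_insert ha, Finset.sum_insert ha, contr_add, ih]

theorem JetEq.sub_zero {E F : Type*} [NormedAddCommGroup E] [NormedSpace ℝ E]
    [NormedAddCommGroup F] [NormedSpace ℝ F] {r : ℕ} {f g : E → F} {z : E} (h : JetEq r f g z)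
    (hf : ContDiffAt ℝ ∞ f z) (hg : ContDiffAt ℝ ∞ g z) : JetEq r (f - g) 0 z := by
  intro l hl
  rw [iteratedFDeriv_sub_apply (hf.of_le (natCast_le_infty l)) (hg.of_le (natCast_le_infty l)),
    h l hl, sub_self, iteratedFDeriv_zero']
  rfl

theorem JetEq.of_sub_zero {E F : Type*} [NormedAddCommGroup E] [NormedSpace ℝ E]
    [NormedAddCommGroup F] [NormedSpace ℝ F] {r : ℕ} {f g : E → F} {z : E}
    (h : JetEq r (f - g) 0 z) (hf : ContDiffAt ℝ ∞ f z) (hg : ContDiffAt ℝ ∞ g z) :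
    JetEq r f g z := by
  intro l hl
  have := h l hl
  rw [iteratedFDeriv_sub_apply (hf.of_le (natCast_le_infty l)) (hg.of_le (natCast_le_infty l)),
    iteratedFDeriv_zero'] at this
  exact sub_eq_zero.1 this

/-- A product of functions which agree to orders `a` and `b`. -/
theorem JetEq.smul_congr {E F : Type*} [NormedAddCommGroup E] [NormedSpace ℝ E]
    [NormedAddCommGroup F] [NormedSpace ℝ F] {a b : ℕ} {f f' : E → ℝ} {g : E → F} {z : E}
    (hf : ContDiff ℝ ∞ f) (hf' : ContDiff ℝ ∞ f') (hg : ContDiff ℝ ∞ g)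
    (Hf : JetEq a f f' z) (Hg : JetEq b g 0 z) :
    JetEq (a + b) (fun w => f w • g w) (fun w => f' w • g w) z := by
  have h := JetEq.bilinear_zero (ContinuousLinearMap.lsmul ℝ ℝ : ℝ →L[ℝ] F →L[ℝ] F)
    (hf.sub hf') hg (Hf.sub_zero hf.contDiffAt hf'.contDiffAt) Hg
  refine JetEq.of_sub_zero ?_ (hf.smul hg).contDiffAt (hf'.smul hg).contDiffAt
  convert h using 1
  ext w
  simp

theorem JetEq.smul_congr_right {E F : Type*} [NormedAddCommGroup E] [NormedSpace ℝ E]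
    [NormedAddCommGroup F] [NormedSpace ℝ F] {b : ℕ} {f : E → ℝ} {g g' : E → F} {z : E}
    (hf : ContDiff ℝ ∞ f) (hg : ContDiff ℝ ∞ g) (hg' : ContDiff ℝ ∞ g') (Hg : JetEq b g g' z) :
    JetEq b (fun w => f w • g w) (fun w => f w • g' w) z := by
  have h := JetEq.bilinear_zero (a := 0) (ContinuousLinearMap.lsmul ℝ ℝ : ℝ →L[ℝ] F →L[ℝ] F)
    hf (hg.sub hg') (fun l hl => absurd hl (Nat.not_lt_zero l))
    (Hg.sub_zero hg.contDiffAt hg'.contDiffAt)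
  rw [zero_add] at h
  refine JetEq.of_sub_zero ?_ (hf.smul hg).contDiffAt (hf.smul hg').contDiffAt
  convert h using 1
  ext w
  simp [smul_sub]

/-- The coordinate function `x^a`, centred at `z`. -/
def cdn {n : ℕ} (z : Eu n) (a : Fin n) (w : Eu n) : ℝ := w a - z a

theorem contDiff_cdn {n : ℕ} (z : Eu n) (a : Fin n) : ContDiff ℝ ∞ (cdn z a) := by
  unfold cdn
  fun_prop

/-- Only the Taylor polynomial of `η` matters, and multiplication by a coordinate adds an index to
each monomial. The symmetry test thereby reduces to monomials. -/
theorem contr_jc_cdn_smul (P : MomIdx m N k → ℝ) (z : Eu (m + 1)) {η : Eu (m + 1) → Fin N → ℝ}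
    (hη : ContDiff ℝ ∞ η) (a b : Fin (m + 1)) :
    contr P (jc k (fun w => cdn z a w • η w) z) b =
      ∑ c : Fin N × JetIdx (m + 1) k, jc k η z c / permCount c.2.2.1 c.2.2.1 *
        contr P (jc k (vmono z (Fin.snoc c.2.2.1 a : Fin (c.2.1 + 1) → Fin (m + 1)) c.1) z) b := by
  have h1 : JetEq (k + 1) η (taylorPoly k z (jc k η z)) z :=
    jetEq_of_jc_eq hη.contDiffAt (contDiff_taylorPoly k z _).contDiffAt (jc_taylorPoly k z _).symm
  rw [(JetEq.smul_congr_right (contDiff_cdn z a) hη (contDiff_taylorPoly k z _) h1).jc_eq]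
  have h2 : (fun w => cdn z a w • taylorPoly k z (jc k η z) w) =
      ∑ c : Fin N × JetIdx (m + 1) k, (jc k η z c / permCount c.2.2.1 c.2.2.1) •
        vmono z (Fin.snoc c.2.2.1 a : Fin (c.2.1 + 1) → Fin (m + 1)) c.1 := by
    ext w : 1
    simp only [taylorPoly, Finset.sum_apply, Finset.smul_sum, Pi.smul_apply]
    refine Finset.sum_congr rfl fun c _ => ?_
    rw [smul_comm, ← coord_smul_vmono]
    rfl
  have h3 : ∀ c : Fin N × JetIdx (m + 1) k, ContDiffAt ℝ ∞
      ((jc k η z c / permCount c.2.2.1 c.2.2.1) •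
        vmono z (Fin.snoc c.2.2.1 a : Fin (c.2.1 + 1) → Fin (m + 1)) c.1) z := fun c =>
    contDiffAt_const.smul (contDiff_vmono _ _ _).contDiffAt
  rw [h2, jc_sum _ h3, contr_sum]
  simp_rw [jc_smul _ (contDiff_vmono _ _ _).contDiffAt, contr_smul]
  simp

/-- The action of a momentum on the variations `x^a η` is symmetric. -/
def SymTest (r : ℕ) (P : MomIdx m N k → ℝ) (z : Eu (m + 1)) : Prop :=
  ∀ η : Eu (m + 1) → Fin N → ℝ, ContDiff ℝ ∞ η → JetEq (r - 1) η 0 z → ∀ a b : Fin (m + 1),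
    contr P (jc k (fun w => cdn z a w • η w) z) b = contr P (jc k (fun w => cdn z b w • η w) z) a

/-- Permutations fixing the last index only rearrange indices in which the momentum is symmetric by
construction. -/
theorem tens_comp_swap_of_lt (P : MomIdx m N k → ℝ) (K : Fin N) (l : Fin (k + 1))
    (ν : Fin (l + 1) → Fin (m + 1)) (τ : Equiv.Perm (Fin (l + 1)))
    (h : τ (Fin.last l) = Fin.last l) : tens P K l (ν ∘ τ) = tens P K l ν := by
  have h1 : ∀ j : Fin l, τ j.castSucc ≠ Fin.last l := by
    intro j hj
    rw [← h] at hj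
    exact (Fin.castSucc_lt_last j).ne (τ.injective hj)
  have h1' : ∀ j : Fin l, τ.symm j.castSucc ≠ Fin.last l := by
    intro j hj
    rw [Equiv.symm_apply_eq, h] at hj
    exact (Fin.castSucc_lt_last j).ne hj
  let σ : Equiv.Perm (Fin l) :=
    { toFun := fun j => (τ j.castSucc).castPred (h1 j)
      invFun := fun j => (τ.symm j.castSucc).castPred (h1' j)
      left_inv := fun j => by simp
      right_inv := fun j => by simp }
  have h2 : Fin.init (ν ∘ τ) = Fin.init ν ∘ σ := by
    ext j
    simp [Fin.init, σ]
  simp only [tens]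
  rw [h2, sorted_comp_perm, Function.comp_apply, h]

/-- For a monomial `η` of degree `l` with indices `κ`, the test compares `p^{κ a b}` with `p^{κ b
a}`, components of level `l + 1`. Exchanging the last two indices, together with permutations of all
but the last, generates all permutations. Level `0` carries no condition, which makes the truncated
`r - 1` harmless. -/
theorem mem_symSub_iff_symTest (r : ℕ) (P : MomIdx m N k → ℝ) (z : Eu (m + 1)) :
    P ∈ symSub m N {l : Fin (k + 1) | r ≤ l} ↔ SymTest r P z := by
  constructor
  · intro h η hη hJ a b
    rw [contr_jc_cdn_smul P z hη, contr_jc_cdn_smul P z hη]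
    refine Finset.sum_congr rfl fun c _ => ?_
    obtain ⟨K, ⟨l, hl⟩, μ⟩ := c
    -- Taylor coefficients of degree below `r - 1` vanish by assumption, so only levels from `r` on
    -- (or the vacuous level `0`) are concerned.
    by_cases hr : l < r - 1
    · have : jc k η z (K, ⟨⟨l, hl⟩, μ⟩) = 0 := by
        simp only [jc]
        rw [hJ l hr, iteratedFDeriv_zero']
        rfl
      simp [this]
    · congr 1
      -- Beyond degree `k` the product has zero `k`-jet at `z`, and both sides vanish.
      by_cases hk : l + 1 < k + 1
      · have hm : ∀ ν (σ : Equiv.Perm (Fin (l + 1 + 1))),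
            tens P K ⟨l + 1, hk⟩ (ν ∘ σ) = tens P K ⟨l + 1, hk⟩ ν := by
          intro ν σ
          have hl' : (⟨l + 1, hk⟩ : Fin (k + 1)) ∈ {l : Fin (k + 1) | r ≤ l} := by
            change r ≤ l + 1
            omega
          rw [h _ hl' K, h _ hl' K]
          exact symTens_comp_perm P K ⟨l + 1, hk⟩ ν σ
        refine (contr_jc_vmono P K ⟨l + 1, hk⟩ _ z b).trans
          (Eq.trans ?_ (contr_jc_vmono P K ⟨l + 1, hk⟩ _ z a).symm)
        congr 1
        rw [← hm _ (Equiv.swap (Fin.last l).castSucc (Fin.last (l + 1)))]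
        congr 1
        ext j
        congr 1
        induction j using Fin.lastCases with
        | last => simp
        | cast j =>
          induction j using Fin.lastCases with
          | last => simp
          | cast j =>
            rw [Function.comp_apply, Equiv.swap_apply_of_ne_of_ne]
            · simp
            · simp [Fin.ext_iff, j.2.ne]
            · simp [Fin.ext_iff, (j.2.trans (Nat.lt_succ_self _)).ne]
      · rw [contr_jc_vmono_of_lt P K (show k < l + 1 by omega),
          contr_jc_vmono_of_lt P K (show k < l + 1 by omega)]
  · intro h
    refine mem_symSub_of_perm fun l hl K ν σ => ?_
    have hσ : σ ∈ Submonoid.closure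
        (Set.range fun i : Fin l => Equiv.swap i.castSucc i.succ) := by
      rw [Equiv.Perm.mclosure_swap_castSucc_succ]
      trivial
    induction hσ using Submonoid.closure_induction generalizing ν with
    | one => rfl
    | mul x y _ _ hx hy => rw [Equiv.Perm.coe_mul, ← Function.comp_assoc, hy, hx]
    | mem x hx =>
      obtain ⟨i, rfl⟩ := hx
      -- Only the last adjacent transposition moves `λ`; this is where the test is needed.
      by_cases hi : i.succ = Fin.last l
      · obtain ⟨l, hlk⟩ := l
        obtain _ | l := l
        · exact i.elim0
        obtain rfl : i = Fin.last l := by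
          rw [← Fin.succ_last] at hi
          exact Fin.succ_injective _ hi
        have hr : r ≤ l + 1 := hl
        let κ : Fin l → Fin (m + 1) := fun j => ν j.castSucc.castSucc
        have hJ : JetEq (r - 1) (vmono z κ K) 0 z := by
          intro i hi
          rw [vmono_eq, iteratedFDeriv_multilinear_diag_of_ne (by omega), iteratedFDeriv_zero']
          rfl
        have h1 := h _ (contDiff_vmono z κ K) hJ (ν (Fin.last l).castSucc) (ν (Fin.last (l + 1)))
        have h2 : ∀ a, (fun w => cdn z a w • vmono z κ K w) =
          vmono z (Fin.snoc κ a : Fin (l + 1) → Fin (m + 1)) K := coord_smul_vmono z κ (K := K)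
        rw [h2, h2] at h1
        have h3 := (contr_jc_vmono P K ⟨l + 1, hlk⟩ _ z _).symm.trans
          (h1.trans (contr_jc_vmono P K ⟨l + 1, hlk⟩ _ z _))
        have h4 := mul_left_cancel₀ (Nat.cast_ne_zero.2 (Nat.factorial_ne_zero _)) h3
        have e1 : (Fin.snoc (Fin.snoc κ (ν (Fin.last l).castSucc) : Fin (l + 1) → Fin (m + 1))
            (ν (Fin.last (l + 1))) : Fin (l + 2) → Fin (m + 1)) = ν := by
          ext j
          congr 1
          induction j using Fin.lastCases with
          | last => simp
          | cast j =>
            induction j using Fin.lastCases with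
            | last => simp
            | cast j => simp [κ]
        have e2 : (Fin.snoc (Fin.snoc κ (ν (Fin.last (l + 1))) : Fin (l + 1) → Fin (m + 1))
            (ν (Fin.last l).castSucc) : Fin (l + 2) → Fin (m + 1)) =
            ν ∘ Equiv.swap (Fin.last l).castSucc (Fin.last l).succ := by
          ext j
          congr 1
          induction j using Fin.lastCases with
          | last =>
            rw [Function.comp_apply, ← Fin.succ_last, Equiv.swap_apply_right, Fin.succ_last]
            simp
          | cast j =>
            induction j using Fin.lastCases with
            | last => simp
            | cast j =>
              rw [Function.comp_apply, Equiv.swap_apply_of_ne_of_ne]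
              · simp [κ]
              · simp [Fin.ext_iff, j.2.ne]
              · simp [Fin.ext_iff, (j.2.trans (Nat.lt_succ_self _)).ne]
        exact (congrArg _ e2.symm).trans (h4.symm.trans (congrArg _ e1))
      · refine tens_comp_swap_of_lt P K l ν _ (Equiv.swap_apply_of_ne_of_ne ?_ (Ne.symm hi))
        exact (Fin.castSucc_lt_last i).ne'

end SymmetryTest

end HigherOrderPhase
end

noncomputable section

namespace HigherOrderPhase

open BundleCoords

variable {m N : ℕ} {M Φ : Type*}
  [TopologicalSpace M] [ChartedSpace (EuclideanSpace ℝ (Fin (m + 1))) M]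
  [TopologicalSpace Φ] [ChartedSpace (EuclideanSpace ℝ (Fin (m + 1 + N))) Φ]
  {π : Φ → M} {k : ℕ} [IsManifold (𝓡 (m + 1)) ∞ M]

/-! ### Symmetry of momenta in different charts -/

section SymmetryInvariance

theorem Eu.eq_sum {n : ℕ} (v : Eu n) : v = ∑ c, v c • ev c := by
  ext j
  simp [Finset.sum_apply, Pi.single_apply]

theorem contDiffAt_clm_of_apply {D E F : Type*} [NormedAddCommGroup D] [NormedSpace ℝ D]
    [NormedAddCommGroup E] [NormedSpace ℝ E] [FiniteDimensional ℝ E] [NormedAddCommGroup F]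
    [NormedSpace ℝ F] {f : D → E →L[ℝ] F} {z : D} (h : ∀ v, ContDiffAt ℝ ∞ (fun w => f w v) z) :
    ContDiffAt ℝ ∞ f z := by
  let e₁ : E ≃L[ℝ] (Fin (Module.finrank ℝ E) → ℝ) :=
    ContinuousLinearEquiv.ofFinrankEq (Module.finrank_fin_fun ℝ).symm
  let e₂ := (e₁.arrowCongr (1 : F ≃L[ℝ] F)).trans
    (ContinuousLinearEquiv.piRing (Fin (Module.finrank ℝ E)))
  rw [← Function.id_comp f, ← e₂.symm_comp_self]
  exact e₂.symm.contDiff.contDiffAt.comp z (contDiffAt_pi.2 fun i => h _)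

theorem jetEq_two_affine {E F : Type*} [NormedAddCommGroup E] [NormedSpace ℝ E]
    [NormedAddCommGroup F] [NormedSpace ℝ F] {f : E → F} {z : E} {y : F}
    (hy : f z = y) :
    JetEq 2 f (fun w => y + fderiv ℝ f z (w - z)) z := by
  subst hy
  intro l hl
  interval_cases l
  · ext v
    simp
  · ext v
    rw [iteratedFDeriv_one_apply, iteratedFDeriv_one_apply]
    have h1 : HasFDerivAt (fun w => f z + fderiv ℝ f z (w - z)) (fderiv ℝ f z) z := by
      simpa using ((fderiv ℝ f z).hasFDerivAt.comp z
        ((hasFDerivAt_id z).sub_const z)).const_add (f z)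
    rw [h1.fderiv]

/-- The transformation law of vector densities, obtained from the pullback of `(n - 1)`-forms by
writing the contraction in `e'` as `A u` with invertible `A`. -/
theorem contr_varTrans (hF : (fieldB m N π).Nice) {p : Phase m N π k} {s : M → Φ} {x : M}
    (hs : (fieldB m N π).IsSection s x) (hp : p.1 = Jet.mk k s hs) {e e' : FibredChart m N π}
    (he : s x ∈ (fieldB m N π).dom e) (he' : s x ∈ (fieldB m N π).dom e')
    {η : Eu (m + 1) → Fin N → ℝ} (hη : ∀ᶠ w in 𝓝 (e'.base x), ContDiffAt ℝ ∞ η w) :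
    fderiv ℝ (fun w => e'.base (e.base.symm w)) (e.base x)
        (contr (momC e p) (jc k (varTrans (fieldB m N π) e' e s η) (e.base x))) =
      (fderiv ℝ (fun w => e'.base (e.base.symm w)) (e.base x)).det •
        contr (momC e' p) (jc k η (e'.base x)) := by
  have hQ := jetB_nice hF k
  have h1 : p.1 ∈ (confB m N π k).dom e := by
    rw [hp]
    exact he
  have h1' : p.1 ∈ (confB m N π k).dom e' := by
    rw [hp]
    exact he'
  have h2 := contr_trans hQ (p := p) h1' h1 (vecOf hQ h1' (jc k η (e'.base x)))
  rw [vecOf_self hQ h1'] at h2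
  have h3 : (vecOf hQ h1' (jc k η (e'.base x))).1 ⟨e, h1⟩ =
      jc k (varTrans (fieldB m N π) e' e s η) (e.base x) := by
    rw [← vtrans_jc hF hs he' he hη]
    simp only [vecOf, hp]
  have h4 : (confB m N π k).proj p.1 = x := by
    rw [hp]
    rfl
  rw [h3, h4] at h2
  have hdet := FibredChart.det_ne_zero e' e (hF.base_mem hs he') (hF.base_mem hs he)
  set A := fderiv ℝ (fun w => e'.base (e.base.symm w)) (e.base x) with hA
  obtain ⟨u, hu⟩ : ∃ u, A u = contr (momC e' p) (jc k η (e'.base x)) :=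
    ⟨(LinearEquiv.ofIsUnitDet (v := stdB (m + 1)) (v' := stdB (m + 1))
      (f := (A : Eu (m + 1) →ₗ[ℝ] Eu (m + 1))) (by
        rw [LinearMap.det_toMatrix]
        exact hdet.isUnit)).symm _,
      LinearEquiv.apply_symm_apply (LinearEquiv.ofIsUnitDet (v := stdB (m + 1))
        (v' := stdB (m + 1)) (f := (A : Eu (m + 1) →ₗ[ℝ] Eu (m + 1))) (by
          rw [LinearMap.det_toMatrix]
          exact hdet.isUnit)) _⟩
  rw [h2, ← hu, coef_pullback, map_smul]

/-- Transforming a variation is composition with a coordinate change followed by a pointwise linear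
map, so the order of vanishing is kept. -/
theorem jetEq_varTrans_zero (hF : (fieldB m N π).Nice) {s : M → Φ} {x : M}
    (hs : (fieldB m N π).IsSection s x) {e e' : FibredChart m N π}
    (he : s x ∈ (fieldB m N π).dom e) (he' : s x ∈ (fieldB m N π).dom e')
    {η : Eu (m + 1) → Fin N → ℝ} (hη : ContDiffAt ℝ ∞ η (e'.base x)) {r : ℕ}
    (hJ : JetEq r η 0 (e'.base x)) :
    JetEq r (varTrans (fieldB m N π) e' e s η) 0 (e.base x) := by
  have hx := hF.base_mem hs he
  have hx' := hF.base_mem hs he'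
  have hz : e.base.symm (e.base x) = x := e.base.left_inv hx
  have hφ : ContDiffAt ℝ ∞ (fun w => e'.base (e.base.symm w)) (e.base x) :=
    e.contDiffAt_base e' (e.base.map_source hx) (by rwa [hz])
  have hM : ContDiffAt ℝ ∞ (fun w => vtrans (fieldB m N π) e' e (s (e.base.symm w))) (e.base x) := by
    refine contDiffAt_clm_of_apply fun v => ?_
    exact contDiffAt_varTrans (η := fun _ => v) hF hs he' he contDiffAt_const
  have h1 : JetEq r (η ∘ fun w => e'.base (e.base.symm w))
      ((0 : Eu (m + 1) → Fin N → ℝ) ∘ fun w => e'.base (e.base.symm w)) (e.base x) :=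
    JetEq.comp_right (by rwa [hz]) (by rwa [hz]) contDiffAt_const hφ
  have hηφ : ContDiffAt ℝ ∞ (η ∘ fun w => e'.base (e.base.symm w)) (e.base x) :=
    ContDiffAt.comp (e.base x) (by rwa [hz]) hφ
  have h2 := JetEq.prodMk (JetEq.refl r (id : Eu (m + 1) → Eu (m + 1)) (e.base x)) h1
    contDiffAt_id contDiffAt_id hηφ contDiffAt_const
  have h3 := JetEq.comp_left (h := fun q : Eu (m + 1) × (Fin N → ℝ) =>
    vtrans (fieldB m N π) e' e (s (e.base.symm q.1)) q.2) h2 (contDiffAt_id.prodMk hηφ)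
    (contDiffAt_id.prodMk contDiffAt_const)
    ((ContDiffAt.comp (g := fun w => vtrans (fieldB m N π) e' e (s (e.base.symm w)))
      (e.base x, (η ∘ fun w => e'.base (e.base.symm w)) (e.base x)) hM contDiffAt_fst).clm_apply
      contDiffAt_snd)
  refine h3.trans (JetEq.of_eventuallyEq (Eventually.of_forall fun w => ?_))
  simp

/-- If the new base coordinates were affine in the old ones, the test matrix `W` would become `A W
Aᵀ` divided by the determinant, which is again symmetric. The non-affine part contributes nothing:
it vanishes to order `d`, the variation to order `r - 1`, and the product beyond order `k`. -/
theorem symTest_trans (hF : (fieldB m N π).Nice) {p : Phase m N π k} {e e' : FibredChart m N π}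
    (he : p ∈ (phaseB m N π k).dom e) (he' : p ∈ (phaseB m N π k).dom e') {x : M}
    (hpx : (phaseB m N π k).proj p = x) {r d : ℕ}
    (hd : k + 1 ≤ d + (r - 1))
    (hφ : JetEq d (fun w => e'.base (e.base.symm w)) (fun w => e'.base x +
      fderiv ℝ (fun w => e'.base (e.base.symm w)) (e.base x) (w - e.base x)) (e.base x))
    (h : SymTest r (momC e p) (e.base x)) : SymTest r (momC e' p) (e'.base x) := by
  obtain ⟨s, hs, hp⟩ := p.1.exists_rep
  have hx0 : p.1.1 = x := hpx
  subst hx0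
  set x := p.1.1
  have he1 : s x ∈ (fieldB m N π).dom e := by
    have : p.1 ∈ (confB m N π k).dom e := he
    rw [hp] at this
    exact this
  have he1' : s x ∈ (fieldB m N π).dom e' := by
    have : p.1 ∈ (confB m N π k).dom e' := he'
    rw [hp] at this
    exact this
  have hx := hF.base_mem hs he1
  have hx' := hF.base_mem hs he1'
  have hz : e.base.symm (e.base x) = x := e.base.left_inv hx
  have hdet := FibredChart.det_ne_zero e' e hx' hx
  have hφs : ∀ᶠ w in 𝓝 (e.base x), ContDiffAt ℝ ∞ (fun w => e'.base (e.base.symm w)) w := by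
    filter_upwards [e.base.open_target.mem_nhds (e.base.map_source hx),
      e.eventually_base_symm (e.base.map_source hx) (p := fun y => y ∈ e'.base.source) (by
        rw [hz]
        exact e'.base.open_source.mem_nhds hx')] with w h1 h2
    exact e.contDiffAt_base e' h1 h2
  obtain ⟨φ, hφc, hφe⟩ := exists_contDiff_eventuallyEq hφs
  set A := fderiv ℝ (fun w => e'.base (e.base.symm w)) (e.base x) with hA
  intro η' hη' hJ
  have hηs := eventually_contDiffAt_varTrans hF hs he1' he1
    (Eventually.of_forall fun w => (hη'.contDiffAt (x := w)))
  obtain ⟨η, hηc, hηe⟩ := exists_contDiff_eventuallyEq hηs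
  have hJη : JetEq (r - 1) η 0 (e.base x) := (JetEq.of_eventuallyEq hηe).trans
    (jetEq_varTrans_zero hF hs he1 he1' hη'.contDiffAt hJ)
  let W : Fin (m + 1) → Eu (m + 1) := fun c =>
    contr (momC e p) (jc k (fun w => cdn (e.base x) c w • η w) (e.base x))
  have hW : ∀ c d, W c d = W d c := fun c d => h η hηc hJη c d
  have key : ∀ a, A.det • contr (momC e' p) (jc k (fun w => cdn (e'.base x) a w • η' w)
    (e'.base x)) =
      ∑ c, (A (ev c) a) • A (W c) := by
    intro a
    have hg : ContDiff ℝ ∞ fun w => cdn (e'.base x) a w • η' w := (contDiff_cdn _ a).smul hη'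
    rw [← contr_varTrans hF hs hp he1 he1' (Eventually.of_forall fun w => hg.contDiffAt (x := w))]
    have h1 : varTrans (fieldB m N π) e' e s (fun w => cdn (e'.base x) a w • η' w) =ᶠ[𝓝 (e.base x)]
        fun w => cdn (e'.base x) a (φ w) • η w := by
      filter_upwards [hφe, hηe] with w h1 h2
      rw [h1, h2]
      simp only [varTrans, map_smul]
    have hlin : ContDiff ℝ ∞ fun w => ∑ c, A (ev c) a * cdn (e.base x) c w :=
      ContDiff.sum fun c _ => contDiff_const.mul (contDiff_cdn _ c)
    have hcφ : ContDiff ℝ ∞ fun w => cdn (e'.base x) a (φ w) := (contDiff_cdn _ a).comp hφc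
    have h2 : JetEq d (fun w => cdn (e'.base x) a (φ w))
        (fun w => ∑ c, A (ev c) a * cdn (e.base x) c w) (e.base x) := by
      have h3 : JetEq d φ (fun w => e'.base x + A (w - e.base x)) (e.base x) :=
        (JetEq.of_eventuallyEq hφe).trans hφ
      have h4 := JetEq.comp_left (h := cdn (e'.base x) a) h3 hφc.contDiffAt (by fun_prop)
        (contDiff_cdn _ a).contDiffAt
      refine h4.trans (JetEq.of_eventuallyEq (Eventually.of_forall fun w => ?_))
      simp only [Function.comp_apply, cdn, PiLp.add_apply, add_sub_cancel_left]
      conv_lhs => rw [Eu.eq_sum (w - e.base x)]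
      simp [mul_comm]
    -- Orders of vanishing add under multiplication; this is the sole use of `hd`.
    have h5 : JetEq (k + 1) (fun w => cdn (e'.base x) a (φ w) • η w)
        (fun w => (∑ c, A (ev c) a * cdn (e.base x) c w) • η w) (e.base x) :=
      (JetEq.smul_congr hcφ hlin hηc h2 hJη).mono hd
    have h6 : (fun w => (∑ c, A (ev c) a * cdn (e.base x) c w) • η w) =
        ∑ c, (A (ev c) a) • fun w => cdn (e.base x) c w • η w := by
      ext w : 1
      simp only [Finset.sum_apply, Finset.sum_smul, Pi.smul_apply, smul_smul]
    have h7 : ∀ c, ContDiffAt ℝ ∞ (fun w => cdn (e.base x) c w • η w) (e.base x) := fun c =>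
      ((contDiff_cdn _ c).smul hηc).contDiffAt
    have h8 : ∀ c, ContDiffAt ℝ ∞ ((A (ev c) a) • fun w => cdn (e.base x) c w • η w) (e.base x) :=
      fun c => contDiffAt_const.smul (h7 c)
    rw [jc_congr h1, h5.jc_eq, h6, jc_sum _ h8, contr_sum, map_sum]
    refine Finset.sum_congr rfl fun c _ => ?_
    rw [jc_smul _ (h7 c), contr_smul, map_smul]
  have key2 : ∀ a b, A.det *
      contr (momC e' p) (jc k (fun w => cdn (e'.base x) a w • η' w) (e'.base x)) b =
      ∑ c, ∑ d, A (ev c) a * A (ev d) b * W c d := by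
    intro a b
    have h1 := congrArg (fun v : Eu (m + 1) => v b) (key a)
    simp only [PiLp.smul_apply, smul_eq_mul] at h1
    rw [h1]
    have h2 : ∀ c, A (W c) = ∑ d, W c d • A (ev d) := by
      intro c
      conv_lhs => rw [Eu.eq_sum (W c)]
      simp
    simp only [h2, WithLp.ofLp_sum, WithLp.ofLp_smul, Finset.sum_apply, Pi.smul_apply, smul_eq_mul,
      Finset.mul_sum]
    refine Finset.sum_congr rfl fun c _ => Finset.sum_congr rfl fun d _ => ?_
    ring
  intro a b
  refine mul_left_cancel₀ hdet ?_
  -- After division by the determinant, only the symmetry of `W` is left to use.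
  rw [key2, key2, Finset.sum_comm]
  refine Finset.sum_congr rfl fun c _ => Finset.sum_congr rfl fun d _ => ?_
  rw [hW d c]
  ring

theorem isSymmetricAt_iff (e : FibredChart m N π) (p : Phase m N π k) (r : ℕ) :
    (∀ l : Fin (k + 1), r ≤ l → IsSymmetricAt e p l) ↔
      momC e p ∈ symSub m N {l : Fin (k + 1) | r ≤ l} := Iff.rfl

theorem isSymmetricAt_last_trans (hF : (fieldB m N π).Nice) {p : Phase m N π k}
    {e e' : FibredChart m N π} (he : p ∈ (phaseB m N π k).dom e)
    (he' : p ∈ (phaseB m N π k).dom e') (h : IsSymmetricAt e p (Fin.last k)) :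
    IsSymmetricAt e' p (Fin.last k) := by
  have hlast : ∀ e : FibredChart m N π, (∀ l : Fin (k + 1), k ≤ l → IsSymmetricAt e p l) ↔
      IsSymmetricAt e p (Fin.last k) := by
    intro e
    refine ⟨fun h => h _ le_rfl, fun h l hl => ?_⟩
    obtain rfl : l = Fin.last k := Fin.ext (le_antisymm (Nat.lt_succ_iff.1 l.2) hl)
    exact h
  rw [← hlast, isSymmetricAt_iff,
    mem_symSub_iff_symTest k _ (e.base ((phaseB m N π k).proj p))] at h
  rw [← hlast, isSymmetricAt_iff,
    mem_symSub_iff_symTest k _ (e'.base ((phaseB m N π k).proj p))]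
  have hP := covB_nice (jetB_nice hF k)
  have hx := hP.proj_mem e p he
  have hx' := hP.proj_mem e' p he'
  have hz : e.base.symm (e.base ((phaseB m N π k).proj p)) = (phaseB m N π k).proj p :=
    e.base.left_inv hx
  -- At the top level `η` is so small at the point that only the linear part of the coordinate
  -- change is seen: `2 + (k - 1) ≥ k + 1`.
  refine symTest_trans hF he he' rfl (d := 2) (by omega) ?_ h
  exact jetEq_two_affine (congrArg e'.base hz)

theorem isSymmetricAt_trans (hF : (fieldB m N π).Nice) {p : Phase m N π k}
    {e e' : FibredChart m N π} (hb : e.base = e'.base) (he : p ∈ (phaseB m N π k).dom e)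
    (he' : p ∈ (phaseB m N π k).dom e') (h : ∀ l, IsSymmetricAt e p l) :
    ∀ l, IsSymmetricAt e' p l := by
  have hall : ∀ e : FibredChart m N π, (∀ l : Fin (k + 1), 0 ≤ (l : ℕ) → IsSymmetricAt e p l) ↔
      ∀ l, IsSymmetricAt e p l := fun e => ⟨fun h l => h l (Nat.zero_le _), fun h l _ => h l⟩
  rw [← hall, isSymmetricAt_iff e p 0,
    mem_symSub_iff_symTest 0 _ (e.base ((phaseB m N π k).proj p))] at h
  rw [← hall, isSymmetricAt_iff e' p 0,
    mem_symSub_iff_symTest 0 _ (e'.base ((phaseB m N π k).proj p))]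
  have hP := covB_nice (jetB_nice hF k)
  have hx := hP.proj_mem e p he
  -- The change of base coordinates is the identity, hence affine to any order; no vanishing of `η`
  -- is required, and all levels are covered.
  refine symTest_trans hF he he' rfl (d := k + 2) (by omega) ?_ h
  have h1 : (fun w => e'.base (e.base.symm w)) =ᶠ[𝓝 (e.base ((phaseB m N π k).proj p))] id := by
    filter_upwards [e.base.open_target.mem_nhds (e.base.map_source hx)] with w hw
    rw [← hb, e.base.right_inv hw]
    rfl
  refine JetEq.of_eventuallyEq (h1.trans (Eventually.of_forall fun w => ?_))
  rw [h1.fderiv_eq, fderiv_id, hb]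
  simp

end SymmetryInvariance

end HigherOrderPhase
end

noncomputable section

namespace HigherOrderPhase

open BundleCoords

variable {m N : ℕ} {M Φ : Type*}
  [TopologicalSpace M] [ChartedSpace (EuclideanSpace ℝ (Fin (m + 1))) M]
  [TopologicalSpace Φ] [ChartedSpace (EuclideanSpace ℝ (Fin (m + 1 + N))) Φ]
  {π : Φ → M} {k : ℕ}

/-! ### Charts adapted to sub-bundles of symmetric momenta -/

section Adapted

/-- The splitting of the coordinates into base and fibre coordinates. -/
def splitCoords (m N : ℕ) : Eu (m + 1 + N) ≃ₜ Eu (m + 1) × (Fin N → ℝ) where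
  toFun u := (WithLp.toLp 2 fun μ => u (Fin.castAdd N μ), fun K => u (Fin.natAdd (m + 1) K))
  invFun := appendCoords
  left_inv u := by
    ext i
    induction i using Fin.addCases <;> simp [appendCoords]
  right_inv p := by
    refine Prod.ext ?_ ?_
    · ext μ
      simp [appendCoords]
    · ext K
      simp [appendCoords]
  continuous_toFun := by fun_prop
  continuous_invFun := contDiff_appendCoords.continuous

theorem contDiff_splitCoords : ContDiff ℝ ∞ (splitCoords m N) := by
  refine ContDiff.prodMk ?_ ?_
  · rw [contDiff_euclidean]
    intro μ
    exact (EuclideanSpace.proj (Fin.castAdd N μ) : Eu (m + 1 + N) →L[ℝ] ℝ).contDiff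
  · rw [contDiff_pi]
    intro K
    exact (EuclideanSpace.proj (Fin.natAdd (m + 1) K) : Eu (m + 1 + N) →L[ℝ] ℝ).contDiff

/-- A change of the base coordinates, acting on base and fibre coordinates. -/
def extendBase (N : ℕ) (τ : OpenPartialHomeomorph (Eu (m + 1)) (Eu (m + 1))) :
    OpenPartialHomeomorph (Eu (m + 1 + N)) (Eu (m + 1 + N)) :=
  ((splitCoords m N).transOpenPartialHomeomorph
    (τ.prod (OpenPartialHomeomorph.refl (Fin N → ℝ)))).transHomeomorph (splitCoords m N).symm

theorem extendBase_apply (τ : OpenPartialHomeomorph (Eu (m + 1)) (Eu (m + 1)))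
    (u : Eu (m + 1 + N)) : extendBase N τ u =
      appendCoords (τ (splitCoords m N u).1, (splitCoords m N u).2) := rfl

theorem mem_extendBase_source (τ : OpenPartialHomeomorph (Eu (m + 1)) (Eu (m + 1)))
    (u : Eu (m + 1 + N)) : u ∈ (extendBase N τ).source ↔ (splitCoords m N u).1 ∈ τ.source := by
  simp [extendBase]

theorem contDiffOn_extendBase {τ : OpenPartialHomeomorph (Eu (m + 1)) (Eu (m + 1))}
    (hτ : ContDiffOn ℝ ∞ τ τ.source) :
    ContDiffOn ℝ ∞ (extendBase N τ) (extendBase N τ).source := by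
  have h1 : ContDiffOn ℝ ∞ (fun u : Eu (m + 1 + N) => τ (splitCoords m N u).1)
      (extendBase N τ).source :=
    hτ.comp contDiff_splitCoords.fst.contDiffOn fun u hu => (mem_extendBase_source τ u).1 hu
  exact contDiff_appendCoords.comp_contDiffOn (h1.prodMk contDiff_splitCoords.snd.contDiffOn)

theorem splitCoords_total {e : FibredChart m N π} {y : Φ} (hy : y ∈ e.total.source) :
    (splitCoords m N (e.total y)).1 = e.base (π y) := by
  ext μ
  exact e.coord_eq y hy μ

variable [IsManifold (𝓡 (m + 1)) ∞ M] [IsManifold (𝓡 (m + 1 + N)) ∞ Φ]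

theorem contDiffOn_transition {c c' : OpenPartialHomeomorph M (Eu (m + 1))}
    (hc : c ∈ IsManifold.maximalAtlas (𝓡 (m + 1)) ∞ M)
    (hc' : c' ∈ IsManifold.maximalAtlas (𝓡 (m + 1)) ∞ M) :
    ContDiffOn ℝ ∞ (c.symm.trans c') (c.symm.trans c').source := by
  intro z hz
  rw [OpenPartialHomeomorph.trans_source] at hz
  exact (contDiffAt_transition hc hc' hz.1 hz.2).contDiffWithinAt

/-- The base coordinates of a fibred chart may be changed. -/
theorem FibredChart.exists_base_eq (e : FibredChart m N π)
    {c : OpenPartialHomeomorph M (Eu (m + 1))}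
    (hc : c ∈ IsManifold.maximalAtlas (𝓡 (m + 1)) ∞ M) {y : Φ} (hy : y ∈ e.total.source)
    (hyc : π y ∈ c.source) : ∃ e' : FibredChart m N π, e'.base = c ∧ y ∈ e'.total.source := by
  have hsrc : ∀ y' ∈ (e.total.trans (extendBase N (e.base.symm.trans c))).source,
      y' ∈ e.total.source ∧ π y' ∈ c.source := by
    intro y' hy'
    rw [OpenPartialHomeomorph.trans_source] at hy'
    have h1 : (splitCoords m N (e.total y')).1 ∈ (e.base.symm.trans c).source :=
      (mem_extendBase_source _ _).1 hy'.2
    rw [splitCoords_total hy'.1, OpenPartialHomeomorph.trans_source] at h1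
    have h2 : e.base.symm (e.base (π y')) ∈ c.source := h1.2
    rw [e.base.left_inv (e.mapsTo y' hy'.1)] at h2
    exact ⟨hy'.1, h2⟩
  -- Apply the change of base coordinates to the first `m + 1` coordinates of the total chart and
  -- leave the fibre coordinates alone.
  refine ⟨⟨c, e.total.trans (extendBase N (e.base.symm.trans c)), hc, ?_,
    fun y' hy' => (hsrc y' hy').2, ?_⟩, rfl, ?_⟩
  · refine OpenPartialHomeomorph.mem_maximalAtlas_of_contMDiffOn (M := Φ)
      (I := 𝓡 (m + 1 + N)) (n := ∞)
      (φ := e.total.trans (extendBase N (e.base.symm.trans c))) ?_ ?_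
    · have h1 := (contDiffOn_extendBase (N := N) (contDiffOn_transition e.base_mem hc)).contMDiffOn
      rw [OpenPartialHomeomorph.trans_source]
      exact h1.comp ((contMDiffOn_of_mem_maximalAtlas e.total_mem).mono inter_subset_left)
        fun y' hy' => hy'.2
    · have h1 := (contDiffOn_extendBase (N := N) (contDiffOn_transition hc e.base_mem)).contMDiffOn
      rw [OpenPartialHomeomorph.trans_target]
      exact (contMDiffOn_symm_of_mem_maximalAtlas e.total_mem).comp (h1.mono inter_subset_left)
        fun y' hy' => hy'.2
  · intro y' hy' μ
    obtain ⟨h1, h2⟩ := hsrc y' hy'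
    change extendBase N (e.base.symm.trans c) (e.total y') (Fin.castAdd N μ) = _
    rw [extendBase_apply, splitCoords_total h1]
    simp only [appendCoords, Fin.append_left]
    change c (e.base.symm (e.base (π y'))) μ = _
    rw [e.base.left_inv (e.mapsTo y' h1)]
  · change y ∈ (e.total.trans (extendBase N (e.base.symm.trans c))).source
    rw [OpenPartialHomeomorph.trans_source]
    refine ⟨hy, (mem_extendBase_source _ _).2 ?_⟩
    rw [splitCoords_total hy, OpenPartialHomeomorph.trans_source]
    refine ⟨e.base.map_source (e.mapsTo y hy), ?_⟩
    change e.base.symm (e.base (π y)) ∈ c.source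
    rwa [e.base.left_inv (e.mapsTo y hy)]

/-- In the chart `e`, the sub-bundle `S` is given by symmetry of the momenta at the levels in
`L`. -/
def Adapted (S : Set (Phase m N π k)) (e : FibredChart m N π) (L : Set (Fin (k + 1))) : Prop :=
  ∀ p ∈ (phaseB m N π k).dom e, p ∈ S ↔ momC e p ∈ symSub m N L

/-- `S` is locally given by symmetry of the momenta at certain levels. -/
def LocallySymmetric (S : Set (Phase m N π k)) : Prop :=
  ∀ y : Φ, ∃ (e : FibredChart m N π) (L : Set (Fin (k + 1))), y ∈ e.total.source ∧ Adapted S e L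

theorem locallySymmetric_univ (hπ : ∀ y, ∃ e : FibredChart m N π, y ∈ e.total.source) :
    LocallySymmetric (univ : Set (Phase m N π k)) := by
  intro y
  obtain ⟨e, he⟩ := hπ y
  exact ⟨e, ∅, he, fun p _ => ⟨fun _ l hl => absurd hl (notMem_empty l), fun _ => mem_univ p⟩⟩

theorem locallySymmetric_topSymmetric
    (hπ : ∀ y, ∃ e : FibredChart m N π, y ∈ e.total.source) :
    LocallySymmetric (topSymmetric m N π k) := by
  intro y
  obtain ⟨e, he⟩ := hπ y
  refine ⟨e, {Fin.last k}, he, fun p hp => ⟨fun h l hl => ?_, fun h e' he' => ?_⟩⟩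
  · obtain rfl : l = Fin.last k := hl
    exact h e hp
  · exact isSymmetricAt_last_trans (fieldB_nice hπ) hp he' (h (Fin.last k) rfl)

/-- The definition tests all fibred charts over the given base chart. One of them passes through
`y`, and a change of fibre coordinates alone preserves symmetry. -/
theorem IsTotallySymmetric.locallySymmetric
    (hπ : ∀ y, ∃ e : FibredChart m N π, y ∈ e.total.source) {S : Set (Phase m N π k)}
    (hS : IsTotallySymmetric S) : LocallySymmetric S := by
  intro y
  obtain ⟨e₀, he₀⟩ := hπ y
  obtain ⟨c, hc, hyc, h⟩ := hS (π y)
  obtain ⟨e, rfl, he⟩ := e₀.exists_base_eq hc he₀ hyc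
  have hF := fieldB_nice hπ
  refine ⟨e, univ, he, fun p hp => ?_⟩
  rw [h p ((covB_nice (jetB_nice hF k)).proj_mem e p hp)]
  refine ⟨fun h l _ => h e rfl hp l, fun h e' he' hp' => ?_⟩
  exact isSymmetricAt_trans hF he'.symm hp hp' fun l => h l (mem_univ l)

end Adapted

end HigherOrderPhase
end

noncomputable section

namespace HigherOrderPhase

open BundleCoords

variable {m N : ℕ} {M Φ : Type*}
  [TopologicalSpace M] [ChartedSpace (EuclideanSpace ℝ (Fin (m + 1))) M]
  [TopologicalSpace Φ] [ChartedSpace (EuclideanSpace ℝ (Fin (m + 1 + N))) Φ]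
  {π : Φ → M} {k : ℕ} [IsManifold (𝓡 (m + 1)) ∞ M]

/-! ### Holonomic jets in coordinates -/

section Holonomic

theorem coords_ext {κ J : Type} {u v : (κ ⊕ κ × Fin (m + 1)) × J → ℝ}
    (h1 : confPart u = confPart v) (h2 : momPart u = momPart v) : u = v := by
  ext ⟨a | a, j⟩
  · exact congrFun h1 (a, j)
  · exact congrFun h2 (a, j)

/-- Difference quotients lie in the subspace, which is closed because the dimension is finite. -/
theorem fderiv_mem_of_eventually {E F : Type*} [NormedAddCommGroup E] [NormedSpace ℝ E]
    [NormedAddCommGroup F] [NormedSpace ℝ F] [FiniteDimensional ℝ F] (W : Submodule ℝ F) {f : E → F}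
    {z : E} (hf : DifferentiableAt ℝ f z) (h : ∀ᶠ w in 𝓝 z, f w ∈ W) (v : E) :
    fderiv ℝ f z v ∈ W := by
  have h1 : HasDerivAt (fun t : ℝ => f (z + t • v)) (fderiv ℝ f z v) 0 := by
    have h2 : HasDerivAt (fun t : ℝ => z + t • v) v 0 := by
      simpa using ((hasDerivAt_id (0 : ℝ)).smul_const v).const_add z
    have h3 : HasFDerivAt f (fderiv ℝ f z) (z + (0 : ℝ) • v) := by simpa using hf.hasFDerivAt
    exact h3.comp_hasDerivAt 0 h2
  have h2 := h1.tendsto_slope_zero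
  refine (W.closed_of_finiteDimensional).mem_of_tendsto h2 ?_
  have hc : ContinuousAt (fun t : ℝ => z + t • v) 0 := by fun_prop
  have h3 : ∀ᶠ t : ℝ in 𝓝 0, f (z + t • v) ∈ W := hc.eventually (by simpa using h)
  filter_upwards [h3.filter_mono nhdsWithin_le_nhds] with t ht
  simp only [zero_add, zero_smul, add_zero]
  exact W.smul_mem _ (W.sub_mem ht h.self_of_nhds)

theorem deriv_mem_of_eventually {F : Type*} [NormedAddCommGroup F] [NormedSpace ℝ F]
    [FiniteDimensional ℝ F] (W : Submodule ℝ F) {f : ℝ → F} {t : ℝ} (hf : DifferentiableAt ℝ f t)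
    (h : ∀ᶠ w in 𝓝 t, f w ∈ W) : deriv f t ∈ W := by
  rw [← fderiv_apply_one_eq_deriv]
  exact fderiv_mem_of_eventually W hf h 1

theorem jc_one_mem_symJet {L : Set (Fin (k + 1))} {f : Eu (m + 1) → MomIdx m N k → ℝ}
    {z : Eu (m + 1)} (hf : DifferentiableAt ℝ f z) (h : ∀ᶠ w in 𝓝 z, f w ∈ symSub m N L) :
    jc 1 f z ∈ symJet m N L := by
  intro j
  obtain rfl | ⟨lam, rfl⟩ := jetIdx_one_cases j
  · simp only [jc_ix0]
    exact h.self_of_nhds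
  · simp only [jc_ix1]
    exact fderiv_mem_of_eventually _ hf h _

/-- The values are linear combinations of the components of the jet, each a symmetric momentum. The
polynomial extension thus stays in the sub-bundle at every point, not only to first order. -/
theorem taylorPoly_mem_symSub {L : Set (Fin (k + 1))} {a : MomIdx m N k × JetIdx (m + 1) 1 → ℝ}
    (ha : a ∈ symJet m N L) (z w : Eu (m + 1)) : taylorPoly 1 z a w ∈ symSub m N L := by
  classical
  have h : taylorPoly 1 z a w = ∑ j : JetIdx (m + 1) 1,
      (mono z j.2.1 w / permCount j.2.1 j.2.1) • fun i => a (i, j) := by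
    ext i
    simp only [taylorPoly, Finset.sum_apply, Pi.smul_apply, smul_eq_mul]
    rw [Fintype.sum_prod_type, Finset.sum_comm]
    refine Finset.sum_congr rfl fun j _ => ?_
    rw [Finset.sum_eq_single_of_mem i (Finset.mem_univ i)]
    · simp only [vmono, Pi.smul_apply, Pi.single_eq_same, smul_eq_mul]
      ring
    · intro b _ hb
      simp only [vmono, Pi.smul_apply, Pi.single_apply, if_neg (Ne.symm hb), smul_zero, mul_zero]
  rw [h]
  exact Submodule.sum_mem (symSub m N L) fun j _ =>
    Submodule.smul_mem (symSub m N L) _ (ha j)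

/-- A section of the phase bundle lies over the jets of a section of the field bundle. -/
def Over (p : M → Phase m N π k) (s : M → Φ) (x : M) : Prop :=
  ∀ᶠ y in 𝓝 x, ∃ h : (fieldB m N π).IsSection s y, (p y).1 = Jet.mk k s h

theorem Over.mem_dom {p : M → Phase m N π k} {s : M → Φ} {x : M} (h : Over p s x)
    (e : FibredChart m N π) :
    p x ∈ (phaseB m N π k).dom e ↔ s x ∈ (fieldB m N π).dom e := by
  obtain ⟨h1, h2⟩ := h.self_of_nhds
  change (p x).1 ∈ (confB m N π k).dom e ↔ _
  rw [h2]
  rfl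

theorem Over.confPart (hF : (fieldB m N π).Nice) {p : M → Phase m N π k} {s : M → Φ} {x : M}
    (hps : Over p s x) (hp : (phaseB m N π k).IsSection p x) {e : FibredChart m N π}
    (he : s x ∈ (fieldB m N π).dom e) :
    confPart ((phaseJetB m N π k).coord e (Jet.mk 1 p hp)) =
      jc 1 (jc k ((fieldB m N π).rep e s)) (e.base x) := by
  obtain ⟨hs, hx0⟩ := hps.self_of_nhds
  have hx := hF.base_mem hs he
  have hz : e.base.symm (e.base x) = x := e.base.left_inv hx
  rw [confPart_coord_mk (jetB_nice hF k) hp ((hps.mem_dom e).2 he)]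
  refine jc_congr ?_
  filter_upwards [e.eventually_base_symm (e.base.map_source hx)
    (p := fun y => (∃ h : (fieldB m N π).IsSection s y, (p y).1 = Jet.mk k s h) ∧
      s y ∈ (fieldB m N π).dom e) (by
      rw [hz]
      exact hps.and (IsSection.eventually_dom hs he)),
    e.base.open_target.mem_nhds (e.base.map_source hx)] with w ⟨⟨hw, hw2⟩, hw3⟩ hwt
  simp only [rep]
  rw [hw2, jetB_coord_mk hw hw3, e.base.right_inv hwt]

/-- The only obstruction to realising the function as a section is its value at the point, and that
is the field coordinate of the target of `ζ`. -/
theorem exists_section_of_confPart (hF : (fieldB m N π).Nice) {ζ : PhaseJet m N π k}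
    {e : FibredChart m N π} (he : ζ ∈ (phaseJetB m N π k).dom e)
    (hc : confPart ((phaseJetB m N π k).coord e ζ) ∈ holo m (Fin N) k) :
    ∃ (s : M → Φ) (_ : (fieldB m N π).IsSection s ζ.1), s ζ.1 ∈ (fieldB m N π).dom e ∧
      confPart ((phaseJetB m N π k).coord e ζ) =
        jc 1 (jc k ((fieldB m N π).rep e s)) (e.base ζ.1) := by
  have hQ := jetB_nice hF k
  have hP := covB_nice hQ
  have : Nonempty Φ := ⟨ζ.target.1.target⟩
  have hx : ζ.1 ∈ e.base.source := (jetB_nice hP 1).proj_mem e ζ he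
  obtain ⟨f, hf, hfh⟩ := exists_of_mem_holo hc (e.base ζ.1)
  have h1 := Jet.cc_target hP he
  have h2 := Jet.cc_target hF (ζ := ζ.target.1) (e := e) he
  have h3 : f (e.base ζ.1) = (fieldB m N π).coord e ζ.target.1.target := by
    have h4 := congrArg Prod.snd h2
    refine Eq.trans ?_ h4.symm
    rw [← jetVal_jc (k := k) f]
    ext i
    simp only [jetVal]
    have h5 := congrFun hfh ((i, ⟨0, sorted Fin.elim0⟩), ix0)
    rw [jc_ix0] at h5
    exact h5.trans (congrFun (congrArg Prod.snd h1) (Sum.inl (i, ⟨0, sorted Fin.elim0⟩))).symm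
  have h4 : (e.base ζ.1, f (e.base ζ.1)) ∈ (fieldB m N π).range e := by
    refine ⟨ζ.target.1.target, he, Prod.ext ?_ h3.symm⟩
    have h5 := congrArg Prod.fst h1
    exact (congrArg Prod.fst h2).trans h5
  obtain ⟨q1, q2, q3⟩ := hF.section_of_function e (f := f) h4
    (Eventually.of_forall fun w => hf.contDiffAt)
  rw [e.base.left_inv hx] at q1
  refine ⟨_, q1, inv_mem h4, ?_⟩
  rw [← hfh]
  exact jc_congr (q3.eventually_nhds.mono fun w hw => (jc_congr hw).symm)

/-- Over the prolongation of `s`, take the momenta to be the Taylor polynomial of the given jet. The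
explicit form is kept in the conclusion in order to see that symmetric jets come from symmetric
sections. -/
theorem exists_lift (hF : (fieldB m N π).Nice) {s : M → Φ} {ζ : PhaseJet m N π k}
    (hs : (fieldB m N π).IsSection s ζ.1) {e : FibredChart m N π}
    (hse : s ζ.1 ∈ (fieldB m N π).dom e) (he : ζ ∈ (phaseJetB m N π k).dom e)
    (hc : confPart ((phaseJetB m N π k).coord e ζ) =
        jc 1 (jc k ((fieldB m N π).rep e s)) (e.base ζ.1)) :
    ∃ (p : M → Phase m N π k) (hp : (phaseB m N π k).IsSection p ζ.1), ζ = Jet.mk 1 p hp ∧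
      Over p s ζ.1 ∧ ∀ᶠ y in 𝓝 ζ.1, p y ∈ (phaseB m N π k).dom e ∧ momC e (p y) =
        taylorPoly 1 (e.base ζ.1) (momPart ((phaseJetB m N π k).coord e ζ)) (e.base y) := by
  have hQ := jetB_nice hF k
  have hP := covB_nice hQ
  have : Nonempty (Phase m N π k) := ⟨ζ.target⟩
  have hx : ζ.1 ∈ e.base.source := (jetB_nice hP 1).proj_mem e ζ he
  let f := taylorPoly 1 (e.base ζ.1) (momPart ((phaseJetB m N π k).coord e ζ))
  have hf : ContDiff ℝ ∞ f := contDiff_taylorPoly _ _ _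
  have hq : jetExt k hs ζ.1 ∈ (confB m N π k).dom e := by
    rw [jetExt_eq hs hs]
    exact hse
  obtain ⟨h1, h2, h3⟩ := liftSection_spec hQ (jetExt_isSection hF (k := k) hs) hq (f := f)
    (Eventually.of_forall fun w => hf.contDiffAt)
  have hov : Over (liftSection (confB m N π k) e (jetExt k hs) f) s ζ.1 := by
    filter_upwards [h2, hF.eventually_isSection hs] with y hy hy2
    exact ⟨hy2, hy.trans (jetExt_eq hs hy2)⟩
  have hd := (hov.mem_dom e).2 hse
  have hmom : (fun w => momC e (liftSection (confB m N π k) e (jetExt k hs) f (e.base.symm w)))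
      =ᶠ[𝓝 (e.base ζ.1)] f := by
    filter_upwards [h3] with w hw
    ext a
    exact congrFun hw (Sum.inr a)
  refine ⟨_, h1, ?_, hov, ?_⟩
  · refine (jetB_nice hP 1).injOn e he hd (Prod.ext rfl (coords_ext ?_ ?_))
    · exact hc.trans (hov.confPart hF h1 hse).symm
    · refine Eq.trans ?_ (momPart_coord_mk hQ h1 hd).symm
      rw [jc_congr hmom, jc_taylorPoly]
      rfl
  · filter_upwards [IsSection.eventually_dom h1 (e := e) hd, e.eventually_base hx hmom,
      e.base.open_source.mem_nhds hx] with y hy hy2 hys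
    rw [e.base.left_inv hys] at hy2
    exact ⟨hy, hy2⟩

theorem LiesOver.exists_section (hF : (fieldB m N π).Nice) {ζ : PhaseJet m N π k}
    {q : Jet (fieldB m N π) (k + 1)} (h : LiesOver ζ q) {e : FibredChart m N π}
    (he : ζ ∈ (phaseJetB m N π k).dom e) :
    ∃ (s : M → Φ) (hs : (fieldB m N π).IsSection s ζ.1), s ζ.1 ∈ (fieldB m N π).dom e ∧
      q = Jet.mk (k + 1) s hs ∧ confPart ((phaseJetB m N π k).coord e ζ) =
        jc 1 (jc k ((fieldB m N π).rep e s)) (e.base ζ.1) := by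
  obtain ⟨x, s, hs, p, hp, rfl, rfl, hps⟩ := h
  have hov : Over p s x := hps
  have hse : s x ∈ (fieldB m N π).dom e := (hov.mem_dom e).1 he
  exact ⟨s, hs, hse, rfl, hov.confPart hF hp hse⟩

theorem LiesOver.of_section (hF : (fieldB m N π).Nice) {ζ : PhaseJet m N π k} {s : M → Φ}
    (hs : (fieldB m N π).IsSection s ζ.1) {e : FibredChart m N π}
    (hse : s ζ.1 ∈ (fieldB m N π).dom e) (he : ζ ∈ (phaseJetB m N π k).dom e)
    (hc : confPart ((phaseJetB m N π k).coord e ζ) =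
        jc 1 (jc k ((fieldB m N π).rep e s)) (e.base ζ.1)) :
    LiesOver ζ (Jet.mk (k + 1) s hs) := by
  obtain ⟨p, hp, hζ, hov, -⟩ := exists_lift hF hs hse he hc
  exact ⟨ζ.1, s, hs, p, hp, hζ, rfl, hov⟩

theorem confPart_mem_holo (hF : (fieldB m N π).Nice) {S : Set (Phase m N π k)}
    {ζ : PhaseJet m N π k} (h : ζ ∈ holonomic S) {e : FibredChart m N π}
    (he : ζ ∈ (phaseJetB m N π k).dom e) :
    confPart ((phaseJetB m N π k).coord e ζ) ∈ holo m (Fin N) k := by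
  obtain ⟨q, hq⟩ := h.2
  obtain ⟨s, hs, hse, -, hc⟩ := hq.exists_section hF he
  rw [hc]
  exact jc_jc_mem_holo (hF.contDiffAt_rep hs hse)

/-- In an adapted chart the holonomic jets form an open subset of a linear space. -/
theorem mem_holonomic_iff (hF : (fieldB m N π).Nice) {S : Set (Phase m N π k)}
    {e : FibredChart m N π} {L : Set (Fin (k + 1))} (hS : Adapted S e L) {ζ : PhaseJet m N π k}
    (he : ζ ∈ (phaseJetB m N π k).dom e) :
    ζ ∈ holonomic S ↔ confPart ((phaseJetB m N π k).coord e ζ) ∈ holo m (Fin N) k ∧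
      momPart ((phaseJetB m N π k).coord e ζ) ∈ symJet m N L := by
  have hQ := jetB_nice hF k
  constructor
  · intro h
    refine ⟨confPart_mem_holo hF h he, ?_⟩
    obtain ⟨x, p, hp, rfl, hpS⟩ := h.1
    have hd : (p x).1 ∈ (confB m N π k).dom e := he
    have hx : x ∈ e.base.source := (covB_nice hQ).base_mem hp (e := e) he
    have h1 := momPart_coord_mk hQ hp hd
    refine Eq.subst (motive := fun u => u ∈ symJet m N L) h1.symm (jc_one_mem_symJet
      ((contDiffAt_momC hQ hp hd).self_of_nhds.differentiableAt (by simp)) ?_)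
    refine e.eventually_base_symm (e.base.map_source hx)
        (p := fun y => momC e (p y) ∈ symSub m N L) ?_
    rw [e.base.left_inv hx]
    filter_upwards [hpS, IsSection.eventually_dom hp (e := e) he] with y hy hyd
    exact (hS _ hyd).1 hy
  · rintro ⟨hc, hm⟩
    obtain ⟨s, hs, hse, hcs⟩ := exists_section_of_confPart hF he hc
    obtain ⟨p, hp, hζ, hov, hmom⟩ := exists_lift hF hs hse he hcs
    refine ⟨⟨ζ.1, p, hp, hζ, ?_⟩, ⟨_, LiesOver.of_section hF hs hse he hcs⟩⟩
    filter_upwards [hmom] with y hy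
    rw [hS _ hy.1, hy.2]
    exact taylorPoly_mem_symSub hm _ _

end Holonomic

/-! ### Points with the same coordinates up to gauge -/

section SameLeaf

/-- In the chart `e`, two points of `J^1 P` have the same configuration coordinates, and their
momenta pair in the same way with all variations. -/
structure SameLeaf (e : FibredChart m N π) (a b : PhaseJet m N π k) : Prop where
  base : a.1 = b.1
  left_mem : a ∈ (phaseJetB m N π k).dom e
  right_mem : b ∈ (phaseJetB m N π k).dom e
  conf : confPart ((phaseJetB m N π k).coord e a) = confPart ((phaseJetB m N π k).coord e b)
  mom : ∀ h ∈ holo m (Fin N) k, pair (momPart ((phaseJetB m N π k).coord e a)) h =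
    pair (momPart ((phaseJetB m N π k).coord e b)) h

theorem SameLeaf.symm {e : FibredChart m N π} {a b : PhaseJet m N π k} (h : SameLeaf e a b) :
    SameLeaf e b a :=
  ⟨h.base.symm, h.right_mem, h.left_mem, h.conf.symm, fun u hu => (h.mom u hu).symm⟩

theorem SameLeaf.trans {e : FibredChart m N π} {a b c : PhaseJet m N π k} (h : SameLeaf e a b)
    (h' : SameLeaf e b c) : SameLeaf e a c :=
  ⟨h.base.trans h'.base, h.left_mem, h'.right_mem, h.conf.trans h'.conf,
    fun u hu => (h.mom u hu).trans (h'.mom u hu)⟩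

theorem SameLeaf.refl {e : FibredChart m N π} {a : PhaseJet m N π k}
    (h : a ∈ (phaseJetB m N π k).dom e) : SameLeaf e a a := ⟨rfl, h, h, rfl, fun _ _ => rfl⟩

/-- Both points are jets of sections of momenta over the same field section. The transformed
variation and the Jacobian factor do not depend on the momenta, and the factor is not zero. -/
theorem SameLeaf.change_chart (hF : (fieldB m N π).Nice) {e e' : FibredChart m N π}
    {a b : PhaseJet m N π k} (h : SameLeaf e a b)
    (hc : confPart ((phaseJetB m N π k).coord e a) ∈ holo m (Fin N) k)
    (ha' : a ∈ (phaseJetB m N π k).dom e') : SameLeaf e' a b := by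
  obtain ⟨hab, ha, hb, hconf, hmom⟩ := h
  obtain ⟨s, hs, hse, hcs⟩ := exists_section_of_confPart hF ha hc
  obtain ⟨p, hp, hζ, hov, -⟩ := exists_lift hF hs hse ha hcs
  obtain ⟨p', hp', hζ', hov', -⟩ := exists_lift hF (s := s) (ζ := b) (e := e) (hab ▸ hs) (hab ▸ hse)
    hb (hconf.symm.trans (hcs.trans (by rw [hab])))
  obtain ⟨x, qa⟩ := a
  obtain ⟨x', qb⟩ := b
  obtain rfl : x = x' := hab
  simp only at hs hse hp hp' hov hov' hζ hζ'
  rw [hζ] at hmom ha'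
  rw [hζ'] at hmom
  rw [hζ, hζ']
  have hse' : s x ∈ (fieldB m N π).dom e' := (hov.mem_dom e').1 ha'
  refine ⟨rfl, ha', (hov'.mem_dom e').2 hse', ?_, fun u hu => ?_⟩
  · exact (hov.confPart hF hp hse').trans (hov'.confPart hF hp' hse').symm
  · have hx := hF.base_mem hs hse
    have hx' := hF.base_mem hs hse'
    obtain ⟨η, hη, rfl⟩ := exists_of_mem_holo hu (e'.base x)
    have hη' : ∀ᶠ w in 𝓝 (e'.base x), ContDiffAt ℝ ∞ η w :=
      Eventually.of_forall fun w => hη.contDiffAt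
    have h1 := pair_trans hF hs hov hp hse' hse hη'
    have h2 := pair_trans hF hs hov' hp' hse' hse hη'
    have h3 := hmom _ (jc_jc_mem_holo (k := k)
      (eventually_contDiffAt_varTrans hF hs hse' hse hη'))
    exact mul_left_cancel₀ (FibredChart.det_ne_zero e' e hx' hx) (h1.symm.trans (h3.trans h2))

end SameLeaf

end HigherOrderPhase
end

noncomputable section

namespace HigherOrderPhase

open BundleCoords

variable {m N : ℕ} {M Φ : Type*}
  [TopologicalSpace M] [ChartedSpace (EuclideanSpace ℝ (Fin (m + 1))) M]
  [TopologicalSpace Φ] [ChartedSpace (EuclideanSpace ℝ (Fin (m + 1 + N))) Φ]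
  {π : Φ → M} {k : ℕ} [IsManifold (𝓡 (m + 1)) ∞ M]

/-! ### Leaves of the degeneracy distribution -/

section Leaves

/-- The coordinates of points of `J^1 P`. -/
abbrev JetCoords (m N k : ℕ) : Type :=
  ((Fin N × JetIdx (m + 1) k) ⊕ MomIdx m N k) × JetIdx (m + 1) 1 → ℝ

/-- Coordinates composed of configuration coordinates and momenta. -/
def joinCoords {κ J : Type} (h : κ × J → ℝ) (P : (κ × Fin (m + 1)) × J → ℝ) :
    (κ ⊕ κ × Fin (m + 1)) × J → ℝ :=
  fun a => Sum.elim (fun i => h (i, a.2)) (fun i => P (i, a.2)) a.1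

/-- The change of the momenta by a linear map. -/
def mapMom (R : (MomIdx m N k × JetIdx (m + 1) 1 → ℝ) →ₗ[ℝ] (MomIdx m N k × JetIdx (m + 1) 1 → ℝ)) :
    JetCoords m N k →ₗ[ℝ] JetCoords m N k where
  toFun u := joinCoords (confPart u) (R (momPart u))
  map_add' u v := by
    refine coords_ext rfl ?_
    change R (momPart u + momPart v) = R (momPart u) + R (momPart v)
    exact map_add R _ _
  map_smul' c u := by
    refine coords_ext rfl ?_
    change R (c • momPart u) = c • R (momPart u)
    exact map_smul R _ _

/-- The configuration coordinates, as a linear map. -/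
def confL : JetCoords m N k →ₗ[ℝ] (Fin N × JetIdx (m + 1) k) × JetIdx (m + 1) 1 → ℝ where
  toFun := confPart
  map_add' _ _ := rfl
  map_smul' _ _ := rfl

/-- The momenta, as a linear map. -/
def momPartL : JetCoords m N k →ₗ[ℝ] MomIdx m N k × JetIdx (m + 1) 1 → ℝ where
  toFun := momPart
  map_add' _ _ := rfl
  map_smul' _ _ := rfl

/-- The pairing of the momenta with a variation, as a linear map. -/
def momL (h : (Fin N × JetIdx (m + 1) k) × JetIdx (m + 1) 1 → ℝ) : JetCoords m N k →ₗ[ℝ] ℝ :=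
  ((pairL m (Fin N × JetIdx (m + 1) k)).flip h).comp momPartL

theorem hasDerivAt_linear {E F : Type*} [NormedAddCommGroup E]
    [NormedSpace ℝ E] [FiniteDimensional ℝ E] [NormedAddCommGroup F] [NormedSpace ℝ F]
    (T : E →ₗ[ℝ] F) {u : ℝ → E} {t : ℝ} (hu : DifferentiableAt ℝ u t) :
    HasDerivAt (fun t => T (u t)) (T (deriv u t)) t :=
  (LinearMap.toContinuousLinearMap T).hasFDerivAt.comp_hasDerivAt t hu.hasDerivAt

/-- Momenta are global linear coordinates; the range of the chart restricts the configuration only.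
-/
theorem phaseJet_range (hF : (fieldB m N π).Nice) (e : FibredChart m N π) {z : Eu (m + 1)}
    {u v : JetCoords m N k} (h : confPart u = confPart v)
    (hu : (z, u) ∈ (phaseJetB m N π k).range e) : (z, v) ∈ (phaseJetB m N π k).range e := by
  have hQ := jetB_nice hF k
  have hP := covB_nice hQ
  rw [jetB_range hP, covB_range hQ] at hu ⊢
  have h1 : jetVal u ∘ Sum.inl = jetVal v ∘ Sum.inl := by
    ext i
    exact congrFun h (i, ix0)
  simp only at hu ⊢
  rwa [← h1]

theorem phaseJetB_nice (hF : (fieldB m N π).Nice) : (phaseJetB m N π k).Nice :=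
  jetB_nice (covB_nice (jetB_nice hF k)) 1

theorem eq_of_coord_eq (hF : (fieldB m N π).Nice) {a b : PhaseJet m N π k} {e : FibredChart m N π}
    (ha : a ∈ (phaseJetB m N π k).dom e) (hb : b ∈ (phaseJetB m N π k).dom e) (hab : a.1 = b.1)
    (h : (phaseJetB m N π k).coord e a = (phaseJetB m N π k).coord e b) : a = b :=
  (phaseJetB_nice hF).injOn e ha hb (Prod.ext (congrArg e.base hab) h)

/-- The point of `J^1 P` in the fibre of `ζ` with given coordinates. -/
def setCoords (e : FibredChart m N π) (ζ : PhaseJet m N π k) (u : JetCoords m N k) :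
    PhaseJet m N π k :=
  have : Nonempty (PhaseJet m N π k) := ⟨ζ⟩
  (phaseJetB m N π k).inv e (e.base ζ.1, u)

theorem setCoords_spec (hF : (fieldB m N π).Nice) {e : FibredChart m N π} {ζ : PhaseJet m N π k}
    (he : ζ ∈ (phaseJetB m N π k).dom e) {u : JetCoords m N k}
    (hu : (e.base ζ.1, u) ∈ (phaseJetB m N π k).range e) :
    setCoords e ζ u ∈ (phaseJetB m N π k).dom e ∧
      (phaseJetB m N π k).coord e (setCoords e ζ u) = u ∧ (setCoords e ζ u).1 = ζ.1 := by
  have hJ := phaseJetB_nice (k := k) hF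
  have : Nonempty (PhaseJet m N π k) := ⟨ζ⟩
  refine ⟨inv_mem hu, congrArg Prod.snd (cc_inv hu), ?_⟩
  exact (hJ.proj_inv hu).trans (e.base.left_inv (hJ.proj_mem e ζ he))

theorem setCoords_self (hF : (fieldB m N π).Nice) {e : FibredChart m N π} {ζ : PhaseJet m N π k}
    (he : ζ ∈ (phaseJetB m N π k).dom e) :
    setCoords e ζ ((phaseJetB m N π k).coord e ζ) = ζ := by
  have : Nonempty (PhaseJet m N π k) := ⟨ζ⟩
  exact (phaseJetB_nice hF).inv_cc he

theorem range_of_mem {e : FibredChart m N π} {ζ : PhaseJet m N π k}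
    (he : ζ ∈ (phaseJetB m N π k).dom e) :
    (e.base ζ.1, (phaseJetB m N π k).coord e ζ) ∈ (phaseJetB m N π k).range e := cc_mem_range he

/-- There are fibre curves with prescribed initial velocity. -/
theorem exists_fibreCurve (hF : (fieldB m N π).Nice) {S : Set (Phase m N π k)}
    {e : FibredChart m N π} {L : Set (Fin (k + 1))} (hS : Adapted S e L) {ζ : PhaseJet m N π k}
    (hζ : ζ ∈ holonomic S) (he : ζ ∈ (phaseJetB m N π k).dom e) {w : JetCoords m N k}
    (hc : confPart w ∈ holo m (Fin N) k) (hm : momPart w ∈ symJet m N L) :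
    ∃ γ : ℝ → PhaseJet m N π k, IsFibreCurve S ζ.1 γ ∧ γ 0 = ζ ∧ velocity e γ 0 = w := by
  have hJ := phaseJetB_nice (k := k) hF
  have : Nonempty (PhaseJet m N π k) := ⟨ζ⟩
  obtain ⟨hζc, hζm⟩ := (mem_holonomic_iff hF hS he).1 hζ
  let u := (phaseJetB m N π k).coord e ζ
  have hcont : ContinuousAt (fun r : ℝ => (e.base ζ.1, u + r • w)) 0 := by fun_prop
  have hnear : ∀ᶠ r : ℝ in 𝓝 0, (e.base ζ.1, u + r • w) ∈ (phaseJetB m N π k).range e :=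
    hcont.eventually (hJ.eventually_range (by simpa using range_of_mem he))
  obtain ⟨δ, hδ, hball⟩ := Metric.eventually_nhds_iff.1 hnear
  -- Fibre curves are defined for all times, while the straight line may leave the chart. The
  -- rescaled sine keeps the parameter in the admissible interval and has derivative `1` at `0`.
  let ρ : ℝ → ℝ := fun t => δ / 2 * Real.sin (t / (δ / 2))
  have hρ : ContDiff ℝ ∞ ρ := by
    have : ContDiff ℝ ∞ fun t : ℝ => t / (δ / 2) := contDiff_id.div_const _
    exact contDiff_const.mul (Real.contDiff_sin.comp this)
  have hρ0 : ρ 0 = 0 := by simp [ρ]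
  have hρ' : HasDerivAt ρ 1 0 := by
    have h1 := ((hasDerivAt_id (0 : ℝ)).div_const (δ / 2)).sin.const_mul (δ / 2)
    have h2 : δ / 2 * (Real.cos (id (0 : ℝ) / (δ / 2)) * (1 / (δ / 2))) = 1 := by
      simp [hδ.ne']
    rwa [h2] at h1
  have hr : ∀ t, (e.base ζ.1, u + ρ t • w) ∈ (phaseJetB m N π k).range e := by
    intro t
    refine hball ?_
    rw [Real.dist_eq, sub_zero, abs_mul, abs_of_pos (by positivity)]
    have := Real.abs_sin_le_one (t / (δ / 2))
    nlinarith [abs_nonneg (Real.sin (t / (δ / 2)))]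
  have hspec := fun t => setCoords_spec hF he (hr t)
  have hv : ContDiff ℝ ∞ fun t => (e.base ζ.1, u + ρ t • w) :=
    contDiff_const.prodMk (contDiff_const.add (hρ.smul contDiff_const))
  refine ⟨fun t => setCoords e ζ (u + ρ t • w), ⟨fun t => ?_, fun t => ?_, fun t => (hspec t).2.2⟩,
    ?_, ?_⟩
  · exact hJ.smoothAt_inv_comp (v := fun t => (e.base ζ.1, u + ρ t • w)) e (hr t) hv.contDiffAt
  · rw [mem_holonomic_iff hF hS (hspec t).1, (hspec t).2.1]
    exact ⟨Submodule.add_mem _ hζc (Submodule.smul_mem _ (ρ t) hc),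
      Submodule.add_mem (symJet m N L) hζm (Submodule.smul_mem (symJet m N L) (ρ t) hm)⟩
  · simp only [hρ0, zero_smul, add_zero]
    exact setCoords_self hF he
  · simp only [velocity, (hspec _).2.1]
    have h1 : HasDerivAt (fun t => u + ρ t • w) ((1 : ℝ) • w) 0 :=
      (hρ'.smul_const w).const_add u
    rw [h1.deriv, one_smul]

theorem IsFibreCurve.contDiffAt_coord {S : Set (Phase m N π k)} {x : M} {c : ℝ → PhaseJet m N π k}
    (hc : IsFibreCurve S x c) {e : FibredChart m N π} {t : ℝ}
    (he : c t ∈ (phaseJetB m N π k).dom e) :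
    (∀ᶠ s in 𝓝 t, c s ∈ (phaseJetB m N π k).dom e) ∧
      DifferentiableAt ℝ (fun s => (phaseJetB m N π k).coord e (c s)) t :=
  ⟨(hc.smooth t e he).1, ((hc.smooth t).contDiffAt_coord he).differentiableAt (by simp)⟩

theorem IsFibreCurve.confPart_velocity_mem (hF : (fieldB m N π).Nice) {S : Set (Phase m N π k)}
    {x : M} {c : ℝ → PhaseJet m N π k} (hc : IsFibreCurve S x c) {e : FibredChart m N π} {t : ℝ}
    (he : c t ∈ (phaseJetB m N π k).dom e) :
    confPart (velocity e c t) ∈ holo m (Fin N) k := by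
  obtain ⟨h1, h2⟩ := hc.contDiffAt_coord he
  have h3 := hasDerivAt_linear (confL (m := m) (N := N) (k := k)) h2
  have h4 := deriv_mem_of_eventually (holo m (Fin N) k) h3.differentiableAt
    (h1.mono fun s hs => confPart_mem_holo hF (hc.mem s) hs)
  rw [h3.deriv] at h4
  exact h4

theorem pair_zero_right (P : MomIdx m N k × JetIdx (m + 1) 1 → ℝ) : pair P 0 = 0 :=
  map_zero (pairL m (Fin N × JetIdx (m + 1) k) P)

theorem pair_add_left (P Q : MomIdx m N k × JetIdx (m + 1) 1 → ℝ)
    (h : (Fin N × JetIdx (m + 1) k) × JetIdx (m + 1) 1 → ℝ) :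
    pair (P + Q) h = pair P h + pair Q h :=
  LinearMap.congr_fun (map_add (pairL m (Fin N × JetIdx (m + 1) k)) P Q) h

theorem pair_smul_left (c : ℝ) (P : MomIdx m N k × JetIdx (m + 1) 1 → ℝ)
    (h : (Fin N × JetIdx (m + 1) k) × JetIdx (m + 1) 1 → ℝ) :
    pair (c • P) h = c * pair P h :=
  LinearMap.congr_fun (map_smul (pairL m (Fin N × JetIdx (m + 1) k)) c P) h

/-- Points with the same coordinates up to gauge lie in the same leaf. -/
theorem leafRel_of_sameLeaf (hF : (fieldB m N π).Nice) {S : Set (Phase m N π k)}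
    {e : FibredChart m N π} {L : Set (Fin (k + 1))} (hS : Adapted S e L) {a b : holonomic S}
    (h : SameLeaf e a.1 b.1) : LeafRel S a b := by
  have hJ := phaseJetB_nice (k := k) hF
  have : Nonempty (PhaseJet m N π k) := ⟨a.1⟩
  obtain ⟨a, ha⟩ := a
  obtain ⟨b, hb⟩ := b
  change SameLeaf e a b at h
  obtain ⟨hac, ham⟩ := (mem_holonomic_iff hF hS h.left_mem).1 ha
  obtain ⟨hbc, hbm⟩ := (mem_holonomic_iff hF hS h.right_mem).1 hb
  set u := (phaseJetB m N π k).coord e a with hu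
  set v := (phaseJetB m N π k).coord e b with hv
  have hconf : ∀ t : ℝ, confPart u = confPart (u + t • (v - u)) := by
    intro t
    have h1 : confPart (v - u) = 0 := by
      change confPart v - confPart u = 0
      rw [h.conf, sub_self]
    change _ = confPart u + t • confPart (v - u)
    rw [h1, smul_zero, add_zero]
  -- The segment moves momenta only, so it stays in the chart for every real `t`.
  have hr : ∀ t : ℝ, (e.base a.1, u + t • (v - u)) ∈ (phaseJetB m N π k).range e := fun t =>
    phaseJet_range hF e (hconf t) (range_of_mem h.left_mem)
  have hspec := fun t => setCoords_spec hF h.left_mem (hr t)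
  let c : ℝ → PhaseJet m N π k := fun t => setCoords e a (u + t • (v - u))
  have hcurve : IsFibreCurve S a.1 c := by
    refine ⟨fun t => ?_, fun t => ?_, fun t => (hspec t).2.2⟩
    · exact hJ.smoothAt_inv_comp (v := fun t : ℝ => (e.base a.1, u + t • (v - u))) e (hr t)
        (by fun_prop)
    · rw [mem_holonomic_iff hF hS (hspec t).1, (hspec t).2.1]
      refine ⟨hconf t ▸ hac, ?_⟩
      exact Submodule.add_mem (symJet m N L) ham
        (Submodule.smul_mem (symJet m N L) t (Submodule.sub_mem (symJet m N L) hbm ham))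
  refine ⟨a.1, c, hcurve, ?_, ?_, ?_⟩
  · simp only [c, zero_smul, add_zero]
    exact setCoords_self hF h.left_mem
  · have h1 := hspec 1
    refine eq_of_coord_eq hF h1.1 h.right_mem (h1.2.2.trans h.base) ?_
    rw [h1.2.1, one_smul, add_sub_cancel]
  · intro t γ hγ hγ0 e' he'
    -- The kernel condition has to be checked in every chart around `c t`. In each of them the
    -- configuration and the pairing functional are constant along the curve, hence have zero
    -- derivative.
    have hsame : ∀ s, SameLeaf e' (c t) (c s) := by
      intro s
      refine SameLeaf.change_chart hF (e := e) ⟨(hspec t).2.2.trans (hspec s).2.2.symm, (hspec t).1,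
        (hspec s).1, ?_, fun w hw => ?_⟩ (confPart_mem_holo hF (hcurve.mem t) (hspec t).1) he'
      · rw [(hspec t).2.1, (hspec s).2.1, ← hconf, ← hconf]
      · have h1 : ∀ s : ℝ, pair (momPart (u + s • (v - u))) w = pair (momPart u) w := by
          intro s
          have h2 := h.mom w hw
          have h3 : momL w (u + s • (v - u)) = momL w u := by
            rw [map_add, map_smul, map_sub]
            have h4 : momL w v = momL w u := h2.symm
            rw [h4, sub_self, smul_zero, add_zero]
          exact h3
        rw [(hspec t).2.1, (hspec s).2.1, h1, h1]
    have hd := (hcurve.contDiffAt_coord he').2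
    have h1 : confPart (velocity e' c t) = 0 := by
      have h2 := hasDerivAt_linear (confL (m := m) (N := N) (k := k)) hd
      have h3 : (fun s => confL ((phaseJetB m N π k).coord e' (c s))) =
          fun _ => confL ((phaseJetB m N π k).coord e' (c t)) := by
        ext s : 1
        exact (hsame s).conf.symm
      rw [h3] at h2
      exact h2.unique (hasDerivAt_const _ _)
    have he0 : γ 0 ∈ (phaseJetB m N π k).dom e' := by rwa [hγ0]
    have h4 : pair (momPart (velocity e' c t)) (confPart (velocity e' γ 0)) = 0 := by
      have h2 := hasDerivAt_linear (momL (confPart (velocity e' γ 0))) hd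
      have h3 : (fun s => momL (confPart (velocity e' γ 0)) ((phaseJetB m N π k).coord e' (c s))) =
          fun _ => momL (confPart (velocity e' γ 0)) ((phaseJetB m N π k).coord e' (c t)) := by
        ext s : 1
        exact ((hsame s).mom _ (hγ.confPart_velocity_mem hF he0)).symm
      rw [h3] at h2
      exact h2.unique (hasDerivAt_const _ _)
    rw [omega_eq_pair, h1, h4, pair_zero_right, sub_zero]

theorem exists_adapted {S : Set (Phase m N π k)} (hS : LocallySymmetric S) (ζ : PhaseJet m N π k) :
    ∃ (e : FibredChart m N π) (L : Set (Fin (k + 1))), ζ ∈ (phaseJetB m N π k).dom e ∧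
      Adapted S e L :=
  hS ζ.target.1.target

/-- A curve tangent to the degeneracy distribution stays in the same leaf, locally. -/
theorem eventually_sameLeaf (hF : (fieldB m N π).Nice) {S : Set (Phase m N π k)}
    (hS : LocallySymmetric S) {x : M} {c : ℝ → PhaseJet m N π k} (hc : IsFibreCurve S x c)
    (hker : ∀ t, ∀ γ : ℝ → PhaseJet m N π k, IsFibreCurve S x γ → γ 0 = c t →
      ∀ e, c t ∈ (phaseJetB m N π k).dom e → omega (velocity e c t) (velocity e γ 0) = 0) (t₀ : ℝ) :
    ∀ᶠ t in 𝓝 t₀, ∀ e, c t₀ ∈ (phaseJetB m N π k).dom e → SameLeaf e (c t₀) (c t) := by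
  obtain ⟨e, L, he, hSe⟩ := exists_adapted hS (c t₀)
  obtain ⟨ε, hε, hball⟩ := Metric.eventually_nhds_iff_ball.1 (hc.contDiffAt_coord he).1
  have hzero : ∀ t ∈ Metric.ball t₀ ε, confPart (velocity e c t) = 0 ∧
      ∀ h ∈ holo m (Fin N) k, pair (momPart (velocity e c t)) h = 0 := by
    intro t ht
    have hd := hball t ht
    have hom : ∀ w : JetCoords m N k, confPart w ∈ holo m (Fin N) k → momPart w ∈ symJet m N L →
        omega (velocity e c t) w = 0 := by
      intro w hw hw'
      obtain ⟨γ, hγ, hγ0, rfl⟩ := exists_fibreCurve hF hSe (hc.mem t) hd hw hw'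
      have hx : (c t).1 = x := hc.proj t
      rw [hx] at hγ
      exact hker t γ hγ hγ0 e hd
    -- Pure momentum directions that are totally symmetric are tangent to `holonomic S` whatever `L`
    -- is, and they separate holonomic jets.
    have h1 : confPart (velocity e c t) = 0 := by
      refine eq_zero_of_pair_eq_zero (hc.confPart_velocity_mem hF hd) fun P hP => ?_
      have h2 := hom (joinCoords 0 P) (Submodule.zero_mem _) (symJet_anti (subset_univ L) hP)
      rw [omega_eq_pair] at h2
      have h3 : confPart (joinCoords (m := m) (0 : (Fin N × JetIdx (m + 1) k) × JetIdx (m + 1) 1 →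
          ℝ)
        P) = 0 := rfl
      have h4 : momPart (joinCoords (m := m) (0 : (Fin N × JetIdx (m + 1) k) × JetIdx (m + 1) 1 → ℝ)
        P) = P := rfl
      rw [h3, h4, pair_zero_right, zero_sub, neg_eq_zero] at h2
      exact h2
    refine ⟨h1, fun h hh => ?_⟩
    -- Pure configuration directions show that the momentum part annihilates `holo`.
    have h2 := hom (joinCoords h 0) hh (Submodule.zero_mem (symJet m N L))
    rw [omega_eq_pair, h1, pair_zero_right, sub_zero] at h2
    exact h2
  have hdiff : ∀ t ∈ Metric.ball t₀ ε,
      DifferentiableAt ℝ (fun s => (phaseJetB m N π k).coord e (c s)) t :=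
    fun t ht => (hc.contDiffAt_coord (hball t ht)).2
  -- Linear functions of the coordinates with zero derivative along the curve are constant on the
  -- interval.
  have hconst : ∀ {F : Type} [NormedAddCommGroup F] [NormedSpace ℝ F] (T : JetCoords m N k →ₗ[ℝ] F),
      (∀ t ∈ Metric.ball t₀ ε, T (velocity e c t) = 0) → ∀ t ∈ Metric.ball t₀ ε,
      T ((phaseJetB m N π k).coord e (c t₀)) = T ((phaseJetB m N π k).coord e (c t)) := by
    intro F _ _ T hT t ht
    refine Metric.isOpen_ball.is_const_of_deriv_eq_zero (convex_ball t₀ ε).isPreconnected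
      (f := fun s => T ((phaseJetB m N π k).coord e (c s)))
      (fun s hs => (hasDerivAt_linear T (hdiff s hs)).differentiableAt.differentiableWithinAt)
      (fun s hs => ?_) (Metric.mem_ball_self hε) ht
    exact (hasDerivAt_linear T (hdiff s hs)).deriv.trans (hT s hs)
  filter_upwards [Metric.ball_mem_nhds t₀ hε] with t ht
  intro e' he'
  refine SameLeaf.change_chart hF (e := e) ⟨(hc.proj t₀).trans (hc.proj t).symm, he, hball t ht,
    hconst confL (fun s hs => (hzero s hs).1) t ht,
    fun h hh => hconst (momL h) (fun s hs => (hzero s hs).2 h hh) t ht⟩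
    (confPart_mem_holo hF (hc.mem t₀) he) he'

/-- Points in the same leaf have the same coordinates up to gauge. -/
theorem sameLeaf_of_leafRel (hF : (fieldB m N π).Nice) {S : Set (Phase m N π k)}
    (hS : LocallySymmetric S) {a b : holonomic S} (h : LeafRel S a b) (e : FibredChart m N π)
    (he : a.1 ∈ (phaseJetB m N π k).dom e) : SameLeaf e a.1 b.1 := by
  obtain ⟨x, c, hc, h0, h1, hker⟩ := h
  have hloc := eventually_sameLeaf hF hS hc hker
  rw [← h0] at he
  rw [← h0, ← h1]
  -- Connectedness of the line. For closedness the chart `e` need not contain `c t₀` a priori; a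
  -- chart around `c t₀` is compared with `e` at a nearby point of the curve.
  have hU : IsClopen {t | SameLeaf e (c 0) (c t)} := by
    constructor
    · rw [← isOpen_compl_iff, isOpen_iff_mem_nhds]
      intro t₀ ht₀
      filter_upwards [hloc t₀] with t ht hmem
      obtain ⟨e₁, L, he₁, -⟩ := exists_adapted hS (c t₀)
      have h2 := (ht e₁ he₁).symm
      exact ht₀ (SameLeaf.trans hmem (h2.change_chart hF
        (confPart_mem_holo hF (hc.mem t) h2.left_mem) (SameLeaf.right_mem hmem)))
    · rw [isOpen_iff_mem_nhds]
      intro t₀ ht₀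
      filter_upwards [hloc t₀] with t ht
      exact SameLeaf.trans ht₀ (ht e (SameLeaf.right_mem ht₀))
  have hmem : (1 : ℝ) ∈ {t | SameLeaf e (c 0) (c t)} := by
    rw [hU.eq_univ ⟨0, SameLeaf.refl he⟩]
    trivial
  exact hmem

theorem leaf_eq_of_sameLeaf (hF : (fieldB m N π).Nice) {S : Set (Phase m N π k)}
    (hS : LocallySymmetric S) {a b : holonomic S} {e : FibredChart m N π}
    (h : SameLeaf e a.1 b.1) : leaf S a = leaf S b := by
  obtain ⟨e₁, L, he₁, hSe⟩ := exists_adapted hS a.1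
  exact Quot.sound (leafRel_of_sameLeaf hF hSe
    (h.change_chart hF (confPart_mem_holo hF a.2 h.left_mem) he₁))

/-- The quotient uses the equivalence relation generated by `LeafRel`. Along a chain of such
relations the invariants are carried on, because they can be compared in any chart around the
points. -/
theorem sameLeaf_of_leaf_eq (hF : (fieldB m N π).Nice) {S : Set (Phase m N π k)}
    (hS : LocallySymmetric S) {a b : holonomic S} (h : leaf S a = leaf S b)
    (e : FibredChart m N π) (he : a.1 ∈ (phaseJetB m N π k).dom e) : SameLeaf e a.1 b.1 := by
  have h1 := Quot.eqvGen_exact h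
  clear h
  induction h1 generalizing e with
  | rel a b h => exact sameLeaf_of_leafRel hF hS h e he
  | refl a => exact SameLeaf.refl he
  | symm a b _ ih =>
    obtain ⟨e₁, L, he₁, -⟩ := exists_adapted hS a.1
    have h2 := (ih e₁ he₁).symm
    exact h2.change_chart hF (confPart_mem_holo hF b.2 h2.left_mem) he
  | trans a b c _ _ ih ih' =>
    have h1 := ih e he
    exact h1.trans (ih' e h1.right_mem)

end Leaves

end HigherOrderPhase
end

noncomputable section

namespace HigherOrderPhase

open BundleCoords

variable {m N : ℕ} {M Φ : Type*}
  [TopologicalSpace M] [ChartedSpace (EuclideanSpace ℝ (Fin (m + 1))) M]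
  [TopologicalSpace Φ] [ChartedSpace (EuclideanSpace ℝ (Fin (m + 1 + N))) Φ]
  {π : Φ → M} {k : ℕ} [IsManifold (𝓡 (m + 1)) ∞ M]

/-! ### The isomorphism of the leaf spaces -/

section Isomorphism

/-- Every holonomic jet lies in the leaf of a symmetric one, which depends linearly
on its momenta. -/
theorem symmetrise_spec (hF : (fieldB m N π).Nice) {S : Set (Phase m N π k)}
    {e : FibredChart m N π} {L : Set (Fin (k + 1))} (hS : Adapted S e L)
    {R : (MomIdx m N k × JetIdx (m + 1) 1 → ℝ) →ₗ[ℝ] (MomIdx m N k × JetIdx (m + 1) 1 → ℝ)}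
    (hR : ∀ P, R P ∈ symJet m N L ∧ ∀ h ∈ holo m (Fin N) k, pair (R P) h = pair P h)
    {S' : Set (Phase m N π k)} {ζ : PhaseJet m N π k} (hζ : ζ ∈ holonomic S')
    (he : ζ ∈ (phaseJetB m N π k).dom e) :
    (e.base ζ.1, mapMom R ((phaseJetB m N π k).coord e ζ)) ∈ (phaseJetB m N π k).range e ∧
      setCoords e ζ (mapMom R ((phaseJetB m N π k).coord e ζ)) ∈ holonomic S ∧
      SameLeaf e ζ (setCoords e ζ (mapMom R ((phaseJetB m N π k).coord e ζ))) := by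
  have hr := phaseJet_range hF e (u := (phaseJetB m N π k).coord e ζ)
    (v := mapMom R ((phaseJetB m N π k).coord e ζ)) rfl (range_of_mem he)
  obtain ⟨h1, h2, h3⟩ := setCoords_spec hF he hr
  refine ⟨hr, (mem_holonomic_iff hF hS h1).2 ?_, h3.symm, he, h1, ?_, fun h hh => ?_⟩
  · rw [h2]
    exact ⟨confPart_mem_holo hF hζ he, (hR _).1⟩
  · rw [h2]
    rfl
  · rw [h2]
    exact ((hR _).2 h hh).symm

theorem SameLeaf.liesOver (hF : (fieldB m N π).Nice) {e : FibredChart m N π}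
    {a b : PhaseJet m N π k} (h : SameLeaf e a b) {q : Jet (fieldB m N π) (k + 1)}
    (hq : LiesOver a q) : LiesOver b q := by
  obtain ⟨s, hs, hse, rfl, hc⟩ := hq.exists_section hF h.left_mem
  obtain ⟨xa, a⟩ := a
  obtain ⟨xb, b⟩ := b
  obtain rfl : xa = xb := h.base
  exact LiesOver.of_section (ζ := ⟨xa, b⟩) hF hs hse h.right_mem (h.conf.symm.trans hc)

theorem momC_add_smul {B : Type*} {ι : Type} [Fintype ι] {X : BundleCoords m N π B ι}
    (e : FibredChart m N π) {q : B}
    (ξ₁ ξ₂ : VertTangent X q →ₗ[ℝ] ((TangentSpace (𝓡 (m + 1)) (X.proj q)) [⋀^Fin m]→L[ℝ] ℝ))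
    (a b : ℝ) : momC e (⟨q, a • ξ₁ + b • ξ₂⟩ : Cov X) =
      a • momC e (⟨q, ξ₁⟩ : Cov X) + b • momC e (⟨q, ξ₂⟩ : Cov X) := by
  ext ⟨i, lam⟩
  change _ * (a • ξ₁ (coordVec X e q i) + b • ξ₂ (coordVec X e q i)) _ =
    a * (_ * ξ₁ (coordVec X e q i) _) + b * (_ * ξ₂ (coordVec X e q i) _)
  simp only [ContinuousAlternatingMap.add_apply, ContinuousAlternatingMap.smul_apply, smul_eq_mul]
  ring

/-- Linear combinations in coordinates. -/
theorem IsLinComb.coord (hF : (fieldB m N π).Nice) {a b : ℝ} {ζ₁ ζ₂ ζ₃ : PhaseJet m N π k}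
    (h : IsLinComb a b ζ₁ ζ₂ ζ₃) {e : FibredChart m N π} (he : ζ₁ ∈ (phaseJetB m N π k).dom e) :
    (ζ₂ ∈ (phaseJetB m N π k).dom e ∧ ζ₃ ∈ (phaseJetB m N π k).dom e) ∧ ζ₃.1 = ζ₁.1 ∧
      confPart ((phaseJetB m N π k).coord e ζ₃) = confPart ((phaseJetB m N π k).coord e ζ₁) ∧
      momPart ((phaseJetB m N π k).coord e ζ₃) =
        a • momPart ((phaseJetB m N π k).coord e ζ₁) +
          b • momPart ((phaseJetB m N π k).coord e ζ₂) := by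
  obtain ⟨x, p₁, p₂, p₃, h₁, h₂, h₃, rfl, rfl, rfl, hp⟩ := h
  have hQ := jetB_nice hF k
  have he1 : (p₁ x).1 ∈ (confB m N π k).dom e := he
  obtain ⟨h12, h13⟩ : (p₂ x).1 = (p₁ x).1 ∧ (p₃ x).1 = (p₁ x).1 := by
    obtain ⟨q, ξ₁, ξ₂, e1, e2, e3⟩ := hp.self_of_nhds
    rw [e1, e2, e3]
    exact ⟨rfl, rfl⟩
  have he2 : (p₂ x).1 ∈ (confB m N π k).dom e := h12 ▸ he1
  have he3 : (p₃ x).1 ∈ (confB m N π k).dom e := h13 ▸ he1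
  have hx : x ∈ e.base.source := (covB_nice hQ).base_mem h₁ he1
  have hnear := e.eventually_base_symm (e.base.map_source hx) ((e.base.left_inv hx).symm ▸ hp)
  refine ⟨⟨he2, he3⟩, rfl, ?_, ?_⟩
  · rw [confPart_coord_mk hQ h₃ he3, confPart_coord_mk hQ h₁ he1]
    refine jc_congr ?_
    filter_upwards [hnear] with w ⟨q, ξ₁, ξ₂, e1, e2, e3⟩
    simp only [rep, e1, e3]
  · rw [momPart_coord_mk hQ h₃ he3, momPart_coord_mk hQ h₁ he1, momPart_coord_mk hQ h₂ he2]
    have d1 := (contDiffAt_momC hQ h₁ he1).self_of_nhds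
    have d2 := (contDiffAt_momC hQ h₂ he2).self_of_nhds
    rw [← jc_smul a d1, ← jc_smul b d2, ← jc_add (f := a • _)
        (g := b • _) (d1.const_smul a) (d2.const_smul b)]
    refine jc_congr ?_
    filter_upwards [hnear] with w ⟨q, ξ₁, ξ₂, e1, e2, e3⟩
    simp only [Pi.add_apply, Pi.smul_apply, e1, e2, e3, momC_add_smul]

/-- The velocities of curves which define the same curve of leaves agree up to gauge. -/
theorem velocity_eq_of_sameLeaf {S S' : Set (Phase m N π k)} {x : M}
    {c d : ℝ → PhaseJet m N π k} (hc : IsFibreCurve S x c) (hd : IsFibreCurve S' x d)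
    {e : FibredChart m N π} (he : c 0 ∈ (phaseJetB m N π k).dom e)
    (h : ∀ t, c t ∈ (phaseJetB m N π k).dom e → SameLeaf e (c t) (d t)) :
    confPart (velocity e c 0) = confPart (velocity e d 0) ∧ ∀ w ∈ holo m (Fin N) k,
      pair (momPart (velocity e c 0)) w = pair (momPart (velocity e d 0)) w := by
  obtain ⟨h1, h2⟩ := hc.contDiffAt_coord he
  obtain ⟨-, h3⟩ := hd.contDiffAt_coord (h 0 he).right_mem
  constructor
  · have h4 := (hasDerivAt_linear confL h3).congr_of_eventuallyEq
      (f₁ := fun t => confL ((phaseJetB m N π k).coord e (c t))) (h1.mono fun t ht => (h t ht).conf)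
    exact (hasDerivAt_linear confL h2).unique h4
  · intro w hw
    have h4 := (hasDerivAt_linear (momL w) h3).congr_of_eventuallyEq
      (f₁ := fun t => momL w ((phaseJetB m N π k).coord e (c t)))
      (h1.mono fun t ht => (h t ht).mom w hw)
    exact (hasDerivAt_linear (momL w) h2).unique h4

theorem isSymplecticBundleIso (hF : (fieldB m N π).Nice) {S S' : Set (Phase m N π k)}
    (hS : LocallySymmetric S) (hS' : LocallySymmetric S') (hSS' : S ⊆ S')
    (F : Reduced S ≃ Reduced S')
    (hFS : ∀ ζ : holonomic S, F (leaf S ζ) = leaf S' ⟨ζ.1, holonomic_mono hSS' ζ.2⟩) :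
    IsSymplecticBundleIso F := by
  -- Points corresponding under `F` have the same configuration coordinates and the same pairing
  -- functional; each of the four properties is expressed by these.
  have key : ∀ (ζ : holonomic S) (η : holonomic S'), F (leaf S ζ) = leaf S' η →
      ∀ e, ζ.1 ∈ (phaseJetB m N π k).dom e → SameLeaf e ζ.1 η.1 := by
    intro ζ η h e he
    exact sameLeaf_of_leaf_eq hF hS' ((hFS ζ).symm.trans h) e he
  refine ⟨?_, ?_, ?_, ?_⟩
  · intro ζ η h q
    obtain ⟨e, L, he, -⟩ := exists_adapted hS ζ.1
    have h1 := key ζ η h e he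
    exact ⟨h1.liesOver hF, h1.symm.liesOver hF⟩
  · intro a b ζ₁ ζ₂ ζ₃ η₁ η₂ η₃ hζ hη h₁ h₂
    obtain ⟨e, L, he, -⟩ := exists_adapted hS ζ₁.1
    obtain ⟨⟨he2, he3⟩, hb, hc, hm⟩ := hζ.coord hF he
    have k1 := key ζ₁ η₁ h₁ e he
    have k2 := key ζ₂ η₂ h₂ e he2
    obtain ⟨⟨-, he3'⟩, hb', hc', hm'⟩ := hη.coord hF k1.right_mem
    rw [hFS]
    refine leaf_eq_of_sameLeaf hF hS' (e := e)
      ⟨(hb.trans k1.base).trans hb'.symm, he3, he3', (hc.trans k1.conf).trans hc'.symm, ?_⟩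
    intro h hh
    rw [hm, hm', pair_add_left, pair_add_left, pair_smul_left, pair_smul_left, pair_smul_left,
      pair_smul_left, k1.mom h hh, k2.mom h hh]
  · intro d c
    constructor
    · intro hc u
      obtain ⟨c', hc'⟩ := hc u
      refine ⟨c', hc'.mono fun w hw => ⟨hw.1, holonomic_mono hSS' hw.2.1, ?_⟩⟩
      obtain ⟨h, hw⟩ := hw.2
      exact (congrArg F hw).trans (hFS _)
    · intro hc u
      obtain ⟨c', hc'⟩ := hc u
      obtain ⟨e, L, he, hSe⟩ := exists_adapted hS (c' u)
      -- A lift into `holonomic S'` is symmetrised by one fixed linear map in one fixed chart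
      -- adapted to `S`; it remains smooth and does not leave its leaves.
      obtain ⟨R, hR⟩ := exists_symmetrisation (m := m) (N := N) L
      have : Nonempty (PhaseJet m N π k) := ⟨c' u⟩
      refine ⟨fun w => setCoords e (c' w) (mapMom R ((phaseJetB m N π k).coord e (c' w))), ?_⟩
      filter_upwards [hc', (hc'.self_of_nhds.1 e he).1] with w hw hwe
      obtain ⟨hsm, hmem, hleaf⟩ := hw
      obtain ⟨hr, h1, h2⟩ := symmetrise_spec hF hSe hR hmem hwe
      refine ⟨?_, h1, ?_⟩
      · refine (phaseJetB_nice hF).smoothAt_inv_comp (v := fun w => (e.base (c' w).1,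
          mapMom R ((phaseJetB m N π k).coord e (c' w)))) e hr ?_
        have h3 := hsm.contDiffAt_cc hwe
        exact h3.fst.prodMk
          ((LinearMap.toContinuousLinearMap (mapMom R)).contDiff.contDiffAt.comp w h3.snd)
      · refine F.injective ((hleaf.trans ?_).trans (hFS _).symm)
        exact leaf_eq_of_sameLeaf hF hS' h2
  · intro x c₁ c₂ d₁ d₂ hc₁ hc₂ hd₁ hd₂ hc hd h₁ h₂ e he
    have k1 := velocity_eq_of_sameLeaf hc₁ hd₁ he fun t ht => key _ _ (h₁ t) e ht
    have k2 := velocity_eq_of_sameLeaf hc₂ hd₂ (hc ▸ he) fun t ht => key _ _ (h₂ t) e ht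
    refine ⟨(key _ _ (h₁ 0) e he).right_mem, ?_⟩
    -- Velocities have holonomic configuration parts, so the two-form depends only on the
    -- configuration velocities and the pairing functionals, which agree for `c` and `d`.
    rw [omega_eq_pair, omega_eq_pair, k1.2 _ (hc₂.confPart_velocity_mem hF (hc ▸ he)),
      k2.2 _ (hc₁.confPart_velocity_mem hF he), k1.1, k2.1]

/-- The inclusion of symmetric momenta induces an isomorphism of the leaf spaces. -/
theorem exists_isSymplecticBundleIso (hF : (fieldB m N π).Nice) {S S' : Set (Phase m N π k)}
    (hS : LocallySymmetric S) (hS' : LocallySymmetric S') (hSS' : S ⊆ S') :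
    ∃ F : Reduced S ≃ Reduced S',
      (∀ ζ : holonomic S, F (leaf S ζ) = leaf S' ⟨ζ.1, holonomic_mono hSS' ζ.2⟩) ∧
        IsSymplecticBundleIso F := by
  let f : Reduced S → Reduced S' :=
    Quot.lift (fun ζ => leaf S' ⟨ζ.1, holonomic_mono hSS' ζ.2⟩) fun ζ η h => by
      obtain ⟨e, L, he, -⟩ := exists_adapted hS ζ.1
      exact leaf_eq_of_sameLeaf hF hS' (sameLeaf_of_leafRel hF hS h e he)
  have hf : Function.Bijective f := by
    constructor
    · rintro ⟨ζ⟩ ⟨η⟩ h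
      obtain ⟨e, L, he, -⟩ := exists_adapted hS ζ.1
      exact leaf_eq_of_sameLeaf hF hS (sameLeaf_of_leaf_eq hF hS' h e he)
    · rintro ⟨ζ⟩
      obtain ⟨e, L, he, hSe⟩ := exists_adapted hS ζ.1
      obtain ⟨R, hR⟩ := exists_symmetrisation (m := m) (N := N) L
      obtain ⟨-, h1, h2⟩ := symmetrise_spec hF hSe hR ζ.2 he
      exact ⟨leaf S ⟨_, h1⟩, leaf_eq_of_sameLeaf hF hS' h2.symm⟩
  exact ⟨Equiv.ofBijective f hf, fun _ => rfl,
    isSymplecticBundleIso hF hS hS' hSS' _ fun _ => rfl⟩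

/-- The non-symmetric parts of the momenta are pure gauge. -/
theorem DifferByNonsymmetric.sameLeaf (hF : (fieldB m N π).Nice) {e : FibredChart m N π}
    {ζ η : PhaseJet m N π k} (h : DifferByNonsymmetric e ζ η)
    (hζ : ζ ∈ (phaseJetB m N π k).dom e) (hη : η ∈ (phaseJetB m N π k).dom e) :
    SameLeaf e ζ η := by
  obtain ⟨h1, h2, h3, h4⟩ := h
  have hs : ∀ {ζ : PhaseJet m N π k}, ζ ∈ (phaseJetB m N π k).dom e → ∀ K l ν,
      symMomentum e ζ.target K l ν =
        symTens (fun a => momPart ((phaseJetB m N π k).coord e ζ) (a, ix0)) K l ν := by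
    intro ζ hζ K l ν
    have h5 : momC e ζ.target = fun a => momPart ((phaseJetB m N π k).coord e ζ) (a, ix0) := by
      ext a
      exact (congrFun (jetVal_coord hζ (covB_nice (jetB_nice hF k))) (Sum.inr a)).symm
    rw [← h5]
    rfl
  refine ⟨h1, hζ, hη, funext fun a => h2 a.1 a.2, fun h hh => ?_⟩
  exact pair_eq_of_symTens_eq (fun a lam => h3 a lam)
    (fun K l ν => by rw [← hs hζ, ← hs hη, h4]) hh

end Isomorphism

end HigherOrderPhase
end

theorem mainTheorem5 {m N k : ℕ} {M Φ : Type*}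
    [TopologicalSpace M] [ChartedSpace (EuclideanSpace ℝ (Fin (m + 1))) M]
    [IsManifold (𝓡 (m + 1)) ∞ M]
    [TopologicalSpace Φ] [ChartedSpace (EuclideanSpace ℝ (Fin (m + 1 + N))) Φ]
    [IsManifold (𝓡 (m + 1 + N)) ∞ Φ]
    (π : Φ → M) (hπ : ∀ y, ∃ e : FibredChart m N π, y ∈ e.total.source) :
    (∀ S : Set (Phase m N π k), (IsTotallySymmetric S ∨ S = topSymmetric m N π k) →
      ∃ F : Reduced S ≃ Reduced (univ : Set (Phase m N π k)),
        (∀ ζ : holonomic S,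
          F (leaf S ζ) = leaf univ ⟨ζ.1, holonomic_mono (subset_univ S) ζ.2⟩) ∧
        IsSymplecticBundleIso F) ∧
    (∀ (e : FibredChart m N π) (ζ η : holonomic (univ : Set (Phase m N π k))),
      ζ.1 ∈ (phaseJetB m N π k).dom e → η.1 ∈ (phaseJetB m N π k).dom e →
      DifferByNonsymmetric e ζ.1 η.1 → leaf univ ζ = leaf univ η) := by
  have hF := fieldB_nice hπ
  have hU := locallySymmetric_univ (k := k) hπ
  refine ⟨fun S hS => ?_, fun e ζ η hζ hη h => leaf_eq_of_sameLeaf hF hU (h.sameLeaf hF hζ hη)⟩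
  refine exists_isSymplecticBundleIso hF ?_ hU (subset_univ S)
  rcases hS with hS | rfl
  · exact hS.locallySymmetric hπ
  · exact locallySymmetric_topSymmetric hπ
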